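/- **Setting.** Fix $L>0$, $m>0$, a smooth $f:\mathbb R\to\mathbb R$ with primitive $W(y)=\int_0^y f$, and an even continuous $\theta:\mathbb R\to\mathbb R$ with $\upsilon_1|\kappa|^m\le\theta(\kappa)\le\upsilon_2|\kappa|^m$ for all $|\kappa|\ge\kappa_0$, for some $\kappa_0\in\mathbb R$ and $\upsilon_1,\upsilon_2>0$. For real $L$-periodic $u$ let $\widehat u(k)=\frac1L\int_0^L u(x)e^{-2\pi i kx/L}dx$, $(u,v)=\int_0^L uv\,dx$, $\|u\|_r^2=L\sum_{k\in\mathbb Z}(1+k^2)^r|\widehat u(k)|^2$ and $\|u\|=\|u\|_0$; for $r\ge0$ let $H^r_{per}=H^r_{per}([0,L])$ be the space of $u\in L^2_{per}([0,L])$ with $\|u\|_r<\infty$, and let $C^\infty_{per}=C^\infty_{per}([0,L])$ be the smooth $L$-periodic functions. Let $\mathcal M$ be the Fourier multiplier $\widehat{\mathcal Mu}(k)=\theta(k)\widehat u(k)$, and put $M(u)=\int_0^Lu\,dx$, $F(u)=\frac12\int_0^Lu^2dx$. Consider $$u_t+(f(u))_x-(\mathcal Mu)_x=0 .\qquad(1)$$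 **Solutions and well-posedness.** A classical solution of (1) is a function $U(t,x)$, $C^\infty$ on $[0,\infty)\times\mathbb R$ and $L$-periodic in $x$, satisfying (1) pointwise for $t\ge 0$. An $H^s$-solution is a $u\in C([0,\infty);H^s_{per})$ for which there is a sequence of classical solutions converging to $u$ in $C([0,T];H^s_{per})$ for every $T>0$. The Cauchy problem for (1) is globally well-posed in $H^s_{per}$ if every $u_0\in H^s_{per}$ is the initial value of exactly one $H^s$-solution, and the solution depends continuously on $u_0$ as a map $H^s_{per}\to C([0,T];H^s_{per})$ for every $T$. **Orbital stability.** For $\phi\in C^\infty_{per}$ let $d(u,\Omega_\phi)=\inf_{r\in\mathbb R}\|u-\phi(\cdot+r)\|_{m/2}$. Given $s\ge\frac m2$, $\phi$ is orbitally stable in $H^{m/2}_{per}$ if for every $\varepsilon>0$ there is $\delta>0$ such that, for every $u_0\in H^s_{per}$ with $\|u_0-\phi\|_{m/2}<\delta$, an $H^s$-solution $u$ with $u(0)=u_0$ exists for all $t\ge0$, and every such solution satisfies $d(u(t),\Omega_\phi)<\varepsilon$ for all $t\ge0$. **Statement.** Let $s\ge\frac m2$ and assume that the Cauchy problem for (1)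 is globally well-posed in $H^s_{per}$. If $m\le1$, assume also that the functional $u\mapsto\int_0^LW(u)\,dx$ is well defined and of class $C^2$ on $H^{m/2}_{per}$. Let $I\subset\mathbb R$ be an open interval and let $\omega,A:I\to\mathbb R$ be smooth. Let $\phi_\xi\in C^\infty_{per}$, $\xi\in I$, be a smooth curve (that is, $(\xi,x)\mapsto\phi_\xi(x)$ is $C^\infty$ on $I\times\mathbb R$) such that for every $\xi\in I$ $$\mathcal M\phi_\xi+\omega(\xi)\phi_\xi-f(\phi_\xi)+A(\xi)=0,$$ and such that the operator $\mathcal L_\xi=\mathcal M+\omega(\xi)-f'(\phi_\xi)$ on $L^2_{per}([0,L])$, with domain $H^m_{per}$, has exactly one negative eigenvalue, which is simple, and zero is a simple eigenvalue with eigenfunction $\phi_\xi'$. Fix $\xi\in I$, write $\phi=\phi_\xi$, $\mathcal L=\mathcal L_\xi$, and assume that there are $c_1,c_2>0$ with $$(\mathcal Lv,v)\ge c_1\|v\|_{m/2}^2-c_2\|v\|^2\qquad\text{for all }v\in C^\infty_{per}.$$ Let $\Phi=\partial_\xi\phi_\xi$. Then $\xi\mapsto M(\phi_\xi)$ and $\xi\mapsto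 F(\phi_\xi)$ are differentiable at $\xi$, $$(\mathcal L\Phi,\Phi)=-A'(\xi)\frac{d}{d\xi}M(\phi_\xi)-\omega'(\xi)\frac{d}{d\xi}F(\phi_\xi),$$ and if this quantity is negative, then $\phi$ is orbitally stable in $H^{m/2}_{per}$. If $A\equiv0$ and $\omega(\xi)=\xi$ on $I$ (as for solitary waves), the condition $(\mathcal L\Phi,\Phi)<0$ is equivalent to $\frac{d}{d\omega}\int_0^L\phi^2\,dx>0$. -/

import Mathlib

open Set Filter Topology MeasureTheory

noncomputable section

namespace PerWave

/-! ## Periodic Sobolev spaces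

A real `L`-periodic function is a function `ℝ → ℝ` considered on one period `(0, L]`, up to
equality almost everywhere there. -/

/-- Equality almost everywhere on a period. -/
def AEEqPer (L : ℝ) (u v : ℝ → ℝ) : Prop := u =ᵐ[volume.restrict (Ioc 0 L)] v

/-- Fourier coefficient `û(k) = (1/L) ∫₀ᴸ u(x) e^{-2πikx/L} dx`. -/
def coeff (L : ℝ) (u : ℝ → ℝ) (k : ℤ) : ℂ :=
  (1 / (L : ℂ)) *
    ∫ x in (0 : ℝ)..L, Complex.exp (-(2 * Real.pi * Complex.I * k * x / L)) * (u x : ℂ)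

/-- The `L²` inner product `(u, v) = ∫₀ᴸ u v dx`. -/
def innerPer (L : ℝ) (u v : ℝ → ℝ) : ℝ := ∫ x in (0 : ℝ)..L, u x * v x

/-- `u ∈ H^s_per([0,L])`, for `s ≥ 0`: `u ∈ L²(0,L)` and `∑ₖ (1+k²)^s |û(k)|² < ∞`. -/
def MemH (L s : ℝ) (u : ℝ → ℝ) : Prop :=
  MemLp u 2 (volume.restrict (Ioc 0 L)) ∧
    Summable fun k : ℤ => (1 + (k : ℝ) ^ 2) ^ s * ‖coeff L u k‖ ^ 2

/-- The norm of `H^s_per([0,L])`: `‖u‖_s² = L ∑ₖ (1+k²)^s |û(k)|²` (for `s = 0` it is the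
`L²(0,L)` norm, by Parseval's identity). -/
def sobNorm (L s : ℝ) (u : ℝ → ℝ) : ℝ :=
  Real.sqrt (L * ∑' k : ℤ, (1 + (k : ℝ) ^ 2) ^ s * ‖coeff L u k‖ ^ 2)

/-- `v ∈ C^∞_per([0,L])`. -/
def SmoothPer (L : ℝ) (v : ℝ → ℝ) : Prop := ContDiff ℝ (⊤ : ℕ∞) v ∧ Function.Periodic v L

/-! ### `H^s_per([0,L])` as a normed space -/

section Space

lemma integrable_exp_mul {L : ℝ} {u : ℝ → ℝ} (hu : MemLp u 2 (volume.restrict (Ioc 0 L)))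
    (k : ℤ) : Integrable
      (fun x : ℝ => Complex.exp (-(2 * Real.pi * Complex.I * k * x / L)) * (u x : ℂ))
      (volume.restrict (Ioc 0 L)) := by
  have h1 : Integrable (fun x => (u x : ℂ)) (volume.restrict (Ioc 0 L)) :=
    (hu.integrable (by norm_num)).ofReal
  refine h1.bdd_mul (c := 1) (by fun_prop) (ae_of_all _ fun x => ?_)
  have : (-(2 * Real.pi * Complex.I * k * x / L) : ℂ)
      = ((-(2 * Real.pi * k * x / L) : ℝ) : ℂ) * Complex.I := by
    push_cast; ring
  rw [this, Complex.norm_exp_ofReal_mul_I]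

lemma coeff_congr {L : ℝ} (hL : 0 < L) {u v : ℝ → ℝ} (h : AEEqPer L u v) (k : ℤ) :
    coeff L u k = coeff L v k := by
  unfold coeff
  rw [intervalIntegral.integral_of_le hL.le, intervalIntegral.integral_of_le hL.le]
  congr 1
  refine integral_congr_ae ?_
  filter_upwards [h] with x hx
  rw [hx]

lemma coeff_add {L : ℝ} (hL : 0 < L) {u v : ℝ → ℝ}
    (hu : MemLp u 2 (volume.restrict (Ioc 0 L))) (hv : MemLp v 2 (volume.restrict (Ioc 0 L)))
    (k : ℤ) : coeff L (fun x => u x + v x) k = coeff L u k + coeff L v k := by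
  unfold coeff
  simp only [intervalIntegral.integral_of_le hL.le]
  rw [← mul_add, ← integral_add (integrable_exp_mul hu k) (integrable_exp_mul hv k)]
  congr 2
  ext x
  push_cast
  ring

lemma coeff_smul (L c : ℝ) (u : ℝ → ℝ) (k : ℤ) :
    coeff L (fun x => c * u x) k = c * coeff L u k := by
  unfold coeff
  rw [mul_left_comm, ← intervalIntegral.integral_const_mul (c : ℂ)]
  congr 2
  funext x
  push_cast
  ring

lemma coeff_eq_fourierCoeffOn {L : ℝ} (hL : 0 < L) (u : ℝ → ℝ) (k : ℤ) :
    coeff L u k = fourierCoeffOn hL (fun x => (u x : ℂ)) k := by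
  rw [fourierCoeffOn_eq_integral]
  unfold coeff
  rw [sub_zero, Complex.real_smul]
  push_cast
  congr 2
  ext x
  rw [fourier_coe_apply, smul_eq_mul]
  congr 2
  push_cast
  ring

lemma ae_zero_of_coeff {L : ℝ} (hL : 0 < L) {u : ℝ → ℝ}
    (hu : MemLp u 2 (volume.restrict (Ioc 0 L))) (h : ∀ k, coeff L u k = 0) :
    AEEqPer L u 0 := by
  have h2 := hasSum_sq_fourierCoeffOn hL (f := fun x => (u x : ℂ)) hu.ofReal
  simp only [← coeff_eq_fourierCoeffOn hL, h, norm_zero, ne_eq, OfNat.ofNat_ne_zero,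
    not_false_eq_true, zero_pow, sub_zero] at h2
  have h3 := h2.unique hasSum_zero
  rw [smul_eq_mul, mul_eq_zero, or_iff_right (inv_ne_zero hL.ne'),
    intervalIntegral.integral_of_le hL.le,
    integral_eq_zero_iff_of_nonneg (fun x => by positivity)] at h3
  · filter_upwards [h3] with x hx
    simpa using hx
  · simpa using hu.integrable_sq

variable (L : ℝ) [hL : Fact (0 < L)] (s : ℝ)

/-- The linear subspace `H^s_per([0,L])` of `L²(0,L)`. -/
def sobolevSubmodule : Submodule ℝ (Lp ℝ 2 (volume.restrict (Ioc (0 : ℝ) L))) where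
  carrier := {u | MemH L s u}
  zero_mem' := by
    refine ⟨Lp.memLp _, ?_⟩
    have h0 : ∀ k, coeff L
        (((0 : Lp ℝ 2 (volume.restrict (Ioc (0 : ℝ) L))) : ℝ → ℝ)) k = 0 := fun k => by
      rw [coeff_congr hL.out (Lp.coeFn_zero ℝ 2 (volume.restrict (Ioc (0 : ℝ) L)))]
      simp [coeff]
    change Summable fun k : ℤ => (1 + (k : ℝ) ^ 2) ^ s * ‖coeff L
        (((0 : Lp ℝ 2 (volume.restrict (Ioc (0 : ℝ) L))) : ℝ → ℝ)) k‖ ^ 2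
    simp_rw [h0]
    simp
  add_mem' := by
    rintro u v ⟨hu, hu'⟩ ⟨hv, hv'⟩
    refine ⟨Lp.memLp _, ?_⟩
    refine Summable.of_nonneg_of_le (fun k => by positivity) (fun k => ?_)
      ((hu'.add hv').mul_left 2)
    rw [coeff_congr hL.out (Lp.coeFn_add u v)]
    have h1 := coeff_add hL.out hu hv k
    have h2 : coeff L (⇑u + ⇑v) k = coeff L u k + coeff L v k := h1
    rw [h2, ← mul_add, mul_left_comm]
    refine mul_le_mul_of_nonneg_left ?_ (by positivity)
    nlinarith [norm_add_le (coeff L u k) (coeff L v k), norm_nonneg (coeff L u k + coeff L v k),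
      sq_nonneg (‖coeff L u k‖ - ‖coeff L v k‖), norm_nonneg (coeff L u k),
      norm_nonneg (coeff L v k)]
  smul_mem' := by
    rintro c u ⟨hu, hu'⟩
    refine ⟨Lp.memLp _, ?_⟩
    refine (hu'.mul_left (c ^ 2)).congr fun k => ?_
    rw [coeff_congr hL.out (Lp.coeFn_smul c u)]
    have h2 : coeff L (c • ⇑u) k = c * coeff L u k := coeff_smul L c u k
    rw [h2, norm_mul, mul_pow]
    simp only [Complex.norm_real, Real.norm_eq_abs, sq_abs]
    ring

/-- The space `H^s_per([0,L])`. -/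
def Hper : Type := ↥(sobolevSubmodule L s)

instance : AddCommGroup (Hper L s) := inferInstanceAs (AddCommGroup ↥(sobolevSubmodule L s))

instance : Module ℝ (Hper L s) := inferInstanceAs (Module ℝ ↥(sobolevSubmodule L s))

variable {L s}

/-- A representative (on `(0,L]`) of an element of `H^s_per([0,L])`. -/
def Hper.fn (u : Hper L s) : ℝ → ℝ := (u.1 : ℝ → ℝ)

lemma Hper.memH (u : Hper L s) : MemH L s u.fn := u.2

lemma Hper.coeff_fn_add (u v : Hper L s) (k : ℤ) :
    coeff L (u + v).fn k = coeff L u.fn k + coeff L v.fn k := by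
  have h := coeff_congr hL.out (Lp.coeFn_add u.1 v.1) k
  exact h.trans (coeff_add hL.out u.memH.1 v.memH.1 k)

lemma Hper.coeff_fn_smul (c : ℝ) (u : Hper L s) (k : ℤ) :
    coeff L (c • u).fn k = c * coeff L u.fn k := by
  have h := coeff_congr hL.out (Lp.coeFn_smul c u.1) k
  exact h.trans (coeff_smul L c _ k)

lemma weight_sq (s : ℝ) (k : ℤ) (z : ℂ) :
    ‖((Real.sqrt L * (1 + (k : ℝ) ^ 2) ^ (s / 2) : ℝ) : ℂ) * z‖ ^ 2
      = L * ((1 + (k : ℝ) ^ 2) ^ s * ‖z‖ ^ 2) := by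
  have hk : (0 : ℝ) ≤ 1 + (k : ℝ) ^ 2 := by positivity
  rw [norm_mul, mul_pow, Complex.norm_real, Real.norm_eq_abs, sq_abs, mul_pow,
    Real.sq_sqrt hL.out.le, ← Real.rpow_natCast ((1 + (k : ℝ) ^ 2) ^ (s / 2)) 2,
    ← Real.rpow_mul hk]
  norm_num
  ring

variable (L s)

/-- The weighted sequence `(√L (1+k²)^{s/2} û(k))ₖ ∈ ℓ²` of an element of `H^s_per([0,L])`. -/
def Hper.toSeq : Hper L s →ₗ[ℝ] lp (fun _ : ℤ => ℂ) 2 where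
  toFun u := ⟨fun k => ((Real.sqrt L * (1 + (k : ℝ) ^ 2) ^ (s / 2) : ℝ) : ℂ) * coeff L u.fn k, by
    refine (memℓp_gen_iff (by norm_num)).2 ?_
    refine (u.memH.2.mul_left L).congr fun k => ?_
    rw [← weight_sq]
    norm_num⟩
  map_add' u v := by
    ext k
    change _ * coeff L (u + v).fn k = _ * _ + _ * _
    rw [Hper.coeff_fn_add, mul_add]
  map_smul' c u := by
    ext k
    change _ * coeff L (c • u).fn k = (c : ℝ) • (_ * _)
    rw [Hper.coeff_fn_smul, Complex.real_smul, mul_left_comm]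

lemma Hper.toSeq_injective : Function.Injective (Hper.toSeq L s) := by
  rw [← LinearMap.ker_eq_bot, LinearMap.ker_eq_bot']
  intro u hu
  have h : ∀ k, coeff L u.fn k = 0 := fun k => by
    have h1 : ((Real.sqrt L * (1 + (k : ℝ) ^ 2) ^ (s / 2) : ℝ) : ℂ) * coeff L u.fn k = 0 :=
      congrArg (fun w : lp (fun _ : ℤ => ℂ) 2 => (w : ℤ → ℂ) k) hu
    have hw : Real.sqrt L * (1 + (k : ℝ) ^ 2) ^ (s / 2) ≠ 0 :=
      mul_ne_zero (Real.sqrt_ne_zero'.2 hL.out) (Real.rpow_pos_of_pos (by positivity) _).ne'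
    exact (mul_eq_zero.1 h1).resolve_left (by exact_mod_cast hw)
  have h2 := ae_zero_of_coeff hL.out u.memH.1 h
  exact Subtype.ext (Lp.ext (h2.trans (Lp.coeFn_zero ℝ 2 _).symm))

instance : NormedAddCommGroup (Hper L s) :=
  NormedAddCommGroup.induced (Hper L s) (lp (fun _ : ℤ => ℂ) 2) (Hper.toSeq L s)
    (Hper.toSeq_injective L s)

instance : NormedSpace ℝ (Hper L s) :=
  NormedSpace.induced ℝ (Hper L s) (lp (fun _ : ℤ => ℂ) 2) (Hper.toSeq L s)

lemma Hper.norm_eq (u : Hper L s) : ‖u‖ = sobNorm L s u.fn := by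
  have h : ‖u‖ = ‖Hper.toSeq L s u‖ := rfl
  rw [h, lp.norm_eq_tsum_rpow (by norm_num), sobNorm, ← tsum_mul_left, Real.sqrt_eq_rpow]
  norm_num
  congr 1
  refine tsum_congr fun k => ?_
  rw [← weight_sq]
  rfl

end Space

/-! ## The equation `u_t + (f(u))_x - (𝓜u)_x = 0` -/

/-- The operator `𝓜` with symbol `θ`, on smooth periodic functions:
`(𝓜g)(x) = ∑ₖ θ(k) ĝ(k) e^{2πikx/L}` (the sum is real because `θ` is even). -/
def multiplier (L : ℝ) (θ : ℝ → ℝ) (g : ℝ → ℝ) (x : ℝ) : ℝ :=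
  (∑' k : ℤ, (θ k : ℂ) * coeff L g k *
    Complex.exp (2 * Real.pi * Complex.I * k * x / L)).re

/-- `θ` is the symbol of an operator of order `m`: even, continuous, and
`υ₁|κ|^m ≤ θ(κ) ≤ υ₂|κ|^m` for large `|κ|`. -/
def IsSymbol (θ : ℝ → ℝ) (m : ℝ) : Prop :=
  (∀ κ, θ (-κ) = θ κ) ∧ Continuous θ ∧
    ∃ κ₀ υ₁ υ₂ : ℝ, 0 < υ₁ ∧ 0 < υ₂ ∧
      ∀ κ : ℝ, κ₀ ≤ |κ| → υ₁ * |κ| ^ m ≤ θ κ ∧ θ κ ≤ υ₂ * |κ| ^ m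

/-- `U = U(t,x)` is a classical (smooth, `L`-periodic in `x`) solution of
`U_t + (f(U))_x - (𝓜U)_x = 0` for `t ≥ 0`. -/
def IsClassicalSolution (L : ℝ) (θ f : ℝ → ℝ) (U : ℝ → ℝ → ℝ) : Prop :=
  ContDiffOn ℝ (⊤ : ℕ∞) (fun p : ℝ × ℝ => U p.1 p.2) (Ici 0 ×ˢ univ) ∧
  (∀ t, 0 ≤ t → Function.Periodic (U t) L) ∧
  ∀ t, 0 ≤ t → ∀ x, HasDerivWithinAt (fun τ => U τ x)
    (-(deriv (fun y => f (U t y)) x) + deriv (multiplier L θ (U t)) x) (Ici 0) t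

/-- `u` is a global `H^s`-solution: `u ∈ C([0,∞); H^s_per([0,L]))` and `u` is the limit in
`C([0,T]; H^s_per([0,L]))`, for every `T`, of a sequence of classical solutions. (Solutions of low
regularity are understood in the usual sense of limits of smooth solutions; this keeps `f(u)`
meaningful for every `s` and every nonlinearity.) -/
def IsSolution (L : ℝ) (θ f : ℝ → ℝ) (s : ℝ) (u : ℝ → ℝ → ℝ) : Prop :=
  (∀ t, 0 ≤ t → MemH L s (u t)) ∧
  (∀ t, 0 ≤ t → Tendsto (fun τ => sobNorm L s (fun x => u τ x - u t x))
    (𝓝[Ici 0] t) (𝓝 0)) ∧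
  ∃ U : ℕ → ℝ → ℝ → ℝ, (∀ n, IsClassicalSolution L θ f (U n)) ∧
    ∀ T ε : ℝ, 0 < ε → ∃ N, ∀ n, N ≤ n → ∀ t ∈ Icc 0 T,
      sobNorm L s (fun x => U n t x - u t x) < ε

/-- The Cauchy problem is globally well-posed in `H^s_per([0,L])`: existence for all `t ≥ 0`,
uniqueness, and continuous dependence on the initial datum. -/
def GloballyWellPosed (L : ℝ) (θ f : ℝ → ℝ) (s : ℝ) : Prop :=
  (∀ u₀, MemH L s u₀ → ∃ u, IsSolution L θ f s u ∧ AEEqPer L (u 0) u₀) ∧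
  (∀ u v, IsSolution L θ f s u → IsSolution L θ f s v → AEEqPer L (u 0) (v 0) →
    ∀ t, 0 ≤ t → AEEqPer L (u t) (v t)) ∧
  (∀ u, IsSolution L θ f s u → ∀ T ε : ℝ, 0 < ε → ∃ δ : ℝ, 0 < δ ∧
    ∀ v, IsSolution L θ f s v → sobNorm L s (fun x => v 0 x - u 0 x) < δ →
      ∀ t ∈ Icc 0 T, sobNorm L s (fun x => v t x - u t x) < ε)

/-- The potential part `u ↦ ∫₀ᴸ W(u) dx` of the energy, where `W(y) = ∫₀ʸ f`, is well defined
and of class `C²` on `H^r_per([0,L])`. -/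
def PotentialC2 (L : ℝ) [Fact (0 < L)] (f : ℝ → ℝ) (r : ℝ) : Prop :=
  (∀ u : Hper L r,
    IntervalIntegrable (fun x => ∫ y in (0 : ℝ)..(u.fn x), f y) volume 0 L) ∧
  ContDiff ℝ 2 (fun u : Hper L r => ∫ x in (0 : ℝ)..L, ∫ y in (0 : ℝ)..(u.fn x), f y)

/-! ## Travelling waves, linearization, orbital stability -/

/-- `𝓜φ + ωφ - f(φ) + A = 0`. -/
def WaveEq (L : ℝ) (θ f : ℝ → ℝ) (ω A : ℝ) (φ : ℝ → ℝ) : Prop :=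
  ∀ x, multiplier L θ φ x + ω * φ x - f (φ x) + A = 0

/-- `𝓛v = 𝓜v + ωv - f'(φ)v` for smooth periodic `v`. -/
def linOp (L : ℝ) (θ f : ℝ → ℝ) (ω : ℝ) (φ v : ℝ → ℝ) (x : ℝ) : ℝ :=
  multiplier L θ v x + ω * v x - deriv f (φ x) * v x

/-- `v` lies in the domain `H^m_per([0,L])` of `𝓛 = 𝓜 + ω - f'(φ)` and `𝓛v = μv` in `L²`
(the equality is expressed through all Fourier coefficients). -/
def EigenEq (L : ℝ) (θ f : ℝ → ℝ) (m ω : ℝ) (φ : ℝ → ℝ) (μ : ℝ) (v : ℝ → ℝ) : Prop :=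
  MemH L m v ∧ ∀ k : ℤ, (θ k : ℂ) * coeff L v k + (ω : ℂ) * coeff L v k
    - coeff L (fun x => deriv f (φ x) * v x) k = (μ : ℂ) * coeff L v k

/-- `𝓛` has exactly one negative eigenvalue, and it is simple; zero is a simple eigenvalue with
eigenfunction `φ'`. -/
def SpectralCondition (L : ℝ) (θ f : ℝ → ℝ) (m ω : ℝ) (φ : ℝ → ℝ) : Prop :=
  (∃ μ : ℝ, μ < 0 ∧ ∃ χ : ℝ → ℝ, EigenEq L θ f m ω φ μ χ ∧ ¬ AEEqPer L χ 0 ∧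
    ∀ ν : ℝ, ν < 0 → ∀ v, EigenEq L θ f m ω φ ν v → ¬ AEEqPer L v 0 →
      ν = μ ∧ ∃ c : ℝ, AEEqPer L v (fun x => c * χ x)) ∧
  (EigenEq L θ f m ω φ 0 (deriv φ) ∧ ¬ AEEqPer L (deriv φ) 0 ∧
    ∀ v, EigenEq L θ f m ω φ 0 v → ∃ c : ℝ, AEEqPer L v (fun x => c * deriv φ x))

/-- The Gårding-type inequality `(𝓛v,v) ≥ c₁‖v‖_{m/2}² - c₂‖v‖²` on `C^∞_per([0,L])`. -/
def Garding (L : ℝ) (θ f : ℝ → ℝ) (m ω : ℝ) (φ : ℝ → ℝ) : Prop :=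
  ∃ c₁ c₂ : ℝ, 0 < c₁ ∧ 0 < c₂ ∧ ∀ v, SmoothPer L v →
    c₁ * sobNorm L (m / 2) v ^ 2 - c₂ * sobNorm L 0 v ^ 2 ≤ innerPer L (linOp L θ f ω φ v) v

/-- The conserved quantity `M(u) = ∫₀ᴸ u dx`. -/
def massM (L : ℝ) (u : ℝ → ℝ) : ℝ := ∫ x in (0 : ℝ)..L, u x

/-- The conserved quantity `F(u) = (1/2) ∫₀ᴸ u² dx`. -/
def massF (L : ℝ) (u : ℝ → ℝ) : ℝ := (1 / 2) * ∫ x in (0 : ℝ)..L, u x ^ 2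

/-- Distance in `H^r_per([0,L])` from `u` to the orbit `{φ(· + y) : y ∈ ℝ}`. -/
def orbitDist (L r : ℝ) (u φ : ℝ → ℝ) : ℝ :=
  ⨅ y : ℝ, sobNorm L r (fun x => u x - φ (x + y))

/-- Orbital stability of `φ` in `H^{m/2}_per([0,L])`, for the flow in `H^s_per([0,L])`. -/
def OrbitallyStable (L : ℝ) (θ f : ℝ → ℝ) (m s : ℝ) (φ : ℝ → ℝ) : Prop :=
  ∀ ε : ℝ, 0 < ε → ∃ δ : ℝ, 0 < δ ∧ ∀ u₀, MemH L s u₀ →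
    sobNorm L (m / 2) (fun x => u₀ x - φ x) < δ →
      (∃ u, IsSolution L θ f s u ∧ AEEqPer L (u 0) u₀) ∧
      ∀ u, IsSolution L θ f s u → AEEqPer L (u 0) u₀ →
        ∀ t, 0 ≤ t → orbitDist L (m / 2) (u t) φ < ε

/-- `ξ ↦ φ_ξ ∈ C^∞_per([0,L])`, `ξ ∈ I`, is a smooth curve of periodic travelling waves with
fixed period `L`, with parameters `ω(ξ)`, `A(ξ)` depending smoothly on `ξ`, and the spectral
condition holds along the curve. -/
structure SmoothWaveCurve (L : ℝ) (θ f : ℝ → ℝ) (m : ℝ) (I : Set ℝ) (ω A : ℝ → ℝ)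
    (φ : ℝ → ℝ → ℝ) : Prop where
  smooth_ω : ContDiffOn ℝ (⊤ : ℕ∞) ω I
  smooth_A : ContDiffOn ℝ (⊤ : ℕ∞) A I
  smooth_φ : ContDiffOn ℝ (⊤ : ℕ∞) (fun p : ℝ × ℝ => φ p.1 p.2) (I ×ˢ univ)
  periodic : ∀ ξ ∈ I, Function.Periodic (φ ξ) L
  wave : ∀ ξ ∈ I, WaveEq L θ f (ω ξ) (A ξ) (φ ξ)
  spectral : ∀ ξ ∈ I, SpectralCondition L θ f m (ω ξ) (φ ξ)

end PerWave

end

/-! Write `E(u) = (𝓜u, u)/2 - ∫ W(u)`. The wave equation says that `φ` is a critical point of `E +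
ωF + AM`, and `𝓛` is the second variation there. Stability would follow from positivity of `𝓛`
modulo translations, but `𝓛` has one negative direction, which has to be compensated by the
conserved quantities `M` and `F`.

Differentiating the wave equation along the curve gives `𝓛Φ = -ω'φ - A'`
(`SmoothWaveCurve.linOp_dpar`). Pairing with `Φ` yields the formula for `(𝓛Φ, Φ)`. It also shows
that `v ↦ (𝓛Φ, v)` is, up to sign, the differential at `φ` of the conserved quantity `Q = A'M +
ω'F`, with `A'` and `ω'` frozen at `ξ`. A form with a single negative direction satisfies a reversed
Cauchy–Schwarz inequality: if `(𝓛Φ, Φ) < 0`, then `(𝓛v, v) + K (𝓛Φ, v)²` is coercive modulo the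
kernel `φ'` for some large `K` (`GardingPair.coercive_add_sq`).

Hence `E + ωF + AM + K (Q - Q(φ))²` bounds the squared distance to the orbit from above near the
orbit (`exists_lyap_lower`). The neutral direction `φ'` costs nothing: the closest translate of `u`
differs from `φ` by a vector that cannot be shortened along `φ'` (`exists_modulation`). The
functional is continuous and conserved, so a solution starting near the orbit cannot cross a small
sphere around it (`orbitallyStable_of_neg`).

The spectral hypothesis concerns eigenvalues only, so the spectral gap is produced by a direct
minimization on `H^{m/2}`, using Gårding's inequality and Rellich's lemma
(`GardingPair.coercive_perp`, `Hper.rellich`). The minimizer is a weak eigenvector, and ellipticity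
of `θ` places it in `H^m` (`eigenEq_of_weak`). The second order expansion of `∫ W(u)` comes from
`H^{m/2} ⊂ L^∞` if `m > 1`, and from the `C²` hypothesis otherwise. Conservation is proved for
classical solutions and carried over to `H^s`-solutions by continuity (`IsSolution.conserved`). -/

namespace PerWave

/-! ## Coercivity of a symmetric form with one negative direction -/

section Abstract

variable {E : Type*} [NormedAddCommGroup E] [NormedSpace ℝ E]

/-- A pair of bounded symmetric forms: `J` is positive definite and compact relative to the norm, and
`B` satisfies a Gårding inequality relative to `J`. -/
structure GardingPair (B J : E →ₗ[ℝ] E →ₗ[ℝ] ℝ) : Prop where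
  symmB : ∀ u v, B u v = B v u
  symmJ : ∀ u v, J u v = J v u
  boundB : ∃ C, ∀ u v, |B u v| ≤ C * ‖u‖ * ‖v‖
  boundJ : ∃ C, ∀ u v, |J u v| ≤ C * ‖u‖ * ‖v‖
  posJ : ∀ u, u ≠ 0 → 0 < J u u
  garding : ∃ c₁ c₂ : ℝ, 0 < c₁ ∧ 0 < c₂ ∧ ∀ v, c₁ * ‖v‖ ^ 2 - c₂ * J v v ≤ B v v
  compact : ∀ (R : ℝ) (u : ℕ → E), (∀ n, ‖u n‖ ≤ R) → ∃ a : ℕ → ℕ, StrictMono a ∧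
    ∀ ε > 0, ∃ N, ∀ n ≥ N, ∀ k ≥ N, J (u (a n) - u (a k)) (u (a n) - u (a k)) < ε

lemma tendsto_form {B : E →ₗ[ℝ] E →ₗ[ℝ] ℝ} (hB : ∃ C, ∀ u v, |B u v| ≤ C * ‖u‖ * ‖v‖)
    {u v : ℕ → E} {u₀ v₀ : E} (hu : Tendsto u atTop (𝓝 u₀)) (hv : Tendsto v atTop (𝓝 v₀)) :
    Tendsto (fun n => B (u n) (v n)) atTop (𝓝 (B u₀ v₀)) := by
  obtain ⟨C, hC⟩ := hB
  let B' : E →L[ℝ] E →L[ℝ] ℝ := LinearMap.mkContinuous₂ B C hC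
  have h : Continuous fun p : E × E => B' p.1 p.2 := by fun_prop
  exact (h.tendsto (u₀, v₀)).comp (hu.prodMk_nhds hv)

lemma form_smul_self (B : E →ₗ[ℝ] E →ₗ[ℝ] ℝ) (c : ℝ) (v : E) :
    B (c • v) (c • v) = c ^ 2 * B v v := by
  simp only [map_smul, LinearMap.smul_apply, smul_eq_mul]; ring

variable {B J : E →ₗ[ℝ] E →ₗ[ℝ] ℝ}

/-- Direct method for the Rayleigh quotient `B/J` on `V`. Gårding bounds a minimizing sequence,
compactness makes a subsequence Cauchy for `J`, and the parallelogram identity makes it Cauchy in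
norm. Strong convergence is thus obtained without weak limits. -/
lemma GardingPair.exists_minimizer [CompleteSpace E] (h : GardingPair B J) {V : Submodule ℝ E}
    (hV : IsClosed (V : Set E)) (hne : ∃ v ∈ V, v ≠ 0) :
    ∃ v ∈ V, J v v = 1 ∧ ∀ w ∈ V, B v v * J w w ≤ B w w := by
  obtain ⟨c₁, c₂, hc₁, hc₂, hG⟩ := h.garding
  set S : Set ℝ := {y | ∃ w ∈ V, J w w = 1 ∧ B w w = y}
  have hlow : ∀ y ∈ S, -c₂ ≤ y := by
    rintro y ⟨w, -, hw, rfl⟩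
    have := hG w
    rw [hw] at this
    nlinarith [sq_nonneg ‖w‖]
  have hnorm : ∀ w ∈ V, w ≠ 0 → (Real.sqrt (J w w))⁻¹ • w ∈ V ∧
      J ((Real.sqrt (J w w))⁻¹ • w) ((Real.sqrt (J w w))⁻¹ • w) = 1 ∧
      B ((Real.sqrt (J w w))⁻¹ • w) ((Real.sqrt (J w w))⁻¹ • w) = B w w / J w w := by
    intro w hw h0
    have hp := h.posJ w h0
    refine ⟨V.smul_mem _ hw, ?_, ?_⟩
    · rw [form_smul_self, inv_pow, Real.sq_sqrt hp.le, inv_mul_cancel₀ hp.ne']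
    · rw [form_smul_self, inv_pow, Real.sq_sqrt hp.le, inv_mul_eq_div]
  have hSne : S.Nonempty := by
    obtain ⟨w, hw, h0⟩ := hne
    exact ⟨_, _, (hnorm w hw h0).1, (hnorm w hw h0).2.1, rfl⟩
  have hbdd : BddBelow S := ⟨-c₂, hlow⟩
  set l := sInf S with hl
  have hl2 : -c₂ ≤ l := le_csInf hSne hlow
  have hR : ∀ w ∈ V, l * J w w ≤ B w w := by
    intro w hw
    by_cases h0 : w = 0
    · simp [h0]
    have h1 := csInf_le hbdd ⟨_, (hnorm w hw h0).1, (hnorm w hw h0).2.1, (hnorm w hw h0).2.2⟩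
    rwa [← hl, le_div_iff₀ (h.posJ w h0)] at h1
  have hseq : ∀ n : ℕ, ∃ w ∈ V, J w w = 1 ∧ B w w < l + 1 / (n + 1 : ℝ) := by
    intro n
    obtain ⟨y, ⟨w, hw, hw1, rfl⟩, hy⟩ := exists_lt_of_csInf_lt hSne
      (show sInf S < l + 1 / (n + 1 : ℝ) by rw [← hl]; linarith [Nat.one_div_pos_of_nat (α := ℝ) (n := n)])
    exact ⟨w, hw, hw1, hy⟩
  choose v hvV hvJ hvB using hseq
  have hone : ∀ n : ℕ, 1 / (n + 1 : ℝ) ≤ 1 := fun n => by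
    rw [div_le_one (by positivity)]; linarith [Nat.cast_nonneg (α := ℝ) n]
  have hbound : ∀ n, ‖v n‖ ≤ Real.sqrt ((l + 1 + c₂) / c₁) := by
    intro n
    apply Real.le_sqrt_of_sq_le
    rw [le_div_iff₀ hc₁]
    have := hG (v n)
    rw [hvJ] at this
    linarith [hvB n, hone n]
  obtain ⟨a, ha, hcauchy⟩ := h.compact _ v hbound
  -- In the parallelogram identity for `B`, the sum `v n + v k` costs at least `l` times its
  -- `J`-square, which is `4` minus that of the difference. What remains of `B` on the difference is
  -- then controlled by Gårding.
  have hdiff : ∀ n k, c₁ * ‖v n - v k‖ ^ 2 ≤ 2 * (1 / (n + 1 : ℝ)) + 2 * (1 / (k + 1 : ℝ))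
      + (l + c₂) * J (v n - v k) (v n - v k) := by
    intro n k
    have h1 := hR _ (V.add_mem (hvV n) (hvV k))
    have h2 := hG (v n - v k)
    have e1 : B (v n - v k) (v n - v k) + B (v n + v k) (v n + v k)
        = 2 * B (v n) (v n) + 2 * B (v k) (v k) := by
      simp only [map_sub, map_add, LinearMap.sub_apply, LinearMap.add_apply]; ring
    have e2 : J (v n - v k) (v n - v k) + J (v n + v k) (v n + v k) = 4 := by
      have : J (v n - v k) (v n - v k) + J (v n + v k) (v n + v k)
        = 2 * J (v n) (v n) + 2 * J (v k) (v k) := by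
        simp only [map_sub, map_add, LinearMap.sub_apply, LinearMap.add_apply]; ring
      rw [this, hvJ, hvJ]; norm_num
    have e3 : l * J (v n - v k) (v n - v k) + l * J (v n + v k) (v n + v k) = l * 4 := by
      rw [← mul_add, e2]
    linarith [hvB n, hvB k]
  have hC : CauchySeq (fun n => v (a n)) := by
    rw [Metric.cauchySeq_iff]
    intro ε hε
    have hlc : 0 ≤ l + c₂ := by linarith
    obtain ⟨N₁, hN₁⟩ := hcauchy (c₁ * ε ^ 2 / (3 * (l + c₂ + 1))) (by positivity)
    obtain ⟨N₂, hN₂⟩ := exists_nat_one_div_lt (show 0 < c₁ * ε ^ 2 / 8 by positivity)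
    refine ⟨max N₁ N₂, fun n hn k hk => ?_⟩
    have small : ∀ n ≥ max N₁ N₂, 1 / ((a n : ℝ) + 1) < c₁ * ε ^ 2 / 8 := by
      intro n hn
      refine lt_of_le_of_lt ?_ hN₂
      apply one_div_le_one_div_of_le (by positivity)
      have : N₂ ≤ a n := (le_max_right _ _).trans (hn.trans (ha.id_le n))
      have : (N₂ : ℝ) ≤ a n := by exact_mod_cast this
      linarith
    have hJ := hN₁ n ((le_max_left _ _).trans hn) k ((le_max_left _ _).trans hk)
    rw [lt_div_iff₀ (by positivity)] at hJ
    have hd := hdiff (a n) (a k)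
    have h1 := small n hn
    have h2 := small k hk
    have hJ0 : 0 ≤ J (v (a n) - v (a k)) (v (a n) - v (a k)) := by
      by_cases h0 : v (a n) - v (a k) = 0
      · simp [h0]
      · exact (h.posJ _ h0).le
    rw [dist_eq_norm]
    have : c₁ * ‖v (a n) - v (a k)‖ ^ 2 < c₁ * ε ^ 2 := by
      have : 0 < c₁ * ε ^ 2 := by positivity
      nlinarith
    exact lt_of_pow_lt_pow_left₀ 2 hε.le (lt_of_mul_lt_mul_left this hc₁.le)
  obtain ⟨w, hw⟩ := cauchySeq_tendsto_of_complete hC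
  have hwV : w ∈ V := hV.mem_of_tendsto hw (Eventually.of_forall fun n => hvV _)
  have hwJ : J w w = 1 := by
    refine tendsto_nhds_unique (tendsto_form h.boundJ hw hw) ?_
    simp only [hvJ]; exact tendsto_const_nhds
  have hwB : B w w ≤ l := by
    refine le_of_tendsto_of_tendsto (tendsto_form h.boundB hw hw)
      (g := fun n => l + 1 / ((a n : ℝ) + 1)) ?_ (Eventually.of_forall fun n => (hvB _).le)
    have h0 := (tendsto_one_div_add_atTop_nhds_zero_nat (𝕜 := ℝ)).comp ha.tendsto_atTop
    simpa using h0.const_add l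
  have hwl : B w w = l := le_antisymm hwB (by simpa [hwJ] using hR w hwV)
  exact ⟨w, hwV, hwJ, by rw [hwl]; exact hR⟩

/-- A vector at which a nonnegative quadratic form vanishes is in its radical. -/
lemma form_eq_zero_of_nonneg {R : E →ₗ[ℝ] E →ₗ[ℝ] ℝ} (hs : ∀ u v, R u v = R v u)
    {V : Submodule ℝ E} (hR : ∀ w ∈ V, 0 ≤ R w w) {v : E} (hv : v ∈ V) (h0 : R v v = 0)
    {w : E} (hw : w ∈ V) : R v w = 0 := by
  by_contra hne
  have key : ∀ t : ℝ, 0 ≤ 2 * t * R v w + R w w := by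
    intro t
    have := hR _ (V.add_mem (V.smul_mem t hv) hw)
    have e : R (t • v + w) (t • v + w) = t ^ 2 * R v v + 2 * t * R v w + R w w := by
      simp only [map_add, map_smul, LinearMap.add_apply, LinearMap.smul_apply, smul_eq_mul, hs w v]
      ring
    rw [e, h0] at this
    linarith
  -- The bound in `key` is affine in `t`, and this `t` gives it the value `-1`.
  have h1 := key (-(R w w + 1) / (2 * R v w))
  have e : 2 * (-(R w w + 1) / (2 * R v w)) * R v w = -(R w w + 1) := by field_simp
  rw [e] at h1
  linarith

/-- Cauchy–Schwarz for a form that is nonnegative on a subspace. -/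
lemma form_sq_le {R : E →ₗ[ℝ] E →ₗ[ℝ] ℝ} (hs : ∀ u v, R u v = R v u)
    {V : Submodule ℝ E} (hR : ∀ w ∈ V, 0 ≤ R w w) {v w : E} (hv : v ∈ V) (hw : w ∈ V) :
    R v w ^ 2 ≤ R v v * R w w := by
  have key : ∀ t : ℝ, 0 ≤ R v v * (t * t) + (2 * R v w) * t + R w w := by
    intro t
    have := hR _ (V.add_mem (V.smul_mem t hv) hw)
    have e : R (t • v + w) (t • v + w) = R v v * (t * t) + (2 * R v w) * t + R w w := by
      simp only [map_add, map_smul, LinearMap.add_apply, LinearMap.smul_apply, smul_eq_mul, hs w v]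
      ring
    rwa [e] at this
  have := discrim_le_zero key
  rw [discrim] at this
  nlinarith

/-- The eigenvalues of `B` relative to `J` in `(-∞, 0]` are `μ < 0` and `0`, both simple, with
eigenvectors `χ` and `ψ`. -/
structure OneNegative (B J : E →ₗ[ℝ] E →ₗ[ℝ] ℝ) (χ ψ : E) (μ : ℝ) : Prop where
  neg : μ < 0
  χ_ne : χ ≠ 0
  ψ_ne : ψ ≠ 0
  eigen_χ : ∀ w, B χ w = μ * J χ w
  eigen_ψ : ∀ w, B ψ w = 0
  simple_neg : ∀ ν < 0, ∀ v, v ≠ 0 → (∀ w, B v w = ν * J v w) → ∃ c : ℝ, v = c • χ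
  simple_zero : ∀ v, (∀ w, B v w = 0) → ∃ c : ℝ, v = c • ψ

variable {χ ψ : E} {μ : ℝ}

lemma OneNegative.orthogonal (h : GardingPair B J) (hn : OneNegative B J χ ψ μ) : J χ ψ = 0 := by
  have h1 := hn.eigen_χ ψ
  rw [h.symmB, hn.eigen_ψ] at h1
  exact (mul_eq_zero.1 h1.symm).resolve_left hn.neg.ne

/-- The `J`-orthogonal complement of `χ` and `ψ`. -/
def perp (J : E →ₗ[ℝ] E →ₗ[ℝ] ℝ) (χ ψ : E) : Submodule ℝ E := (J χ).ker ⊓ (J ψ).ker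

lemma mem_perp {x : E} : x ∈ perp J χ ψ ↔ J χ x = 0 ∧ J ψ x = 0 := by
  simp [perp, Submodule.mem_inf]

lemma OneNegative.decompose (h : GardingPair B J) (hn : OneNegative B J χ ψ μ) (x : E) :
    ∃ a t : ℝ, ∃ p ∈ perp J χ ψ, x = a • χ + t • ψ + p := by
  have hχ := h.posJ χ hn.χ_ne
  have hψ := h.posJ ψ hn.ψ_ne
  have ho := hn.orthogonal h
  have ho' : J ψ χ = 0 := by rw [h.symmJ, ho]
  refine ⟨J χ x / J χ χ, J ψ x / J ψ ψ, x - (J χ x / J χ χ) • χ - (J ψ x / J ψ ψ) • ψ, ?_, by abel⟩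
  rw [mem_perp]
  simp only [map_sub, map_smul, smul_eq_mul, ho, ho']
  constructor <;> field_simp <;> ring

/-- The minimizer of `B/J` on the complement is an eigenvector on the whole space. An eigenvalue `≤
0` would make it a multiple of `χ` or `ψ`, to both of which it is `J`-orthogonal. So the minimum is
positive, and Gårding upgrades positivity relative to `J` to coercivity in norm. -/
lemma GardingPair.coercive_perp [CompleteSpace E] (h : GardingPair B J)
    (hn : OneNegative B J χ ψ μ) : ∃ c > 0, ∀ v ∈ perp J χ ψ, c * ‖v‖ ^ 2 ≤ B v v := by
  by_cases hne : ∃ v ∈ perp J χ ψ, v ≠ 0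
  swap
  · push Not at hne
    exact ⟨1, one_pos, fun v hv => by simp [hne v hv]⟩
  have hclosed : IsClosed ((perp J χ ψ : Submodule ℝ E) : Set E) := by
    obtain ⟨C, hC⟩ := h.boundJ
    let J' : E →L[ℝ] E →L[ℝ] ℝ := LinearMap.mkContinuous₂ J C hC
    have : ((perp J χ ψ : Submodule ℝ E) : Set E) = {x | J' χ x = 0} ∩ {x | J' ψ x = 0} := by
      ext x; exact mem_perp
    rw [this]
    exact (isClosed_eq (by fun_prop) continuous_const).inter
      (isClosed_eq (by fun_prop) continuous_const)
  obtain ⟨v, hv, hJ, hmin⟩ := h.exists_minimizer hclosed hne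
  set l := B v v with hl
  have hv0 : v ≠ 0 := by rintro rfl; simp at hJ
  have hvp := mem_perp.1 hv
  -- The Euler–Lagrange equation holds a priori only against `perp J χ ψ`; it extends to all `w`
  -- because both sides vanish on `χ` and `ψ`.
  have hEL : ∀ w, B v w = l * J v w := by
    have hV : ∀ w ∈ perp J χ ψ, (B - l • J) v w = 0 := fun w hw => by
      refine form_eq_zero_of_nonneg (fun a b => ?_) (fun x hx => ?_) hv ?_ hw
      · simp only [LinearMap.sub_apply, LinearMap.smul_apply, h.symmB a b, h.symmJ a b]
      · simp only [LinearMap.sub_apply, LinearMap.smul_apply, smul_eq_mul]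
        linarith [hmin x hx]
      · simp [hJ, hl]
    intro w
    obtain ⟨a, t, p, hp, rfl⟩ := hn.decompose h w
    have := hV p hp
    simp only [LinearMap.sub_apply, LinearMap.smul_apply, smul_eq_mul] at this
    have e1 : B v χ = 0 := by rw [h.symmB, hn.eigen_χ, hvp.1, mul_zero]
    have e2 : B v ψ = 0 := by rw [h.symmB, hn.eigen_ψ]
    have e3 : J v χ = 0 := by rw [h.symmJ, hvp.1]
    have e4 : J v ψ = 0 := by rw [h.symmJ, hvp.2]
    simp only [map_add, map_smul, smul_eq_mul, e1, e2, e3, e4]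
    linarith
  have hlpos : 0 < l := by
    by_contra hle
    rcases lt_or_eq_of_le (not_lt.1 hle) with hlt | heq
    · obtain ⟨c, rfl⟩ := hn.simple_neg l hlt v hv0 hEL
      have := hvp.1
      simp only [map_smul, smul_eq_mul] at this
      rcases mul_eq_zero.1 this with hc | hc
      · simp [hc] at hv0
      · exact (h.posJ χ hn.χ_ne).ne' hc
    · obtain ⟨c, rfl⟩ := hn.simple_zero v (fun w => by rw [hEL, heq, zero_mul])
      have := hvp.2
      simp only [map_smul, smul_eq_mul] at this
      rcases mul_eq_zero.1 this with hc | hc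
      · simp [hc] at hv0
      · exact (h.posJ ψ hn.ψ_ne).ne' hc
  obtain ⟨c₁, c₂, hc₁, hc₂, hG⟩ := h.garding
  -- Adding `c₂` times the minimality inequality to `l` times Gårding's inequality cancels the `J`
  -- terms.
  refine ⟨c₁ * l / (l + c₂), by positivity, fun w hw => ?_⟩
  have h1 := hmin w hw
  have h2 := hG w
  rw [div_mul_eq_mul_div, div_le_iff₀ (by positivity)]
  nlinarith

/-- If `B` is negative at some `Φ`, then `B` becomes coercive modulo `ψ` after adding a multiple of
the square of `B Φ`. -/
theorem GardingPair.coercive_add_sq [CompleteSpace E] (h : GardingPair B J)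
    (hn : OneNegative B J χ ψ μ) {Φ : E} (hΦ : B Φ Φ < 0) :
    ∃ K > 0, ∃ c > 0, ∀ v, ∃ t : ℝ, c * ‖v - t • ψ‖ ^ 2 ≤ B v v + K * B Φ v ^ 2 := by
  obtain ⟨c, hc, hcoer⟩ := h.coercive_perp hn
  have hnonneg : ∀ w ∈ perp J χ ψ, 0 ≤ B w w := fun w hw =>
    le_trans (by positivity) (hcoer w hw)
  have hχ := h.posJ χ hn.χ_ne
  have hexp : ∀ (a t b r : ℝ) (p q : E), p ∈ perp J χ ψ → q ∈ perp J χ ψ →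
      B (a • χ + t • ψ + p) (b • χ + r • ψ + q) = -(-μ * J χ χ) * a * b + B p q := by
    intro a t b r p q hp hq
    have e1 : B χ q = 0 := by rw [hn.eigen_χ, (mem_perp.1 hq).1, mul_zero]
    have e2 : B p χ = 0 := by rw [h.symmB, hn.eigen_χ, (mem_perp.1 hp).1, mul_zero]
    have e3 : B p ψ = 0 := by rw [h.symmB, hn.eigen_ψ]
    have e4 : B χ ψ = 0 := by rw [h.symmB, hn.eigen_ψ]
    have e5 : B χ χ = μ * J χ χ := hn.eigen_χ χ
    simp only [map_add, map_smul, LinearMap.add_apply, LinearMap.smul_apply, smul_eq_mul, e1, e2,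
      e3, e4, e5, hn.eigen_ψ]
    ring
  obtain ⟨a₀, t₀, p₀, hp₀, rfl⟩ := hn.decompose h Φ
  -- Here `n = -B χ χ > 0`, so in the coordinates `(a, t, p)` the form is `-n a² + B p p`.
  set n := -μ * J χ χ with hndef
  have hnpos : 0 < n := by have := hn.neg; nlinarith
  set β₀ := B p₀ p₀ with hβ₀
  have hβ₀n : 0 ≤ β₀ := hnonneg p₀ hp₀
  rw [hexp _ _ _ _ _ _ hp₀ hp₀] at hΦ
  obtain ⟨q, hq⟩ : ∃ q, q = n * a₀ * a₀ - β₀ := ⟨_, rfl⟩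
  have hqpos : 0 < q := by rw [hq]; linarith
  set s := q + β₀ with hs
  have hspos : 0 < s := by positivity
  have hs' : n * a₀ ^ 2 = s := by rw [hs, hq]; ring
  -- `q = -B Φ Φ` is the available gap and `s = n a₀²`. This Young parameter gives `η β₀ ≤ q / 2`,
  -- since `β₀ ≤ s`; half of the gap survives and makes the `θ` below smaller than `1`.
  set η := q / (2 * s) with hη
  have hηpos : 0 < η := by positivity
  set C := (1 + 1 / η) / s with hC
  have hCpos : 0 < C := by positivity
  set θ := (β₀ + q / 2) / s with hθ
  have hθ1 : θ < 1 := by rw [hθ, div_lt_one hspos]; linarith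
  have hθ0 : 0 ≤ θ := by positivity
  refine ⟨2 * C, by positivity, (1 - θ) / 2 / (2 * (‖χ‖ ^ 2 / n + 1 / c)), ?_, fun v => ?_⟩
  · have : 0 < 1 - θ := by linarith
    positivity
  obtain ⟨a, t, p, hp, rfl⟩ := hn.decompose h v
  refine ⟨t, ?_⟩
  rw [hexp _ _ _ _ _ _ hp hp, hexp _ _ _ _ _ _ hp₀ hp]
  set β := B p p with hβ
  have hβn : 0 ≤ β := hnonneg p hp
  set γ := B p₀ p with hγ
  have hCS : γ ^ 2 ≤ β₀ * β := form_sq_le h.symmB hnonneg hp₀ hp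
  obtain ⟨S, hS⟩ : ∃ S, S = -n * a₀ * a + γ := ⟨_, rfl⟩
  rw [← hS]
  -- The negative part of `v` is read off from `S = B Φ v`: since `n a₀ a = γ - S`, one has `n a² ·
  -- s = (γ - S)²`. Cauchy–Schwarz for `γ` then gives a factor `θ < 1` in front of `β`.
  have h1 : n * a ^ 2 ≤ θ * β + C * S ^ 2 := by
    have e1 : n * a ^ 2 * s = (γ - S) ^ 2 := by rw [← hs', hS]; ring
    have e2 : (γ - S) ^ 2 ≤ (1 + η) * γ ^ 2 + (1 + 1 / η) * S ^ 2 := by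
      have : 0 ≤ (η * γ + S) ^ 2 / η := by positivity
      have e : (η * γ + S) ^ 2 / η = η * γ ^ 2 + 2 * γ * S + 1 / η * S ^ 2 := by field_simp; ring
      nlinarith
    have e3 : (1 + η) * γ ^ 2 ≤ (β₀ + q / 2) * β := by
      have : η * β₀ ≤ q / 2 := by
        rw [hη, div_mul_eq_mul_div, div_le_div_iff₀ (by positivity) (by norm_num)]
        nlinarith
      calc (1 + η) * γ ^ 2 ≤ (1 + η) * (β₀ * β) := by gcongr
        _ = (β₀ + η * β₀) * β := by ring
        _ ≤ _ := by gcongr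
    have e4 : (θ * β + C * S ^ 2) * s = (β₀ + q / 2) * β + (1 + 1 / η) * S ^ 2 := by
      rw [hθ, hC]; field_simp
    refine le_of_mul_le_mul_right ?_ hspos
    rw [e4, e1]; linarith
  -- Taking `K = 2C`, twice the constant of `h1`, leaves `(1 - θ)² β / 2 + (1 + θ) C S² / 2` to
  -- spare.
  have h2 : (1 - θ) / 2 * (n * a ^ 2 + β) ≤ -n * a * a + β + 2 * C * S ^ 2 := by
    have hCS0 : 0 ≤ C * S ^ 2 := by positivity
    have i1 := mul_le_mul_of_nonneg_left h1 (show 0 ≤ (3 - θ) / 2 by linarith)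
    have i2 : 0 ≤ (1 - θ) ^ 2 * β := by positivity
    have i3 : 0 ≤ θ * (C * S ^ 2) := by positivity
    linarith
  have h3 : ‖a • χ + t • ψ + p - t • ψ‖ ^ 2 ≤ 2 * (‖χ‖ ^ 2 / n + 1 / c) * (n * a ^ 2 + β) := by
    have e : a • χ + t • ψ + p - t • ψ = a • χ + p := by abel
    rw [e]
    have e1 : ‖a • χ + p‖ ≤ |a| * ‖χ‖ + ‖p‖ := by
      refine (norm_add_le _ _).trans ?_
      rw [norm_smul, Real.norm_eq_abs]
    have e2 : ‖p‖ ^ 2 ≤ β / c := by rw [le_div_iff₀ hc, mul_comm]; exact hcoer p hp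
    have e3 : ‖a • χ + p‖ ^ 2 ≤ 2 * (a ^ 2 * ‖χ‖ ^ 2) + 2 * ‖p‖ ^ 2 := by
      have : ‖a • χ + p‖ ^ 2 ≤ (|a| * ‖χ‖ + ‖p‖) ^ 2 := by gcongr
      have e : (|a| * ‖χ‖) ^ 2 = a ^ 2 * ‖χ‖ ^ 2 := by rw [mul_pow, sq_abs]
      nlinarith [sq_nonneg (|a| * ‖χ‖ - ‖p‖)]
    have e4 : 2 * (‖χ‖ ^ 2 / n + 1 / c) * (n * a ^ 2 + β)
        = 2 * (a ^ 2 * ‖χ‖ ^ 2) + 2 * (β / c) + 2 * (‖χ‖ ^ 2 / n * β) + 2 * (n * a ^ 2 / c) := by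
      field_simp; ring
    have e5 : 0 ≤ 2 * (‖χ‖ ^ 2 / n * β) := by positivity
    have e6 : 0 ≤ 2 * (n * a ^ 2 / c) := by positivity
    rw [e4]; linarith
  refine le_trans ?_ h2
  rw [div_mul_eq_mul_div, div_le_iff₀ (by positivity)]
  have : 0 ≤ (1 - θ) / 2 := by linarith
  calc (1 - θ) / 2 * ‖a • χ + t • ψ + p - t • ψ‖ ^ 2
      ≤ (1 - θ) / 2 * (2 * (‖χ‖ ^ 2 / n + 1 / c) * (n * a ^ 2 + β)) := by gcongr
    _ = _ := by ring

/-- A bilinear form dominated by the sum of the squares of the norms is bounded. -/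
lemma form_bound {C : ℝ} (h : ∀ u v, |B u v| ≤ C * (‖u‖ ^ 2 + ‖v‖ ^ 2)) (u v : E) :
    |B u v| ≤ 2 * C * ‖u‖ * ‖v‖ := by
  by_cases hu : u = 0
  · simp [hu]
  by_cases hv : v = 0
  · simp [hv]
  have hu' := norm_pos_iff.2 hu
  have hv' := norm_pos_iff.2 hv
  have h1 := h (‖u‖⁻¹ • u) (‖v‖⁻¹ • v)
  rw [norm_smul, norm_smul, norm_inv, norm_inv, norm_norm, norm_norm, inv_mul_cancel₀ hu'.ne',
    inv_mul_cancel₀ hv'.ne'] at h1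
  simp only [map_smul, LinearMap.smul_apply, smul_eq_mul, abs_mul, abs_inv, abs_norm] at h1
  have h2 := mul_le_mul_of_nonneg_left h1 (show 0 ≤ ‖u‖ * ‖v‖ by positivity)
  calc |B u v| = ‖u‖ * ‖v‖ * (‖v‖⁻¹ * (‖u‖⁻¹ * |B u v|)) := by field_simp
    _ ≤ _ := h2
    _ = _ := by ring

end Abstract

/-! ## Fourier series of real periodic functions -/

/-- The exponential `e^{2πikx/L}`. -/
noncomputable def fchar (L : ℝ) (k : ℤ) (x : ℝ) : ℂ :=
  Complex.exp (2 * Real.pi * Complex.I * k * x / L)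

lemma fchar_eq (L : ℝ) (k : ℤ) (x : ℝ) :
    fchar L k x = Complex.exp (((2 * Real.pi * k * x / L : ℝ) : ℂ) * Complex.I) := by
  unfold fchar; congr 1; push_cast; ring

lemma norm_fchar (L : ℝ) (k : ℤ) (x : ℝ) : ‖fchar L k x‖ = 1 := by
  rw [fchar_eq, Complex.norm_exp_ofReal_mul_I]

lemma conj_fchar (L : ℝ) (k : ℤ) (x : ℝ) : (starRingEnd ℂ) (fchar L k x) = fchar L (-k) x := by
  rw [fchar_eq, fchar_eq, ← Complex.exp_conj]
  congr 1
  rw [map_mul, Complex.conj_ofReal, Complex.conj_I]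
  push_cast; ring

lemma fchar_zero (L x : ℝ) : fchar L 0 x = 1 := by simp [fchar]

lemma fchar_add (L : ℝ) (k j : ℤ) (x : ℝ) : fchar L (k + j) x = fchar L k x * fchar L j x := by
  unfold fchar; rw [← Complex.exp_add]; congr 1; push_cast; ring

lemma fchar_add_right (L : ℝ) (k : ℤ) (x y : ℝ) : fchar L k (x + y) = fchar L k x * fchar L k y := by
  unfold fchar; rw [← Complex.exp_add]; congr 1; push_cast; ring

lemma fchar_period {L : ℝ} (hL : 0 < L) (k : ℤ) : fchar L k L = 1 := by
  unfold fchar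
  have : (L : ℂ) ≠ 0 := by exact_mod_cast hL.ne'
  rw [mul_div_assoc, div_self this, mul_one, Complex.exp_eq_one_iff]
  exact ⟨k, by ring⟩

lemma fchar_periodic {L : ℝ} (hL : 0 < L) (k : ℤ) : Function.Periodic (fchar L k) L := fun x => by
  rw [fchar_add_right, fchar_period hL, mul_one]

lemma hasDerivAt_fchar (L : ℝ) (k : ℤ) (x : ℝ) :
    HasDerivAt (fchar L k) (2 * Real.pi * Complex.I * k / L * fchar L k x) x := by
  have h : HasDerivAt (fun x : ℝ => 2 * Real.pi * Complex.I * k * (x : ℂ) / L)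
      (2 * Real.pi * Complex.I * k / L) x := by
    have h1 := ((Complex.ofRealCLM.hasDerivAt (x := x)).const_mul
      (2 * Real.pi * Complex.I * (k : ℂ))).div_const (L : ℂ)
    simpa using h1
  exact h.cexp.congr_deriv (mul_comm _ _)

lemma continuous_fchar (L : ℝ) (k : ℤ) : Continuous (fchar L k) :=
  continuous_iff_continuousAt.2 fun x => (hasDerivAt_fchar L k x).continuousAt

lemma coeff_eq_integral (L : ℝ) (u : ℝ → ℝ) (k : ℤ) :
    coeff L u k = (1 / (L : ℂ)) * ∫ x in (0 : ℝ)..L, fchar L (-k) x * (u x : ℂ) := by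
  unfold coeff fchar
  congr 3
  ext x
  congr 2
  push_cast; ring

lemma integral_fchar {L : ℝ} (hL : 0 < L) (k : ℤ) :
    ∫ x in (0 : ℝ)..L, fchar L k x = if k = 0 then (L : ℂ) else 0 := by
  have hL' : (L : ℂ) ≠ 0 := by exact_mod_cast hL.ne'
  split_ifs with h
  · subst h
    simp [fchar_zero]
  · have hk : (2 * Real.pi * Complex.I * k / L : ℂ) ≠ 0 := by
      have : (k : ℂ) ≠ 0 := by exact_mod_cast h
      have hpi : (Real.pi : ℂ) ≠ 0 := by exact_mod_cast Real.pi_ne_zero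
      exact div_ne_zero (mul_ne_zero (mul_ne_zero (mul_ne_zero two_ne_zero hpi) Complex.I_ne_zero)
        this) hL'
    have hi : ∀ x ∈ uIcc (0 : ℝ) L, HasDerivAt
        (fun y => (2 * Real.pi * Complex.I * k / L : ℂ)⁻¹ * fchar L k y) (fchar L k x) x := by
      intro x _
      have := (hasDerivAt_fchar L k x).const_mul (2 * Real.pi * Complex.I * k / L : ℂ)⁻¹
      rwa [inv_mul_cancel_left₀ hk] at this
    rw [intervalIntegral.integral_eq_sub_of_hasDerivAt hi
      ((continuous_fchar L k).intervalIntegrable _ _), fchar_period hL]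
    have : fchar L k 0 = 1 := by simp [fchar]
    rw [this, sub_self]

lemma coeff_neg_index (L : ℝ) (u : ℝ → ℝ) (k : ℤ) :
    coeff L u (-k) = (starRingEnd ℂ) (coeff L u k) := by
  rw [coeff_eq_integral, coeff_eq_integral, map_mul]
  congr 1
  · simp
  · simp only [intervalIntegral, map_sub, ← integral_conj, map_mul, conj_fchar,
      Complex.conj_ofReal]

lemma coeff_zero_index (L : ℝ) (u : ℝ → ℝ) : coeff L u 0 = ((1 / L * massM L u : ℝ) : ℂ) := by
  rw [coeff_eq_integral, massM]
  simp only [neg_zero, fchar_zero, one_mul]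
  rw [intervalIntegral.integral_ofReal]
  push_cast; rfl

lemma coeff_const_mul_add {L : ℝ} (hL : 0 < L) {u v : ℝ → ℝ}
    (hu : MemLp u 2 (volume.restrict (Ioc 0 L))) (hv : MemLp v 2 (volume.restrict (Ioc 0 L)))
    (c : ℝ) (k : ℤ) : coeff L (fun x => u x + c * v x) k = coeff L u k + c * coeff L v k := by
  rw [coeff_add hL hu (hv.const_mul c), coeff_smul]

lemma coeff_sub {L : ℝ} (hL : 0 < L) {u v : ℝ → ℝ}
    (hu : MemLp u 2 (volume.restrict (Ioc 0 L))) (hv : MemLp v 2 (volume.restrict (Ioc 0 L)))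
    (k : ℤ) : coeff L (fun x => u x - v x) k = coeff L u k - coeff L v k := by
  have := coeff_const_mul_add hL hu hv (-1) k
  simp only [neg_one_mul, ← sub_eq_add_neg] at this
  rw [this]; push_cast; ring

lemma norm_coeff_le {L : ℝ} (hL : 0 < L) {u : ℝ → ℝ} {D : ℝ}
    (hD : ∀ x ∈ Icc 0 L, |u x| ≤ D) (k : ℤ) : ‖coeff L u k‖ ≤ D := by
  rw [coeff_eq_integral, norm_mul]
  have h1 : ‖∫ x in (0 : ℝ)..L, fchar L (-k) x * (u x : ℂ)‖ ≤ D * |L - 0| := by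
    refine intervalIntegral.norm_integral_le_of_norm_le_const fun x hx => ?_
    rw [norm_mul, norm_fchar, one_mul, Complex.norm_real, Real.norm_eq_abs]
    rw [uIoc_of_le hL.le] at hx
    exact hD x ⟨hx.1.le, hx.2⟩
  rw [sub_zero, abs_of_pos hL] at h1
  have h2 : ‖(1 / (L : ℂ))‖ = 1 / L := by simp [abs_of_pos hL]
  rw [h2, one_div, inv_mul_le_iff₀ hL]
  linarith

lemma hasSum_sq_coeff {L : ℝ} (hL : 0 < L) {u : ℝ → ℝ}
    (hu : MemLp u 2 (volume.restrict (Ioc 0 L))) :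
    HasSum (fun k : ℤ => L * ‖coeff L u k‖ ^ 2) (∫ x in (0 : ℝ)..L, u x ^ 2) := by
  have h := (hasSum_sq_fourierCoeffOn hL (f := fun x => (u x : ℂ)) hu.ofReal).mul_left L
  simp only [← coeff_eq_fourierCoeffOn hL, sub_zero, smul_eq_mul, Complex.norm_real,
    Real.norm_eq_abs, sq_abs] at h
  rwa [mul_inv_cancel_left₀ hL.ne'] at h

lemma summable_mul_coeff {w : ℤ → ℝ} (hw : ∀ k, 0 ≤ w k) {a b : ℤ → ℂ}
    (ha : Summable fun k => w k * ‖a k‖ ^ 2) (hb : Summable fun k => w k * ‖b k‖ ^ 2) :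
    Summable fun k => w k * (‖a k‖ * ‖b k‖) := by
  refine Summable.of_nonneg_of_le (fun k => by have := hw k; positivity) (fun k => ?_) (ha.add hb)
  rw [← mul_add]
  refine mul_le_mul_of_nonneg_left ?_ (hw k)
  nlinarith [sq_nonneg (‖a k‖ - ‖b k‖), norm_nonneg (a k), norm_nonneg (b k)]

lemma abs_re_mul_conj_le (a b : ℂ) : |(a * (starRingEnd ℂ) b).re| ≤ ‖a‖ * ‖b‖ := by
  refine (Complex.abs_re_le_norm _).trans ?_
  rw [norm_mul, RCLike.norm_conj]

lemma summable_re_mul_conj {w : ℤ → ℝ} (hw : ∀ k, 0 ≤ w k) {θ : ℤ → ℝ}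
    (hθ : ∀ k, |θ k| ≤ w k) {a b : ℤ → ℂ}
    (ha : Summable fun k => w k * ‖a k‖ ^ 2) (hb : Summable fun k => w k * ‖b k‖ ^ 2) :
    Summable fun k => θ k * (a k * (starRingEnd ℂ) (b k)).re := by
  refine Summable.of_norm_bounded (summable_mul_coeff hw ha hb) fun k => ?_
  rw [Real.norm_eq_abs, abs_mul]
  exact mul_le_mul (hθ k) (abs_re_mul_conj_le _ _) (abs_nonneg _) (hw k)

lemma norm_add_sq_complex (a b : ℂ) :
    ‖a + b‖ ^ 2 = ‖a‖ ^ 2 + ‖b‖ ^ 2 + 2 * (a * (starRingEnd ℂ) b).re := by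
  rw [Complex.sq_norm, Complex.normSq_add, Complex.sq_norm, Complex.sq_norm]

lemma integrable_mul_of_memLp {L : ℝ} {u v : ℝ → ℝ}
    (hu : MemLp u 2 (volume.restrict (Ioc 0 L))) (hv : MemLp v 2 (volume.restrict (Ioc 0 L))) :
    Integrable (fun x => u x * v x) (volume.restrict (Ioc 0 L)) :=
  hu.integrable_mul hv

lemma intervalIntegrable_mul_of_memLp {L : ℝ} (hL : 0 < L) {u v : ℝ → ℝ}
    (hu : MemLp u 2 (volume.restrict (Ioc 0 L))) (hv : MemLp v 2 (volume.restrict (Ioc 0 L))) :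
    IntervalIntegrable (fun x => u x * v x) volume 0 L :=
  (intervalIntegrable_iff_integrableOn_Ioc_of_le hL.le).2 (integrable_mul_of_memLp hu hv)

/-- Parseval's identity polarized: the squared norms of `u + v`, `u` and `v` are compared on both
sides. -/
lemma hasSum_coeff_mul {L : ℝ} (hL : 0 < L) {u v : ℝ → ℝ}
    (hu : MemLp u 2 (volume.restrict (Ioc 0 L))) (hv : MemLp v 2 (volume.restrict (Ioc 0 L))) :
    HasSum (fun k : ℤ => L * (coeff L u k * (starRingEnd ℂ) (coeff L v k)).re)
      (innerPer L u v) := by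
  have h := (((hasSum_sq_coeff hL (hu.add hv)).sub (hasSum_sq_coeff hL hu)).sub
    (hasSum_sq_coeff hL hv)).mul_left (1 / 2)
  have i1 := intervalIntegrable_mul_of_memLp hL hu hu
  have i2 := intervalIntegrable_mul_of_memLp hL hv hv
  have i3 := intervalIntegrable_mul_of_memLp hL hu hv
  have e : (fun x => (u + v) x ^ 2) = fun x => (u x * u x + v x * v x) + 2 * (u x * v x) := by
    ext x; simp only [Pi.add_apply]; ring
  rw [e, intervalIntegral.integral_add (i1.add i2) (i3.const_mul 2),
    intervalIntegral.integral_add i1 i2, intervalIntegral.integral_const_mul] at h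
  have e2 : (fun k : ℤ => L * (coeff L u k * (starRingEnd ℂ) (coeff L v k)).re) = fun k =>
      1 / 2 * (L * ‖coeff L (u + v) k‖ ^ 2 - L * ‖coeff L u k‖ ^ 2 - L * ‖coeff L v k‖ ^ 2) := by
    ext k
    have : coeff L (u + v) k = coeff L u k + coeff L v k := coeff_add hL hu hv k
    rw [this, norm_add_sq_complex]; ring
  rw [e2]
  have e3 : innerPer L u v = 1 / 2 * ((∫ x in (0 : ℝ)..L, u x * u x) + (∫ x in (0 : ℝ)..L, v x * v x)
      + 2 * (∫ x in (0 : ℝ)..L, u x * v x) - (∫ x in (0 : ℝ)..L, u x ^ 2)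
      - ∫ x in (0 : ℝ)..L, v x ^ 2) := by
    simp only [sq, innerPer]; ring
  rw [e3]
  exact h

/-! ### Synthesis -/

/-- The real function with Fourier coefficients `c`. -/
noncomputable def synth (L : ℝ) (c : ℤ → ℂ) (x : ℝ) : ℝ := (∑' k : ℤ, c k * fchar L k x).re

/-- The symmetry of the Fourier coefficients of a real function. -/
def IsHerm (c : ℤ → ℂ) : Prop := ∀ k, c (-k) = (starRingEnd ℂ) (c k)

lemma isHerm_coeff (L : ℝ) (u : ℝ → ℝ) : IsHerm (coeff L u) := coeff_neg_index L u

lemma summable_mul_fchar {c : ℤ → ℂ} (hc : Summable fun k => ‖c k‖) (L x : ℝ) :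
    Summable fun k => c k * fchar L k x := by
  refine Summable.of_norm ?_
  simpa [norm_mul, norm_fchar] using hc

lemma synth_ofReal {c : ℤ → ℂ} (hh : IsHerm c) (L x : ℝ) :
    (synth L c x : ℂ) = ∑' k : ℤ, c k * fchar L k x := by
  have : (starRingEnd ℂ) (∑' k : ℤ, c k * fchar L k x) = ∑' k : ℤ, c k * fchar L k x := by
    rw [Complex.conj_tsum, ← (Equiv.neg ℤ).tsum_eq]
    refine tsum_congr fun k => ?_
    rw [map_mul, Equiv.neg_apply, hh, conj_fchar, neg_neg, Complex.conj_conj]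
  exact Complex.conj_eq_iff_re.1 this

lemma abs_synth_le {c : ℤ → ℂ} (hc : Summable fun k => ‖c k‖) (L x : ℝ) :
    |synth L c x| ≤ ∑' k, ‖c k‖ := by
  refine (Complex.abs_re_le_norm _).trans ((norm_tsum_le_tsum_norm ?_).trans (le_of_eq ?_))
  · simpa [norm_mul, norm_fchar] using hc
  · simp [norm_fchar]

lemma continuous_synth {c : ℤ → ℂ} (hc : Summable fun k => ‖c k‖) (L : ℝ) :
    Continuous (synth L c) := by
  refine Complex.continuous_re.comp (continuous_tsum (fun k => ?_) hc fun k x => ?_)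
  · exact continuous_const.mul (continuous_fchar L k)
  · rw [norm_mul, norm_fchar, mul_one]

lemma synth_periodic {L : ℝ} (hL : 0 < L) (c : ℤ → ℂ) : Function.Periodic (synth L c) L := fun x => by
  simp only [synth, (fchar_periodic hL _) x]

lemma coeff_synth {L : ℝ} (hL : 0 < L) {c : ℤ → ℂ} (hh : IsHerm c)
    (hc : Summable fun k => ‖c k‖) (k : ℤ) : coeff L (synth L c) k = c k := by
  have hL' : (L : ℂ) ≠ 0 := by exact_mod_cast hL.ne'
  rw [coeff_eq_integral]
  have h1 : ∀ x, fchar L (-k) x * (synth L c x : ℂ) = ∑' j : ℤ, c j * fchar L (j - k) x := by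
    intro x
    rw [synth_ofReal hh, ← tsum_mul_left]
    refine tsum_congr fun j => ?_
    rw [sub_eq_add_neg, fchar_add]; ring
  simp only [h1]
  have h2 := intervalIntegral.hasSum_integral_of_dominated_convergence (μ := volume) (a := 0) (b := L)
    (F := fun (j : ℤ) x => c j * fchar L (j - k) x) (f := fun x => ∑' j : ℤ, c j * fchar L (j - k) x)
    (fun j _ => ‖c j‖)
    (fun j => (continuous_const.mul (continuous_fchar L _)).aestronglyMeasurable)
    (fun j => ae_of_all _ fun x _ => by rw [norm_mul, norm_fchar, mul_one])
    (ae_of_all _ fun x _ => hc) (by simp)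
    (ae_of_all _ fun x _ => by
      refine (Summable.of_norm ?_).hasSum
      simpa [norm_mul, norm_fchar] using hc)
  rw [← h2.tsum_eq]
  simp only [intervalIntegral.integral_const_mul, integral_fchar hL]
  rw [tsum_eq_single k]
  · simp; field_simp
  · intro j hj
    simp [sub_ne_zero.2 hj]

/-- Rapidly decreasing sequences. -/
def Rapid (c : ℤ → ℂ) : Prop := ∀ j : ℕ, Summable fun k : ℤ => |(k : ℝ)| ^ j * ‖c k‖

lemma Rapid.summable_norm {c : ℤ → ℂ} (hc : Rapid c) : Summable fun k => ‖c k‖ := by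
  simpa using hc 0

/-- Multipliers of polynomial growth preserve rapid decay. This covers differentiation, the symbol
`θ` and the Sobolev weights, so `𝓜` maps smooth functions to smooth functions. -/
lemma Rapid.mul {a c : ℤ → ℂ} {C : ℝ} {N : ℕ} (ha : ∀ k : ℤ, ‖a k‖ ≤ C * (1 + |(k : ℝ)| ^ N))
    (hc : Rapid c) : Rapid fun k => a k * c k := by
  intro j
  refine Summable.of_nonneg_of_le (fun k => by positivity) (fun k => ?_)
    (((hc j).add (hc (j + N))).mul_left C)
  rw [norm_mul]
  calc |(k : ℝ)| ^ j * (‖a k‖ * ‖c k‖) ≤ |(k : ℝ)| ^ j * ((C * (1 + |(k : ℝ)| ^ N)) * ‖c k‖) := by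
        gcongr; exact ha k
    _ = _ := by ring

lemma rapid_of_finite {c : ℤ → ℂ} (s : Finset ℤ) (h : ∀ k ∉ s, c k = 0) : Rapid c := fun j =>
  summable_of_ne_finset_zero (s := s) fun k hk => by simp [h k hk]

lemma norm_derivSymbol (L : ℝ) (k : ℤ) :
    ‖(2 * Real.pi * Complex.I * k / L : ℂ)‖ = 2 * Real.pi / |L| * |(k : ℝ)| := by
  have hi : ‖(k : ℂ)‖ = |(k : ℝ)| := by
    rw [show (k : ℂ) = ((k : ℝ) : ℂ) by push_cast; rfl, Complex.norm_real, Real.norm_eq_abs]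
  simp only [norm_mul, norm_div, Complex.norm_I, Complex.norm_real, Real.norm_eq_abs, hi, mul_one,
    abs_of_pos Real.pi_pos]
  norm_num
  ring

lemma derivSymbol_bound (L : ℝ) (k : ℤ) :
    ‖(2 * Real.pi * Complex.I * k / L : ℂ)‖ ≤ 2 * Real.pi / |L| * (1 + |(k : ℝ)| ^ 1) := by
  rw [norm_derivSymbol]
  have : 0 ≤ 2 * Real.pi / |L| := by positivity
  nlinarith

lemma hasDerivAt_synth (L : ℝ) {c : ℤ → ℂ} (hc : Rapid c) (x : ℝ) :
    HasDerivAt (synth L c) (synth L (fun k => (2 * Real.pi * Complex.I * k / L : ℂ) * c k) x) x := by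
  have h := hasDerivAt_tsum (𝕜 := ℝ) (α := ℤ) (g := fun k x => c k * fchar L k x)
    (g' := fun k x => (2 * Real.pi * Complex.I * k / L : ℂ) * c k * fchar L k x)
    (u := fun k => ‖(2 * Real.pi * Complex.I * k / L : ℂ) * c k‖)
    (hc.mul (derivSymbol_bound L)).summable_norm
    (fun k y => by
      have := (hasDerivAt_fchar L k y).const_mul (c k)
      exact this.congr_deriv (by ring))
    (fun k y => by rw [norm_mul _ (fchar L k y), norm_fchar, mul_one])
    (y₀ := x) (summable_mul_fchar hc.summable_norm L x) x
  exact (Complex.reCLM.hasFDerivAt.comp_hasDerivAt x h)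

lemma contDiff_synth (L : ℝ) {c : ℤ → ℂ} (hc : Rapid c) : ContDiff ℝ (⊤ : ℕ∞) (synth L c) := by
  rw [contDiff_infty]
  intro n
  induction n generalizing c with
  | zero =>
    exact contDiff_zero.2 (continuous_synth hc.summable_norm L)
  | succ n ih =>
    have hd : deriv (synth L c) = synth L (fun k => (2 * Real.pi * Complex.I * k / L : ℂ) * c k) :=
      funext fun x => (hasDerivAt_synth L hc x).deriv
    push_cast
    rw [contDiff_succ_iff_deriv]
    refine ⟨fun x => (hasDerivAt_synth L hc x).differentiableAt, by simp, ?_⟩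
    rw [hd]
    exact ih (hc.mul (derivSymbol_bound L))

lemma smoothPer_synth {L : ℝ} (hL : 0 < L) {c : ℤ → ℂ} (hc : Rapid c) : SmoothPer L (synth L c) :=
  ⟨contDiff_synth L hc, synth_periodic hL c⟩

/-! ### Smooth periodic functions -/

lemma SmoothPer.continuous {L : ℝ} {g : ℝ → ℝ} (hg : SmoothPer L g) : Continuous g := hg.1.continuous

lemma SmoothPer.hasDerivAt {L : ℝ} {g : ℝ → ℝ} (hg : SmoothPer L g) (x : ℝ) :
    HasDerivAt g (deriv g x) x :=
  (hg.1.differentiable (by simp) x).hasDerivAt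

lemma SmoothPer.deriv {L : ℝ} {g : ℝ → ℝ} (hg : SmoothPer L g) : SmoothPer L (deriv g) := by
  refine ⟨?_, fun x => ?_⟩
  · have := hg.1
    rw [show ((⊤ : ℕ∞) : WithTop ℕ∞) = (⊤ : ℕ∞) + 1 from rfl, contDiff_succ_iff_deriv] at this
    exact this.2.2
  · rw [← deriv_comp_add_const]
    congr 1
    exact funext hg.2

lemma SmoothPer.iteratedDeriv {L : ℝ} {g : ℝ → ℝ} (hg : SmoothPer L g) (p : ℕ) :
    SmoothPer L (iteratedDeriv p g) := by
  induction p with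
  | zero => simpa using hg
  | succ p ih => rw [iteratedDeriv_succ]; exact ih.deriv

lemma SmoothPer.add {L : ℝ} {g h : ℝ → ℝ} (hg : SmoothPer L g) (hh : SmoothPer L h) :
    SmoothPer L (fun x => g x + h x) :=
  ⟨hg.1.add hh.1, fun x => by simp only [hg.2 x, hh.2 x]⟩

lemma SmoothPer.sub {L : ℝ} {g h : ℝ → ℝ} (hg : SmoothPer L g) (hh : SmoothPer L h) :
    SmoothPer L (fun x => g x - h x) :=
  ⟨hg.1.sub hh.1, fun x => by simp only [hg.2 x, hh.2 x]⟩

lemma SmoothPer.mul {L : ℝ} {g h : ℝ → ℝ} (hg : SmoothPer L g) (hh : SmoothPer L h) :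
    SmoothPer L (fun x => g x * h x) :=
  ⟨hg.1.mul hh.1, fun x => by simp only [hg.2 x, hh.2 x]⟩

lemma SmoothPer.const (L a : ℝ) : SmoothPer L (fun _ => a) := ⟨contDiff_const, fun _ => rfl⟩

lemma SmoothPer.comp {L : ℝ} {g F : ℝ → ℝ} (hF : ContDiff ℝ (⊤ : ℕ∞) F) (hg : SmoothPer L g) :
    SmoothPer L (fun x => F (g x)) :=
  ⟨hF.comp hg.1, fun x => by simp only [hg.2 x]⟩

lemma SmoothPer.translate {L : ℝ} {g : ℝ → ℝ} (hg : SmoothPer L g) (y : ℝ) :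
    SmoothPer L (fun x => g (x + y)) :=
  ⟨hg.1.comp (contDiff_id.add contDiff_const), fun x => by
    simp only [add_right_comm x L y, hg.2 (x + y)]⟩

lemma memLp_of_continuous {L : ℝ} {g : ℝ → ℝ} (hg : Continuous g) :
    MemLp g 2 (volume.restrict (Ioc 0 L)) := by
  obtain ⟨D, hD⟩ := isCompact_Icc.exists_bound_of_continuousOn (s := Icc 0 L) hg.continuousOn
  refine MemLp.of_bound hg.aestronglyMeasurable D ?_
  filter_upwards [ae_restrict_mem measurableSet_Ioc] with x hx
  exact hD x ⟨hx.1.le, hx.2⟩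

lemma SmoothPer.memLp {L : ℝ} {g : ℝ → ℝ} (hg : SmoothPer L g) :
    MemLp g 2 (volume.restrict (Ioc 0 L)) := memLp_of_continuous hg.continuous

lemma SmoothPer.coeff_deriv {L : ℝ} (hL : 0 < L) {g : ℝ → ℝ} (hg : SmoothPer L g) (k : ℤ) :
    coeff L (_root_.deriv g) k = (2 * Real.pi * Complex.I * k / L : ℂ) * coeff L g k := by
  rw [coeff_eq_integral, coeff_eq_integral, intervalIntegral.integral_mul_deriv_eq_deriv_mul
    (u := fchar L (-k)) (v := fun x => (g x : ℂ)) (v' := fun x => ((_root_.deriv g x : ℝ) : ℂ))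
    (fun x _ => hasDerivAt_fchar L (-k) x) (fun x _ => (hg.hasDerivAt x).ofReal_comp)
    ((continuous_const.mul (continuous_fchar L _)).intervalIntegrable _ _)
    ((Complex.continuous_ofReal.comp hg.deriv.continuous).intervalIntegrable _ _)]
  have e1 : fchar L (-k) 0 = 1 := by simp [fchar]
  have e2 : g L = g 0 := by simpa using hg.2 0
  simp only [mul_assoc _ (fchar L (-k) _)]
  rw [fchar_period hL, e1, e2, sub_self, zero_sub, intervalIntegral.integral_const_mul]
  push_cast; ring

lemma SmoothPer.coeff_iteratedDeriv {L : ℝ} (hL : 0 < L) {g : ℝ → ℝ} (hg : SmoothPer L g) (p : ℕ)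
    (k : ℤ) : coeff L (_root_.iteratedDeriv p g) k
      = (2 * Real.pi * Complex.I * k / L : ℂ) ^ p * coeff L g k := by
  induction p with
  | zero => simp
  | succ p ih =>
    rw [iteratedDeriv_succ, (hg.iteratedDeriv p).coeff_deriv hL, ih]; ring

/-- The decay comes from `p` integrations by parts. The constant depends only on a bound for the
`p`-th derivative, so it is locally uniform in a smooth family. -/
lemma SmoothPer.pow_mul_norm_coeff_le {L : ℝ} (hL : 0 < L) {g : ℝ → ℝ} (hg : SmoothPer L g)
    {p : ℕ} {D : ℝ} (hD : ∀ x ∈ Icc 0 L, |_root_.iteratedDeriv p g x| ≤ D) (k : ℤ) :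
    |(k : ℝ)| ^ p * ‖coeff L g k‖ ≤ (L / (2 * Real.pi)) ^ p * D := by
  have h := norm_coeff_le hL hD k
  rw [hg.coeff_iteratedDeriv hL, norm_mul, norm_pow, norm_derivSymbol, abs_of_pos hL] at h
  have hp := Real.pi_pos
  calc |(k : ℝ)| ^ p * ‖coeff L g k‖
      = (L / (2 * Real.pi)) ^ p * ((2 * Real.pi / L * |(k : ℝ)|) ^ p * ‖coeff L g k‖) := by
        rw [← mul_assoc, ← mul_pow]
        congr 2
        field_simp
    _ ≤ _ := by gcongr

lemma summable_inv_one_add_sq : Summable fun k : ℤ => 1 / (1 + |(k : ℝ)| ^ 2) := by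
  have h : Summable fun k : ℤ => 1 / (k : ℝ) ^ 2 := Real.summable_one_div_int_pow.2 (by norm_num)
  have h0 : Summable fun k : ℤ => if k = 0 then (1 : ℝ) else 0 :=
    summable_of_ne_finset_zero (s := {0}) fun k hk => by simp at hk; simp [hk]
  refine Summable.of_nonneg_of_le (fun k => by positivity) (fun k => ?_) (h.add h0)
  by_cases hk : k = 0
  · simp [hk]
  · have : (k : ℝ) ≠ 0 := by exact_mod_cast hk
    simp only [hk, if_false, add_zero, sq_abs]
    exact one_div_le_one_div_of_le (by positivity) (by linarith)

lemma SmoothPer.rapid {L : ℝ} (hL : 0 < L) {g : ℝ → ℝ} (hg : SmoothPer L g) : Rapid (coeff L g) := by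
  intro j
  have hb : ∀ p, ∃ D, ∀ x ∈ Icc 0 L, |_root_.iteratedDeriv p g x| ≤ D := fun p =>
    isCompact_Icc.exists_bound_of_continuousOn (hg.iteratedDeriv p).continuous.continuousOn
  obtain ⟨D₁, h1⟩ := hb j
  obtain ⟨D₂, h2⟩ := hb (j + 2)
  refine Summable.of_nonneg_of_le (fun k => by positivity) (fun k => ?_)
    (summable_inv_one_add_sq.mul_left
      ((L / (2 * Real.pi)) ^ j * D₁ + (L / (2 * Real.pi)) ^ (j + 2) * D₂))
  rw [mul_one_div, le_div_iff₀ (by positivity)]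
  have e1 := hg.pow_mul_norm_coeff_le hL h1 k
  have e2 := hg.pow_mul_norm_coeff_le hL h2 k
  calc |(k : ℝ)| ^ j * ‖coeff L g k‖ * (1 + |(k : ℝ)| ^ 2)
      = |(k : ℝ)| ^ j * ‖coeff L g k‖ + |(k : ℝ)| ^ (j + 2) * ‖coeff L g k‖ := by ring
    _ ≤ _ := add_le_add e1 e2

/-- A polynomial bound for the Sobolev weights. -/
lemma weight_le (s : ℝ) : ∃ C : ℝ, ∃ N : ℕ, 0 < C ∧ ∀ k : ℤ,
    (1 + (k : ℝ) ^ 2) ^ s ≤ C * (1 + |(k : ℝ)| ^ N) := by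
  obtain ⟨n, hn⟩ := exists_nat_ge s
  refine ⟨2 ^ n, 2 * n, by positivity, fun k => ?_⟩
  have h1 : (1 : ℝ) ≤ 1 + (k : ℝ) ^ 2 := by nlinarith [sq_nonneg (k : ℝ)]
  calc (1 + (k : ℝ) ^ 2) ^ s ≤ (1 + (k : ℝ) ^ 2) ^ (n : ℝ) := Real.rpow_le_rpow_of_exponent_le h1 hn
    _ = (1 + (k : ℝ) ^ 2) ^ n := Real.rpow_natCast _ _
    _ ≤ 2 ^ n * (1 + |(k : ℝ)| ^ (2 * n)) := by
      rw [pow_mul, sq_abs]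
      rcases le_total ((k : ℝ) ^ 2) 1 with h | h
      · calc (1 + (k : ℝ) ^ 2) ^ n ≤ 2 ^ n := by gcongr; linarith
          _ ≤ _ := by
            have : 0 ≤ ((k : ℝ) ^ 2) ^ n := by positivity
            have h2 : (0 : ℝ) < 2 ^ n := by positivity
            nlinarith
      · calc (1 + (k : ℝ) ^ 2) ^ n ≤ (2 * (k : ℝ) ^ 2) ^ n := by gcongr; linarith
          _ = 2 ^ n * ((k : ℝ) ^ 2) ^ n := by rw [mul_pow]
          _ ≤ _ := by
            have h2 : (0 : ℝ) < 2 ^ n := by positivity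
            nlinarith

lemma Rapid.summable_weight {c : ℤ → ℂ} (hc : Rapid c) (s : ℝ) :
    Summable fun k : ℤ => (1 + (k : ℝ) ^ 2) ^ s * ‖c k‖ ^ 2 := by
  obtain ⟨C, N, hC, h⟩ := weight_le s
  have h1 : Rapid fun k : ℤ => (((1 + (k : ℝ) ^ 2) ^ s : ℝ) : ℂ) * c k :=
    hc.mul (C := C) (N := N) fun k => by
      rw [Complex.norm_real, Real.norm_eq_abs, abs_of_nonneg (by positivity)]; exact h k
  refine Summable.of_nonneg_of_le (fun k => by positivity) (fun k => ?_)
    (h1.summable_norm.mul_right (∑' k, ‖c k‖))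
  rw [norm_mul, Complex.norm_real, Real.norm_eq_abs, abs_of_nonneg (by positivity), sq ‖c k‖, ← mul_assoc]
  refine mul_le_mul_of_nonneg_left ?_ (by positivity)
  exact hc.summable_norm.le_tsum k fun j _ => norm_nonneg _

lemma SmoothPer.memH {L : ℝ} (hL : 0 < L) {g : ℝ → ℝ} (hg : SmoothPer L g) (s : ℝ) : MemH L s g :=
  ⟨hg.memLp, (hg.rapid hL).summable_weight s⟩

lemma coeff_translate {L : ℝ} {g : ℝ → ℝ} (hg : Function.Periodic g L) (y : ℝ) (k : ℤ)
    (hL : 0 < L) : coeff L (fun x => g (x + y)) k = fchar L k y * coeff L g k := by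
  rw [coeff_eq_integral, coeff_eq_integral]
  have h1 : ∀ x, fchar L (-k) x * (g (x + y) : ℂ)
      = fchar L k y * (fun z => fchar L (-k) z * (g z : ℂ)) (x + y) := by
    intro x
    simp only
    rw [fchar_add_right, ← mul_assoc, mul_comm (fchar L k y), mul_assoc (fchar L (-k) x),
      ← fchar_add, neg_add_cancel, fchar_zero, mul_one]
  have hper : Function.Periodic (fun z => fchar L (-k) z * (g z : ℂ)) L := fun z => by
    simp only [fchar_periodic hL _ z, hg z]
  simp_rw [h1]
  rw [intervalIntegral.integral_const_mul,
    intervalIntegral.integral_comp_add_right (fun z => fchar L (-k) z * (g z : ℂ)), zero_add,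
    add_comm L y, hper.intervalIntegral_add_eq y 0, zero_add]
  ring

/-! ## The spaces `H^s_per` -/

lemma AEEqPer.symm {L : ℝ} {u v : ℝ → ℝ} (h : AEEqPer L u v) : AEEqPer L v u :=
  Filter.EventuallyEq.symm h

lemma AEEqPer.trans {L : ℝ} {u v w : ℝ → ℝ} (h : AEEqPer L u v) (h' : AEEqPer L v w) :
    AEEqPer L u w := Filter.EventuallyEq.trans h h'

lemma MemH.congr {L : ℝ} (hL : 0 < L) {s : ℝ} {u v : ℝ → ℝ} (h : AEEqPer L u v) (hu : MemH L s u) :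
    MemH L s v := by
  refine ⟨(memLp_congr_ae h).1 hu.1, ?_⟩
  simp only [← coeff_congr hL h]
  exact hu.2

lemma sobNorm_congr {L : ℝ} (hL : 0 < L) (s : ℝ) {u v : ℝ → ℝ} (h : AEEqPer L u v) :
    sobNorm L s u = sobNorm L s v := by
  simp only [sobNorm, coeff_congr hL h]

lemma integral_congr_per {L : ℝ} (hL : 0 < L) {u v : ℝ → ℝ} (h : AEEqPer L u v) (F : ℝ → ℝ → ℝ) :
    ∫ x in (0 : ℝ)..L, F x (u x) = ∫ x in (0 : ℝ)..L, F x (v x) := by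
  rw [intervalIntegral.integral_of_le hL.le, intervalIntegral.integral_of_le hL.le]
  refine integral_congr_ae ?_
  filter_upwards [h] with x hx
  rw [hx]

lemma one_le_weight {s : ℝ} (hs : 0 ≤ s) (k : ℤ) : 1 ≤ (1 + (k : ℝ) ^ 2) ^ s :=
  Real.one_le_rpow (by nlinarith [sq_nonneg (k : ℝ)]) hs

lemma weight_mono {r s : ℝ} (h : r ≤ s) (k : ℤ) : (1 + (k : ℝ) ^ 2) ^ r ≤ (1 + (k : ℝ) ^ 2) ^ s :=
  Real.rpow_le_rpow_of_exponent_le (by nlinarith [sq_nonneg (k : ℝ)]) h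

lemma MemH.mono {L r s : ℝ} (h : r ≤ s) {u : ℝ → ℝ} (hu : MemH L s u) : MemH L r u :=
  ⟨hu.1, Summable.of_nonneg_of_le (fun k => by positivity)
    (fun k => mul_le_mul_of_nonneg_right (weight_mono h k) (by positivity)) hu.2⟩

lemma sobNorm_mono {L : ℝ} (hL : 0 < L) {r s : ℝ} (h : r ≤ s) {u : ℝ → ℝ} (hu : MemH L s u) :
    sobNorm L r u ≤ sobNorm L s u := by
  refine Real.sqrt_le_sqrt (mul_le_mul_of_nonneg_left ?_ hL.le)
  exact (hu.mono h).2.tsum_le_tsum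
    (fun k => mul_le_mul_of_nonneg_right (weight_mono h k) (by positivity)) hu.2

lemma MemH.sub {L : ℝ} (hL : 0 < L) {s : ℝ} {u v : ℝ → ℝ} (hu : MemH L s u) (hv : MemH L s v) :
    MemH L s (fun x => u x - v x) := by
  refine ⟨hu.1.sub hv.1, ?_⟩
  refine Summable.of_nonneg_of_le (fun k => by positivity) (fun k => ?_)
    ((hu.2.add hv.2).mul_left 2)
  rw [coeff_sub hL hu.1 hv.1, ← mul_add, mul_left_comm]
  refine mul_le_mul_of_nonneg_left ?_ (by positivity)
  nlinarith [norm_sub_le (coeff L u k) (coeff L v k), norm_nonneg (coeff L u k - coeff L v k),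
    sq_nonneg (‖coeff L u k‖ - ‖coeff L v k‖), norm_nonneg (coeff L u k),
    norm_nonneg (coeff L v k)]

/-- A Fatou-type criterion: only finite partial sums are tested, and these pass to the limit when
each Fourier coefficient converges. -/
lemma memH_of_bound {L : ℝ} (hL : 0 < L) {s R : ℝ} (hR : 0 ≤ R) {w : ℝ → ℝ}
    (hw : MemLp w 2 (volume.restrict (Ioc 0 L)))
    (h : ∀ S : Finset ℤ, L * ∑ k ∈ S, (1 + (k : ℝ) ^ 2) ^ s * ‖coeff L w k‖ ^ 2 ≤ R ^ 2) :
    MemH L s w ∧ sobNorm L s w ≤ R := by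
  have hs : Summable fun k : ℤ => (1 + (k : ℝ) ^ 2) ^ s * ‖coeff L w k‖ ^ 2 := by
    refine summable_of_sum_le (c := R ^ 2 / L) (fun k => by positivity) fun S => ?_
    rw [le_div_iff₀ hL, mul_comm]
    exact h S
  refine ⟨⟨hw, hs⟩, ?_⟩
  rw [sobNorm]
  refine Real.sqrt_le_iff.2 ⟨hR, ?_⟩
  rw [← le_div_iff₀' hL]
  refine hs.tsum_le_of_sum_le fun S => ?_
  rw [le_div_iff₀' hL]
  exact h S

section

variable {L : ℝ} [hL : Fact (0 < L)] {s : ℝ}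

/-- The element of `H^s_per` represented by a function. -/
noncomputable def Hper.of (u : ℝ → ℝ) (h : MemH L s u) : Hper L s :=
  ⟨h.1.toLp u, h.congr hL.out (MemLp.coeFn_toLp h.1).symm⟩

lemma Hper.fn_of {u : ℝ → ℝ} (h : MemH L s u) : AEEqPer L (Hper.of u h).fn u :=
  MemLp.coeFn_toLp h.1

lemma Hper.coeff_of {u : ℝ → ℝ} (h : MemH L s u) (k : ℤ) :
    coeff L (Hper.of u h).fn k = coeff L u k := coeff_congr hL.out (Hper.fn_of h) k

lemma Hper.fn_add (u v : Hper L s) : AEEqPer L (u + v).fn (fun x => u.fn x + v.fn x) :=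
  Lp.coeFn_add u.1 v.1

lemma Hper.fn_smul (c : ℝ) (u : Hper L s) : AEEqPer L (c • u).fn (fun x => c * u.fn x) :=
  Lp.coeFn_smul c u.1

lemma Hper.fn_sub (u v : Hper L s) : AEEqPer L (u - v).fn (fun x => u.fn x - v.fn x) :=
  Lp.coeFn_sub u.1 v.1

lemma Hper.memLp (u : Hper L s) : MemLp u.fn 2 (volume.restrict (Ioc 0 L)) := u.memH.1

lemma Hper.coeff_fn_sub (u v : Hper L s) (k : ℤ) :
    coeff L (u - v).fn k = coeff L u.fn k - coeff L v.fn k := by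
  rw [coeff_congr hL.out (Hper.fn_sub u v), coeff_sub hL.out u.memLp v.memLp]

lemma Hper.coeff_fn_zero (k : ℤ) : coeff L (0 : Hper L s).fn k = 0 := by
  have := Hper.coeff_fn_sub (0 : Hper L s) 0 k
  simpa using this

lemma Hper.ext_coeff {u v : Hper L s} (h : ∀ k, coeff L u.fn k = coeff L v.fn k) : u = v := by
  rw [← sub_eq_zero]
  have := ae_zero_of_coeff hL.out (u - v).memLp fun k => by rw [Hper.coeff_fn_sub, h, sub_self]
  exact Subtype.ext (Lp.ext (this.trans (Lp.coeFn_zero ℝ 2 _).symm))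

lemma Hper.ext_fn {u v : Hper L s} (h : AEEqPer L u.fn v.fn) : u = v :=
  Hper.ext_coeff fun k => coeff_congr hL.out h k

lemma Hper.of_fn (u : Hper L s) : Hper.of u.fn u.memH = u := Hper.ext_fn (Hper.fn_of _)

lemma Hper.norm_of {u : ℝ → ℝ} (h : MemH L s u) : ‖Hper.of u h‖ = sobNorm L s u := by
  rw [Hper.norm_eq, sobNorm_congr hL.out s (Hper.fn_of h)]

lemma Hper.of_sub {u v : ℝ → ℝ} (hu : MemH L s u) (hv : MemH L s v) :
    Hper.of u hu - Hper.of v hv = Hper.of (fun x => u x - v x) (hu.sub hL.out hv) :=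
  Hper.ext_coeff fun k => by
    rw [Hper.coeff_fn_sub, Hper.coeff_of, Hper.coeff_of, Hper.coeff_of, coeff_sub hL.out hu.1 hv.1]

lemma Hper.hasSum_norm_sq (u : Hper L s) :
    HasSum (fun k : ℤ => L * ((1 + (k : ℝ) ^ 2) ^ s * ‖coeff L u.fn k‖ ^ 2)) (‖u‖ ^ 2) := by
  have h := u.memH.2.hasSum.mul_left L
  have e : ‖u‖ ^ 2 = L * ∑' k : ℤ, (1 + (k : ℝ) ^ 2) ^ s * ‖coeff L u.fn k‖ ^ 2 := by
    rw [Hper.norm_eq, sobNorm, Real.sq_sqrt]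
    exact mul_nonneg hL.out.le (tsum_nonneg fun k => by positivity)
  rw [e]
  exact h

/-- The norm sees only the moduli of the coefficients. This reduces estimates for translates to
estimates for the scalars `e^{2πiky/L}`, frequency by frequency. -/
lemma Hper.norm_le_of_coeff {u v : Hper L s} (h : ∀ k, ‖coeff L u.fn k‖ ≤ ‖coeff L v.fn k‖) :
    ‖u‖ ≤ ‖v‖ := by
  refine le_of_sq_le_sq ?_ (norm_nonneg _)
  refine hasSum_le (fun k => ?_) u.hasSum_norm_sq v.hasSum_norm_sq
  have := hL.out
  gcongr
  exact h k

lemma Hper.norm_congr_coeff {u v : Hper L s} (h : ∀ k, ‖coeff L u.fn k‖ = ‖coeff L v.fn k‖) :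
    ‖u‖ = ‖v‖ :=
  le_antisymm (Hper.norm_le_of_coeff fun k => (h k).le) (Hper.norm_le_of_coeff fun k => (h k).ge)

lemma Hper.integral_sq_le (hs : 0 ≤ s) (u : Hper L s) : ∫ x in (0 : ℝ)..L, u.fn x ^ 2 ≤ ‖u‖ ^ 2 := by
  refine hasSum_le (fun k => ?_) (hasSum_sq_coeff hL.out u.memLp) u.hasSum_norm_sq
  refine mul_le_mul_of_nonneg_left ?_ hL.out.le
  exact le_mul_of_one_le_left (by positivity) (one_le_weight hs k)

lemma norm_coeff_sq_le_integral {u : ℝ → ℝ} (hu : MemLp u 2 (volume.restrict (Ioc 0 L))) (k : ℤ) :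
    L * ‖coeff L u k‖ ^ 2 ≤ ∫ x in (0 : ℝ)..L, u x ^ 2 :=
  le_hasSum (hasSum_sq_coeff hL.out hu) k fun j _ => by have := hL.out; positivity

lemma Hper.norm_coeff_sq_le (hs : 0 ≤ s) (u : Hper L s) (k : ℤ) :
    L * ‖coeff L u.fn k‖ ^ 2 ≤ ‖u‖ ^ 2 :=
  (norm_coeff_sq_le_integral u.memLp k).trans (u.integral_sq_le hs)

/-! ### Completeness, compact embedding and density in `H^s_per`. -/

lemma lp_norm_sq (w : Lp ℝ 2 (volume.restrict (Ioc (0 : ℝ) L))) :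
    ‖w‖ ^ 2 = ∫ x in (0 : ℝ)..L, w x ^ 2 := by
  rw [← real_inner_self_eq_norm_sq, L2.inner_def, intervalIntegral.integral_of_le hL.out.le]
  refine integral_congr_ae (ae_of_all _ fun x => ?_)
  simp

/-- A Cauchy sequence has an `L²` limit, to which the coefficients converge individually. The Cauchy
bound on finite partial sums then passes to the limit, which gives both membership in `H^s_per` and
convergence there. -/
theorem Hper.completeSpace (hs : 0 ≤ s) : CompleteSpace (Hper L s) := by
  refine Metric.complete_of_cauchySeq_tendsto fun u hu => ?_
  have hsub : ∀ v : Hper L s, ‖v.1‖ ≤ ‖v‖ := fun v =>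
    le_of_sq_le_sq (by rw [lp_norm_sq]; exact v.integral_sq_le hs) (norm_nonneg _)
  have hc : CauchySeq fun n => (u n).1 := by
    rw [Metric.cauchySeq_iff] at hu ⊢
    intro ε hε
    obtain ⟨N, hN⟩ := hu ε hε
    refine ⟨N, fun m hm n hn => lt_of_le_of_lt ?_ (hN m hm n hn)⟩
    rw [dist_eq_norm, dist_eq_norm]
    exact hsub (u m - u n)
  obtain ⟨w, hw⟩ := cauchySeq_tendsto_of_complete hc
  have hwL : MemLp w 2 (volume.restrict (Ioc 0 L)) := Lp.memLp w
  have hcoeff : ∀ k, Tendsto (fun n => coeff L (u n).fn k) atTop (𝓝 (coeff L w k)) := by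
    intro k
    have hL' := hL.out
    rw [tendsto_iff_norm_sub_tendsto_zero] at hw ⊢
    have h0 : Tendsto (fun n => Real.sqrt (‖(u n).1 - w‖ ^ 2 / L)) atTop (𝓝 0) := by
      have : Tendsto (fun n => Real.sqrt (‖(u n).1 - w‖ ^ 2 / L)) atTop
          (𝓝 (Real.sqrt (0 ^ 2 / L))) := ((hw.pow 2).div_const L).sqrt
      simpa using this
    refine squeeze_zero (fun n => norm_nonneg _) (fun n => ?_) h0
    refine Real.le_sqrt_of_sq_le ?_
    rw [le_div_iff₀ hL', mul_comm, lp_norm_sq]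
    have e : coeff L (u n).fn k - coeff L w k = coeff L ((u n).1 - w : Lp ℝ 2 _) k := by
      rw [coeff_congr hL' (Lp.coeFn_sub (u n).1 w)]
      exact (coeff_sub hL' (u n).memLp hwL k).symm
    rw [e]
    exact norm_coeff_sq_le_integral (Lp.memLp _) k
  have key : ∀ ε > 0, ∃ N, ∀ n ≥ N, MemH L s (fun x => (u n).fn x - w x) ∧
      sobNorm L s (fun x => (u n).fn x - w x) ≤ ε := by
    intro ε hε
    obtain ⟨N, hN⟩ := Metric.cauchySeq_iff.1 hu ε hε
    refine ⟨N, fun n hn => memH_of_bound hL.out hε.le ((u n).memLp.sub hwL) fun S => ?_⟩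
    have ht : Tendsto (fun m => L * ∑ k ∈ S, (1 + (k : ℝ) ^ 2) ^ s * ‖coeff L (u n - u m).fn k‖ ^ 2)
        atTop (𝓝 (L * ∑ k ∈ S, (1 + (k : ℝ) ^ 2) ^ s
          * ‖coeff L (fun x => (u n).fn x - w x) k‖ ^ 2)) := by
      refine (tendsto_finsetSum S fun k _ => ?_).const_mul L
      refine ((Tendsto.norm ?_).pow 2).const_mul _
      simp only [Hper.coeff_fn_sub, coeff_sub hL.out (u n).memLp hwL]
      exact (hcoeff k).const_sub _
    refine le_of_tendsto ht ?_
    filter_upwards [eventually_ge_atTop N] with m hm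
    have h1 := (hN n hn m hm).le
    rw [dist_eq_norm] at h1
    rw [Finset.mul_sum]
    refine (sum_le_hasSum S (fun k _ => ?_) (u n - u m).hasSum_norm_sq).trans ?_
    · have := hL.out; positivity
    · gcongr
  obtain ⟨N, hN⟩ := key 1 one_pos
  have hwH : MemH L s w := by
    have := (u N).memH.sub hL.out (hN N le_rfl).1
    simpa using this
  refine ⟨Hper.of w hwH, ?_⟩
  rw [Metric.tendsto_atTop]
  intro ε hε
  obtain ⟨N, hN⟩ := key (ε / 2) (half_pos hε)
  refine ⟨N, fun n hn => ?_⟩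
  rw [dist_eq_norm, ← Hper.of_fn (u n), Hper.of_sub, Hper.norm_of]
  exact lt_of_le_of_lt (hN n hn).2 (half_lt_self hε)

/-- Rellich's lemma: bounded sequences in `H^s_per`, `s > 0`, have `L²`-Cauchy subsequences. -/
theorem Hper.rellich (hs : 0 < s) (R : ℝ) (u : ℕ → Hper L s) (hu : ∀ n, ‖u n‖ ≤ R) :
    ∃ a : ℕ → ℕ, StrictMono a ∧ ∀ ε > 0, ∃ N, ∀ n ≥ N, ∀ j ≥ N,
      ∫ x in (0 : ℝ)..L, (u (a n) - u (a j)).fn x ^ 2 < ε := by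
  have hL' := hL.out
  have hR : 0 ≤ R := (norm_nonneg _).trans (hu 0)
  -- By Tychonoff, a subsequence converges in every Fourier coefficient at once; this replaces a
  -- diagonal argument.
  have hK : IsCompact (Set.pi univ fun _ : ℤ => Metric.closedBall (0 : ℂ) (Real.sqrt (R ^ 2 / L))) :=
    isCompact_univ_pi fun _ => isCompact_closedBall _ _
  have hmem : ∀ n, (fun k => coeff L (u n).fn k) ∈
      Set.pi univ fun _ : ℤ => Metric.closedBall (0 : ℂ) (Real.sqrt (R ^ 2 / L)) := by
    intro n k _
    rw [mem_closedBall_zero_iff]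
    refine Real.le_sqrt_of_sq_le ?_
    rw [le_div_iff₀ hL', mul_comm]
    refine ((u n).norm_coeff_sq_le hs.le k).trans ?_
    gcongr
    exact hu n
  obtain ⟨c, -, a, ha, hlim⟩ := hK.tendsto_subseq hmem
  have hlim' : ∀ k, Tendsto (fun n => coeff L (u (a n)).fn k) atTop (𝓝 (c k)) := fun k =>
    (tendsto_pi_nhds.1 hlim) k
  refine ⟨a, ha, fun ε hε => ?_⟩
  -- Differences have norm at most `2R`, and outside `[-M, M]` the weight gains `(1 + M²)^{-s}`. So
  -- `M` makes the high frequencies contribute less than `ε / 2`; the finitely many others are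
  -- treated by convergence.
  obtain ⟨M, hM⟩ : ∃ M : ℕ, (1 + (M : ℝ) ^ 2) ^ (-s) * (2 * R) ^ 2 < ε / 2 := by
    have h1 : Tendsto (fun M : ℕ => 1 + (M : ℝ) ^ 2) atTop atTop :=
      tendsto_atTop_add_const_left _ _ ((tendsto_pow_atTop two_ne_zero).comp
        tendsto_natCast_atTop_atTop)
    have h2 := ((tendsto_rpow_neg_atTop hs).comp h1).mul_const ((2 * R) ^ 2)
    rw [zero_mul] at h2
    exact (h2.eventually (gt_mem_nhds (half_pos hε))).exists
  set S : Finset ℤ := Finset.Icc (-(M : ℤ)) M with hS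
  have hfin : ∃ N, ∀ n ≥ N, ∀ j ≥ N,
      L * ∑ k ∈ S, ‖coeff L (u (a n)).fn k - coeff L (u (a j)).fn k‖ ^ 2 < ε / 2 := by
    have hb : Tendsto (fun p : ℕ × ℕ => L * ∑ k ∈ S,
        ‖coeff L (u (a p.1)).fn k - coeff L (u (a p.2)).fn k‖ ^ 2) (atTop ×ˢ atTop)
        (𝓝 (L * ∑ k ∈ S, ‖c k - c k‖ ^ 2)) := by
      refine (tendsto_finsetSum S fun k _ => ?_).const_mul L
      exact ((((hlim' k).comp tendsto_fst).sub ((hlim' k).comp tendsto_snd)).norm).pow 2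
    simp only [sub_self, norm_zero, ne_eq, OfNat.ofNat_ne_zero, not_false_eq_true, zero_pow,
      Finset.sum_const_zero, mul_zero] at hb
    have h2 := hb.eventually (gt_mem_nhds (half_pos hε))
    rw [prod_atTop_atTop_eq] at h2
    obtain ⟨⟨N₁, N₂⟩, hN⟩ := eventually_atTop.1 h2
    exact ⟨max N₁ N₂, fun n hn j hj => hN (n, j)
      ⟨(le_max_left _ _).trans hn, (le_max_right _ _).trans hj⟩⟩
  obtain ⟨N, hN⟩ := hfin
  refine ⟨N, fun n hn j hj => ?_⟩
  set d := u (a n) - u (a j) with hd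
  have hdn : ‖d‖ ≤ 2 * R := (norm_sub_le _ _).trans (by linarith [hu (a n), hu (a j)])
  have hle : ∀ k : ℤ, L * ‖coeff L d.fn k‖ ^ 2 ≤ (if k ∈ S then L * ‖coeff L d.fn k‖ ^ 2 else 0)
      + (1 + (M : ℝ) ^ 2) ^ (-s) * (L * ((1 + (k : ℝ) ^ 2) ^ s * ‖coeff L d.fn k‖ ^ 2)) := by
    intro k
    split_ifs with hk
    · exact le_add_of_nonneg_right (by positivity)
    · rw [zero_add, Real.rpow_neg (by positivity), ← div_eq_inv_mul, le_div_iff₀ (by positivity)]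
      have hkM : (M : ℝ) ^ 2 ≤ (k : ℝ) ^ 2 := by
        rw [sq_le_sq, abs_of_nonneg (Nat.cast_nonneg M)]
        rw [hS, Finset.mem_Icc, not_and_or] at hk
        have : (M : ℤ) ≤ |k| := by rcases hk with h | h <;> [rw [le_abs]; rw [le_abs]] <;> omega
        exact_mod_cast this
      have : (1 + (M : ℝ) ^ 2) ^ s ≤ (1 + (k : ℝ) ^ 2) ^ s :=
        Real.rpow_le_rpow (by positivity) (by linarith) hs.le
      calc L * ‖coeff L d.fn k‖ ^ 2 * (1 + (M : ℝ) ^ 2) ^ s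
          ≤ L * ‖coeff L d.fn k‖ ^ 2 * (1 + (k : ℝ) ^ 2) ^ s := by gcongr
        _ = _ := by ring
  have h1 : HasSum (fun k : ℤ => if k ∈ S then L * ‖coeff L d.fn k‖ ^ 2 else 0)
      (∑ k ∈ S, L * ‖coeff L d.fn k‖ ^ 2) := by
    have e : ∑ k ∈ S, L * ‖coeff L d.fn k‖ ^ 2
        = ∑ k ∈ S, if k ∈ S then L * ‖coeff L d.fn k‖ ^ 2 else 0 :=
      Finset.sum_congr rfl fun k hk => by simp [hk]
    rw [e]
    exact hasSum_sum_of_ne_finset_zero fun k hk => by simp [hk]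
  have h2 := hasSum_le hle (hasSum_sq_coeff hL' d.memLp)
    (h1.add (d.hasSum_norm_sq.mul_left ((1 + (M : ℝ) ^ 2) ^ (-s))))
  have h3 := hN n hn j hj
  simp only [← Hper.coeff_fn_sub, ← hd, Finset.mul_sum] at h3
  have h4 : (1 + (M : ℝ) ^ 2) ^ (-s) * ‖d‖ ^ 2 ≤ (1 + (M : ℝ) ^ 2) ^ (-s) * (2 * R) ^ 2 := by gcongr
  linarith

/-- Smooth periodic functions are dense in `H^s_per`. -/
theorem Hper.exists_smooth_near (u : Hper L s) {ε : ℝ} (hε : 0 < ε) :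
    ∃ g, ∃ hg : SmoothPer L g, ‖u - Hper.of g (hg.memH hL.out s)‖ < ε := by
  have hL' := hL.out
  set F : ℤ → ℝ := fun k => L * ((1 + (k : ℝ) ^ 2) ^ s * ‖coeff L u.fn k‖ ^ 2) with hF
  have h0 := tendsto_tsum_compl_atTop_zero F
  obtain ⟨S₀, hS₀⟩ := eventually_atTop.1 (h0.eventually (gt_mem_nhds (show 0 < ε ^ 2 by positivity)))
  -- Truncation to a frequency set symmetric under negation keeps the function real.
  set S := S₀ ∪ S₀.image Neg.neg with hS
  have hsymm : ∀ k, -k ∈ S ↔ k ∈ S := by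
    intro k
    simp only [hS, Finset.mem_union, Finset.mem_image, neg_inj, exists_eq_right]
    constructor
    · rintro (h | h)
      · exact Or.inr ⟨-k, h, neg_neg k⟩
      · exact Or.inl h
    · rintro (h | ⟨a, ha, rfl⟩)
      · exact Or.inr h
      · exact Or.inl (by simpa using ha)
  set c : ℤ → ℂ := fun k => if k ∈ S then coeff L u.fn k else 0 with hc
  have hherm : IsHerm c := by
    intro k
    simp only [hc, hsymm]
    split_ifs
    · exact isHerm_coeff L u.fn k
    · simp
  have hrap : Rapid c := rapid_of_finite S fun k hk => by simp [hc, hk]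
  refine ⟨synth L c, smoothPer_synth hL' hrap, ?_⟩
  have hcoef : ∀ k, coeff L (u - Hper.of (synth L c) ((smoothPer_synth hL' hrap).memH hL' s)).fn k
      = if k ∈ S then 0 else coeff L u.fn k := by
    intro k
    rw [Hper.coeff_fn_sub, Hper.coeff_of, coeff_synth hL' hherm hrap.summable_norm]
    simp only [hc]
    split_ifs <;> simp
  refine lt_of_pow_lt_pow_left₀ 2 hε.le ?_
  rw [← (Hper.hasSum_norm_sq _).tsum_eq]
  refine lt_of_eq_of_lt ?_ (hS₀ S Finset.subset_union_left)
  refine Eq.trans ?_ (tsum_subtype {k | k ∉ S} F).symm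
  refine tsum_congr fun k => ?_
  rw [hcoef, Set.indicator_apply]
  simp only [mem_ofPred_eq, hF]
  split_ifs <;> simp

end

/-! ## The quadratic form of `𝓛` -/

/-- A bound of order `2r` for the symbol at the integers. -/
def SymbolBound (θ : ℝ → ℝ) (r C : ℝ) : Prop :=
  0 < C ∧ ∀ k : ℤ, |θ k| ≤ C * (1 + (k : ℝ) ^ 2) ^ r

lemma abs_rpow_le_weight {m : ℝ} (hm : 0 ≤ m) (x : ℝ) : |x| ^ m ≤ (1 + x ^ 2) ^ (m / 2) := by
  have h : |x| ^ m = (x ^ 2) ^ (m / 2) := by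
    rw [← sq_abs, ← Real.rpow_natCast, ← Real.rpow_mul (abs_nonneg x)]
    congr 1; push_cast; ring
  rw [h]
  exact Real.rpow_le_rpow (by positivity) (by linarith) (by linarith)

/-- The growth condition controls large frequencies and continuity on a compact interval the rest.
This is what makes `(𝓜u, v)` a bounded form on `H^{m/2}_per`. -/
lemma IsSymbol.bound {θ : ℝ → ℝ} {m : ℝ} (hm : 0 < m) (h : IsSymbol θ m) :
    ∃ C, SymbolBound θ (m / 2) C := by
  obtain ⟨-, hc, κ₀, υ₁, υ₂, h1, h2, hb⟩ := h
  obtain ⟨D, hD⟩ := isCompact_Icc.exists_bound_of_continuousOn (s := Icc (-κ₀) κ₀) hc.continuousOn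
  refine ⟨υ₂ + |D|, by positivity, fun k => ?_⟩
  have hw := one_le_weight (show 0 ≤ m / 2 by linarith) k
  rcases le_or_gt κ₀ |(k : ℝ)| with hk | hk
  · obtain ⟨hl, hu⟩ := hb k hk
    have hnn : 0 ≤ υ₁ * |(k : ℝ)| ^ m := by positivity
    rw [abs_of_nonneg (hnn.trans hl)]
    calc θ k ≤ υ₂ * |(k : ℝ)| ^ m := hu
      _ ≤ υ₂ * (1 + (k : ℝ) ^ 2) ^ (m / 2) := by
        gcongr; exact abs_rpow_le_weight hm.le _
      _ ≤ _ := by gcongr; linarith [abs_nonneg D]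
  · have hk' := abs_lt.1 hk
    calc |θ k| ≤ D := hD k ⟨hk'.1.le, hk'.2.le⟩
      _ ≤ (υ₂ + |D|) * 1 := by linarith [le_abs_self D]
      _ ≤ _ := by gcongr

/-- Ellipticity, used to recover `H^m` regularity of weak eigenvectors. The absolute value and the
`+ 1` are needed because `θ` may vanish or be negative at small frequencies. -/
lemma IsSymbol.weight_le {θ : ℝ → ℝ} {m : ℝ} (hm : 0 < m) (h : IsSymbol θ m) :
    ∃ C, 0 < C ∧ ∀ k : ℤ, (1 + (k : ℝ) ^ 2) ^ (m / 2) ≤ C * (|θ k| + 1) := by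
  obtain ⟨-, hc, κ₀, υ₁, υ₂, h1, h2, hb⟩ := h
  refine ⟨2 ^ (m / 2) / υ₁ + (1 + κ₀ ^ 2 + 1) ^ (m / 2), by positivity, fun k => ?_⟩
  rcases le_or_gt (max κ₀ 1) |(k : ℝ)| with hk | hk
  · obtain ⟨hl, hu⟩ := hb k ((le_max_left _ _).trans hk)
    have hk1 : 1 ≤ |(k : ℝ)| := (le_max_right _ _).trans hk
    have e : (1 + (k : ℝ) ^ 2) ^ (m / 2) ≤ 2 ^ (m / 2) * |(k : ℝ)| ^ m := by
      have h3 : |(k : ℝ)| ^ m = (|(k : ℝ)| ^ 2) ^ (m / 2) := by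
        rw [← Real.rpow_natCast, ← Real.rpow_mul (abs_nonneg _)]
        congr 1; push_cast; ring
      rw [h3, ← Real.mul_rpow (by norm_num) (by positivity)]
      refine Real.rpow_le_rpow (by positivity) ?_ (by linarith)
      rw [sq_abs]
      nlinarith [sq_abs (k : ℝ)]
    have h4 : 2 ^ (m / 2) * |(k : ℝ)| ^ m ≤ 2 ^ (m / 2) / υ₁ * |θ k| := by
      rw [div_mul_eq_mul_div, le_div_iff₀ h1, mul_assoc]
      gcongr
      rw [mul_comm]
      exact hl.trans (le_abs_self _)
    calc _ ≤ 2 ^ (m / 2) / υ₁ * |θ k| := e.trans h4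
      _ ≤ _ := by gcongr <;> linarith [show (0:ℝ) ≤ (1 + κ₀ ^ 2 + 1) ^ (m / 2) by positivity]
  · have h5 : (1 + (k : ℝ) ^ 2) ^ (m / 2) ≤ (1 + κ₀ ^ 2 + 1) ^ (m / 2) := by
      refine Real.rpow_le_rpow (by positivity) ?_ (by linarith)
      have : |(k : ℝ)| ^ 2 ≤ max κ₀ 1 ^ 2 := by gcongr
      rw [sq_abs] at this
      have h6 : max κ₀ 1 ^ 2 ≤ κ₀ ^ 2 + 1 := by
        rcases max_choice κ₀ 1 with h | h <;> rw [h] <;> nlinarith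
      linarith
    calc _ ≤ (1 + κ₀ ^ 2 + 1) ^ (m / 2) * 1 := by rw [mul_one]; exact h5
      _ ≤ _ := by
        gcongr
        · exact le_add_of_nonneg_left (by positivity)
        · linarith [abs_nonneg (θ k)]

lemma hasSum_congr {f g : ℤ → ℝ} {a : ℝ} (h : ∀ k, f k = g k) : HasSum f a ↔ HasSum g a := by
  rw [funext h]

lemma memLp_mul_continuous {L : ℝ} {q u : ℝ → ℝ} (hq : Continuous q)
    (hu : MemLp u 2 (volume.restrict (Ioc 0 L))) :
    MemLp (fun x => q x * u x) 2 (volume.restrict (Ioc 0 L)) := by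
  obtain ⟨D, hD⟩ := isCompact_Icc.exists_bound_of_continuousOn (s := Icc 0 L) hq.continuousOn
  refine MemLp.of_le_mul (c := D) hu (hq.aestronglyMeasurable.mul hu.1) ?_
  filter_upwards [ae_restrict_mem measurableSet_Ioc] with x hx
  rw [norm_mul]
  exact mul_le_mul_of_nonneg_right (hD x ⟨hx.1.le, hx.2⟩) (norm_nonneg _)

lemma innerPer_comm (L : ℝ) (u v : ℝ → ℝ) : innerPer L u v = innerPer L v u := by
  simp only [innerPer, mul_comm]

lemma innerPer_congr {L : ℝ} (hL : 0 < L) {u u' v v' : ℝ → ℝ} (hu : AEEqPer L u u')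
    (hv : AEEqPer L v v') : innerPer L u v = innerPer L u' v' := by
  unfold innerPer
  rw [intervalIntegral.integral_of_le hL.le, intervalIntegral.integral_of_le hL.le]
  refine integral_congr_ae ?_
  filter_upwards [hu, hv] with x hx hy
  rw [hx, hy]

lemma innerPer_add_left {L : ℝ} (hL : 0 < L) {u v w : ℝ → ℝ}
    (hu : MemLp u 2 (volume.restrict (Ioc 0 L))) (hv : MemLp v 2 (volume.restrict (Ioc 0 L)))
    (hw : MemLp w 2 (volume.restrict (Ioc 0 L))) :
    innerPer L (fun x => u x + v x) w = innerPer L u w + innerPer L v w := by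
  simp only [innerPer, add_mul]
  exact intervalIntegral.integral_add (intervalIntegrable_mul_of_memLp hL hu hw)
    (intervalIntegrable_mul_of_memLp hL hv hw)

lemma innerPer_smul_left (L c : ℝ) (u w : ℝ → ℝ) :
    innerPer L (fun x => c * u x) w = c * innerPer L u w := by
  simp only [innerPer, mul_assoc]
  exact intervalIntegral.integral_const_mul _ _

/-- A bound by a sum of squares is enough, because `form_bound` turns it into a bilinear bound by
scaling. -/
lemma abs_innerPer_mul_le {L : ℝ} (hL : 0 < L) {q u v : ℝ → ℝ} {D : ℝ}
    (hD : ∀ x ∈ Icc 0 L, |q x| ≤ D) (hu : MemLp u 2 (volume.restrict (Ioc 0 L)))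
    (hv : MemLp v 2 (volume.restrict (Ioc 0 L))) :
    |innerPer L (fun x => q x * u x) v|
      ≤ D * ((∫ x in (0 : ℝ)..L, u x ^ 2) + ∫ x in (0 : ℝ)..L, v x ^ 2) := by
  have i1 := intervalIntegrable_mul_of_memLp hL hu hu
  have i2 := intervalIntegrable_mul_of_memLp hL hv hv
  simp only [← sq] at i1 i2
  rw [← intervalIntegral.integral_add i1 i2, ← intervalIntegral.integral_const_mul, innerPer,
    ← Real.norm_eq_abs]
  refine intervalIntegral.norm_integral_le_of_norm_le hL.le (ae_of_all _ fun x hx => ?_)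
    ((i1.add i2).const_mul D)
  have h1 := hD x ⟨hx.1.le, hx.2⟩
  rw [Real.norm_eq_abs, mul_assoc, abs_mul]
  have h2 : |u x * v x| ≤ u x ^ 2 + v x ^ 2 := by
    rw [abs_mul]; nlinarith [sq_abs (u x), sq_abs (v x), sq_nonneg (|u x| - |v x|)]
  exact mul_le_mul h1 h2 (abs_nonneg _) ((abs_nonneg _).trans h1)

lemma innerPer_self (L : ℝ) (u : ℝ → ℝ) : innerPer L u u = ∫ x in (0 : ℝ)..L, u x ^ 2 := by
  simp only [innerPer, sq]

lemma smoothPer_deriv_comp {L : ℝ} {f φ : ℝ → ℝ} (hf : ContDiff ℝ (⊤ : ℕ∞) f) (hφ : SmoothPer L φ) :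
    SmoothPer L (fun x => deriv f (φ x)) := by
  refine SmoothPer.comp ?_ hφ
  rw [show ((⊤ : ℕ∞) : WithTop ℕ∞) = (⊤ : ℕ∞) + 1 from rfl, contDiff_succ_iff_deriv] at hf
  exact hf.2.2

/-- The potential `ω - f'(φ)`. -/
noncomputable def linPot (f : ℝ → ℝ) (ω : ℝ) (φ : ℝ → ℝ) (x : ℝ) : ℝ := ω - deriv f (φ x)

lemma smoothPer_linPot {L : ℝ} {f φ : ℝ → ℝ} (hf : ContDiff ℝ (⊤ : ℕ∞) f) (ω : ℝ) (hφ : SmoothPer L φ) :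
    SmoothPer L (linPot f ω φ) :=
  (SmoothPer.const L ω).sub (smoothPer_deriv_comp hf hφ)

section Form

variable {L : ℝ} [hL : Fact (0 < L)] {r : ℝ}

lemma kin_summable {θ : ℝ → ℝ} {C : ℝ} (hθ : SymbolBound θ r C) (u v : Hper L r) :
    Summable fun k : ℤ => θ k * (coeff L u.fn k * (starRingEnd ℂ) (coeff L v.fn k)).re := by
  have hC := hθ.1
  refine summable_re_mul_conj (w := fun k : ℤ => C * (1 + (k : ℝ) ^ 2) ^ r)
    (fun k => by positivity) hθ.2 ?_ ?_
  · simpa only [mul_assoc] using u.memH.2.mul_left C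
  · simpa only [mul_assoc] using v.memH.2.mul_left C

/-- The form `(𝓜u, v)` on `H^r_per`. -/
noncomputable def kinForm (θ : ℝ → ℝ) {C : ℝ} (hθ : SymbolBound θ r C) :
    Hper L r →ₗ[ℝ] Hper L r →ₗ[ℝ] ℝ :=
  LinearMap.mk₂ ℝ (fun u v => L * ∑' k : ℤ,
      θ k * (coeff L u.fn k * (starRingEnd ℂ) (coeff L v.fn k)).re)
    (fun u v w => by
      rw [← mul_add, ← (kin_summable hθ u w).tsum_add (kin_summable hθ v w)]
      congr 1
      refine tsum_congr fun k => ?_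
      rw [Hper.coeff_fn_add, add_mul, Complex.add_re, mul_add])
    (fun c u v => by
      rw [smul_eq_mul, mul_left_comm, ← tsum_mul_left (a := c)]
      congr 1
      refine tsum_congr fun k => ?_
      rw [Hper.coeff_fn_smul, mul_assoc, Complex.re_ofReal_mul]; ring)
    (fun u v w => by
      rw [← mul_add, ← (kin_summable hθ u v).tsum_add (kin_summable hθ u w)]
      congr 1
      refine tsum_congr fun k => ?_
      rw [Hper.coeff_fn_add, map_add, mul_add, Complex.add_re, mul_add])
    (fun c u v => by
      rw [smul_eq_mul, mul_left_comm, ← tsum_mul_left (a := c)]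
      congr 1
      refine tsum_congr fun k => ?_
      rw [Hper.coeff_fn_smul, map_mul, Complex.conj_ofReal, mul_left_comm, Complex.re_ofReal_mul]
      ring)

lemma kinForm_hasSum {θ : ℝ → ℝ} {C : ℝ} (hθ : SymbolBound θ r C) (u v : Hper L r) :
    HasSum (fun k : ℤ => L * (θ k * (coeff L u.fn k * (starRingEnd ℂ) (coeff L v.fn k)).re))
      (kinForm θ hθ u v) := (kin_summable hθ u v).hasSum.mul_left L

/-- The form `(qu, v)` on `H^r_per`. -/
noncomputable def potForm (q : ℝ → ℝ) (hq : Continuous q) : Hper L r →ₗ[ℝ] Hper L r →ₗ[ℝ] ℝ :=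
  LinearMap.mk₂ ℝ (fun u v => innerPer L (fun x => q x * u.fn x) v.fn)
    (fun u v w => by
      rw [← innerPer_add_left hL.out (memLp_mul_continuous hq u.memLp)
        (memLp_mul_continuous hq v.memLp) w.memLp]
      refine innerPer_congr hL.out ?_ (EventuallyEq.refl _ _)
      filter_upwards [Hper.fn_add u v] with x hx
      rw [hx, mul_add])
    (fun c u v => by
      rw [smul_eq_mul, ← innerPer_smul_left]
      refine innerPer_congr hL.out ?_ (EventuallyEq.refl _ _)
      filter_upwards [Hper.fn_smul c u] with x hx
      rw [hx]; ring)
    (fun u v w => by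
      rw [innerPer_comm, innerPer_comm L _ v.fn, innerPer_comm L _ w.fn,
        ← innerPer_add_left hL.out v.memLp w.memLp (memLp_mul_continuous hq u.memLp)]
      exact innerPer_congr hL.out (Hper.fn_add v w) (EventuallyEq.refl _ _))
    (fun c u v => by
      rw [innerPer_comm, innerPer_comm L _ v.fn, smul_eq_mul, ← innerPer_smul_left]
      exact innerPer_congr hL.out (Hper.fn_smul c v) (EventuallyEq.refl _ _))

lemma potForm_apply {q : ℝ → ℝ} (hq : Continuous q) (u v : Hper L r) :
    potForm q hq u v = innerPer L (fun x => q x * u.fn x) v.fn := rfl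

/-- The `L²` inner product on `H^r_per`. -/
noncomputable def l2Form : Hper L r →ₗ[ℝ] Hper L r →ₗ[ℝ] ℝ := potForm (fun _ => 1) continuous_const

lemma l2Form_apply (u v : Hper L r) : l2Form u v = innerPer L u.fn v.fn := by
  simp only [l2Form, potForm_apply, one_mul]

/-- The form of the operator `𝓜 + q`. -/
noncomputable def linForm (θ : ℝ → ℝ) {C : ℝ} (hθ : SymbolBound θ r C) (q : ℝ → ℝ)
    (hq : Continuous q) : Hper L r →ₗ[ℝ] Hper L r →ₗ[ℝ] ℝ := kinForm θ hθ + potForm q hq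

lemma linForm_apply {θ : ℝ → ℝ} {C : ℝ} (hθ : SymbolBound θ r C) {q : ℝ → ℝ} (hq : Continuous q)
    (u v : Hper L r) : linForm θ hθ q hq u v = kinForm θ hθ u v + potForm q hq u v := rfl

lemma kinForm_symm {θ : ℝ → ℝ} {C : ℝ} (hθ : SymbolBound θ r C) (u v : Hper L r) :
    kinForm θ hθ u v = kinForm θ hθ v u := by
  refine (kinForm_hasSum hθ u v).unique ((hasSum_congr fun k => ?_).2 (kinForm_hasSum hθ v u))
  rw [← Complex.conj_re, map_mul, Complex.conj_conj, mul_comm (coeff L v.fn k)]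

lemma potForm_symm {q : ℝ → ℝ} (hq : Continuous q) (u v : Hper L r) :
    potForm q hq u v = potForm q hq v u := by
  simp only [potForm_apply, innerPer]
  congr 1; ext x; ring

lemma kinForm_bound {θ : ℝ → ℝ} {C : ℝ} (hθ : SymbolBound θ r C) (u v : Hper L r) :
    |kinForm θ hθ u v| ≤ C * (‖u‖ ^ 2 + ‖v‖ ^ 2) := by
  have hL' := hL.out
  have hC := hθ.1
  have hb := (u.hasSum_norm_sq.add v.hasSum_norm_sq).mul_left C
  rw [← Real.norm_eq_abs, ← (kinForm_hasSum hθ u v).tsum_eq, ← hb.tsum_eq]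
  refine tsum_of_norm_bounded hb.summable.hasSum fun k => ?_
  rw [Real.norm_eq_abs, abs_mul, abs_mul, abs_of_pos hL']
  have h1 := abs_re_mul_conj_le (coeff L u.fn k) (coeff L v.fn k)
  have h2 : ‖coeff L u.fn k‖ * ‖coeff L v.fn k‖ ≤ ‖coeff L u.fn k‖ ^ 2 + ‖coeff L v.fn k‖ ^ 2 := by
    nlinarith [sq_nonneg (‖coeff L u.fn k‖ - ‖coeff L v.fn k‖), sq_nonneg ‖coeff L u.fn k‖,
      sq_nonneg ‖coeff L v.fn k‖]
  calc L * (|θ k| * |(coeff L u.fn k * (starRingEnd ℂ) (coeff L v.fn k)).re|)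
      ≤ L * ((C * (1 + (k : ℝ) ^ 2) ^ r) * (‖coeff L u.fn k‖ ^ 2 + ‖coeff L v.fn k‖ ^ 2)) := by
        gcongr
        · exact hθ.2 k
        · exact h1.trans h2
    _ = _ := by ring

lemma potForm_bound (hr : 0 ≤ r) {q : ℝ → ℝ} (hq : Continuous q) :
    ∃ D, ∀ u v : Hper L r, |potForm q hq u v| ≤ D * (‖u‖ ^ 2 + ‖v‖ ^ 2) := by
  obtain ⟨D, hD⟩ := isCompact_Icc.exists_bound_of_continuousOn (s := Icc 0 L) hq.continuousOn
  have hD0 : 0 ≤ D := (norm_nonneg _).trans (hD 0 ⟨le_rfl, hL.out.le⟩)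
  refine ⟨D, fun u v => (abs_innerPer_mul_le hL.out hD u.memLp v.memLp).trans ?_⟩
  gcongr
  · exact u.integral_sq_le hr
  · exact v.integral_sq_le hr

lemma kinForm_bounded {θ : ℝ → ℝ} {C : ℝ} (hθ : SymbolBound θ r C) :
    ∃ D, ∀ u v : Hper L r, |kinForm θ hθ u v| ≤ D * ‖u‖ * ‖v‖ :=
  ⟨_, form_bound (kinForm_bound hθ)⟩

lemma potForm_bounded (hr : 0 ≤ r) {q : ℝ → ℝ} (hq : Continuous q) :
    ∃ D, ∀ u v : Hper L r, |potForm q hq u v| ≤ D * ‖u‖ * ‖v‖ := by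
  obtain ⟨D, hD⟩ := potForm_bound (L := L) hr hq
  exact ⟨_, form_bound hD⟩

lemma linForm_bounded (hr : 0 ≤ r) {θ : ℝ → ℝ} {C : ℝ} (hθ : SymbolBound θ r C) {q : ℝ → ℝ}
    (hq : Continuous q) : ∃ D, ∀ u v : Hper L r, |linForm θ hθ q hq u v| ≤ D * ‖u‖ * ‖v‖ := by
  obtain ⟨D₁, h1⟩ := kinForm_bounded (L := L) hθ
  obtain ⟨D₂, h2⟩ := potForm_bounded (L := L) hr hq
  refine ⟨D₁ + D₂, fun u v => (abs_add_le _ _).trans ?_⟩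
  rw [add_mul, add_mul]
  exact add_le_add (h1 u v) (h2 u v)

/-! ### Relation with the operator -/

lemma rapid_symbol {θ : ℝ → ℝ} {C : ℝ} (hθ : SymbolBound θ r C) {c : ℤ → ℂ} (hc : Rapid c) :
    Rapid fun k => (θ k : ℂ) * c k := by
  obtain ⟨D, N, hD, h⟩ := weight_le r
  have hC := hθ.1
  refine hc.mul (C := C * D) (N := N) fun k => ?_
  rw [Complex.norm_real, Real.norm_eq_abs, mul_assoc]
  exact (hθ.2 k).trans (by gcongr; exact h k)

lemma isHerm_symbol {θ : ℝ → ℝ} (he : ∀ κ, θ (-κ) = θ κ) {c : ℤ → ℂ} (hc : IsHerm c) :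
    IsHerm fun k => (θ k : ℂ) * c k := by
  intro k
  simp only [map_mul, Complex.conj_ofReal, hc k]
  push_cast
  rw [he]

lemma multiplier_eq_synth (L : ℝ) (θ g : ℝ → ℝ) :
    multiplier L θ g = synth L fun k => (θ k : ℂ) * coeff L g k := rfl

lemma smoothPer_multiplier {θ : ℝ → ℝ} {C : ℝ} (hθ : SymbolBound θ r C) {g : ℝ → ℝ}
    (hg : SmoothPer L g) : SmoothPer L (multiplier L θ g) := by
  rw [multiplier_eq_synth]
  exact smoothPer_synth hL.out (rapid_symbol hθ (hg.rapid hL.out))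

lemma coeff_multiplier {θ : ℝ → ℝ} (he : ∀ κ, θ (-κ) = θ κ) {C : ℝ} (hθ : SymbolBound θ r C)
    {g : ℝ → ℝ} (hg : SmoothPer L g) (k : ℤ) :
    coeff L (multiplier L θ g) k = θ k * coeff L g k := by
  rw [multiplier_eq_synth]
  exact coeff_synth hL.out (isHerm_symbol he (isHerm_coeff L g))
    (rapid_symbol hθ (hg.rapid hL.out)).summable_norm k

lemma kinForm_of_smooth {θ : ℝ → ℝ} (he : ∀ κ, θ (-κ) = θ κ) {C : ℝ} (hθ : SymbolBound θ r C)
    {g : ℝ → ℝ} (hg : SmoothPer L g) (v : Hper L r) :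
    kinForm θ hθ (Hper.of g (hg.memH hL.out r)) v = innerPer L (multiplier L θ g) v.fn := by
  refine (kinForm_hasSum hθ _ v).unique ?_
  refine (hasSum_congr fun k => ?_).2
    (hasSum_coeff_mul hL.out (smoothPer_multiplier hθ hg).memLp v.memLp)
  rw [Hper.coeff_of, coeff_multiplier he hθ hg, mul_assoc, Complex.re_ofReal_mul]

lemma linForm_of_smooth {θ : ℝ → ℝ} (he : ∀ κ, θ (-κ) = θ κ) {C : ℝ} (hθ : SymbolBound θ r C)
    {q : ℝ → ℝ} (hq : Continuous q) {g : ℝ → ℝ} (hg : SmoothPer L g) (v : Hper L r) :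
    linForm θ hθ q hq (Hper.of g (hg.memH hL.out r)) v
      = innerPer L (fun x => multiplier L θ g x + q x * g x) v.fn := by
  rw [linForm_apply, kinForm_of_smooth he hθ hg,
    innerPer_add_left hL.out (smoothPer_multiplier hθ hg).memLp
      (memLp_mul_continuous hq hg.memLp) v.memLp, potForm_apply]
  congr 1
  refine innerPer_congr hL.out ?_ (EventuallyEq.refl _ _)
  filter_upwards [Hper.fn_of (hg.memH hL.out r)] with x hx
  rw [hx]

lemma linOp_eq (L : ℝ) (θ f : ℝ → ℝ) (ω : ℝ) (φ v : ℝ → ℝ) :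
    linOp L θ f ω φ v = fun x => multiplier L θ v x + linPot f ω φ x * v x := by
  ext x; simp only [linOp, linPot]; ring

/-- Positivity of the `L²` form is Parseval, compactness is Rellich, and Gårding's inequality,
assumed for smooth functions only, extends by density because both forms are bounded. -/
theorem gardingPair_linForm (hr : 0 < r) {θ f φ : ℝ → ℝ} (he : ∀ κ, θ (-κ) = θ κ) {C : ℝ}
    (hθ : SymbolBound θ r C) {ω m : ℝ} (hm : m / 2 = r)
    (hq : Continuous (linPot f ω φ)) (hG : Garding L θ f m ω φ) :
    GardingPair (linForm (L := L) θ hθ (linPot f ω φ) hq) l2Form where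
  symmB u v := by simp only [linForm_apply, kinForm_symm hθ u v, potForm_symm hq u v]
  symmJ u v := potForm_symm _ u v
  boundB := linForm_bounded hr.le hθ hq
  boundJ := potForm_bounded hr.le _
  posJ u hu := by
    rw [l2Form_apply, innerPer_self]
    have h := hasSum_sq_coeff hL.out u.memLp
    have hL' := hL.out
    refine lt_of_le_of_ne (h.nonneg fun k => by positivity) fun h0 => hu ?_
    rw [← h0, hasSum_zero_iff_of_nonneg fun k => by positivity] at h
    refine Hper.ext_coeff fun k => ?_
    rw [Hper.coeff_fn_zero]
    have := congrFun h k
    simpa [hL'.ne'] using this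
  garding := by
    obtain ⟨c₁, c₂, h1, h2, h⟩ := hG
    refine ⟨c₁, c₂, h1, h2, fun v => ?_⟩
    have hsm : ∀ g, ∀ hg : SmoothPer L g, c₁ * ‖Hper.of g (hg.memH hL.out r)‖ ^ 2
        - c₂ * l2Form (Hper.of g (hg.memH hL.out r)) (Hper.of g (hg.memH hL.out r))
        ≤ linForm (L := L) θ hθ (linPot f ω φ) hq (Hper.of g (hg.memH hL.out r))
          (Hper.of g (hg.memH hL.out r)) := by
      intro g hg
      have h3 := h g hg
      rw [linForm_of_smooth he hθ hq hg, ← linOp_eq, innerPer_congr hL.out (EventuallyEq.refl _ _)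
        (Hper.fn_of (hg.memH hL.out r)), l2Form_apply, innerPer_congr hL.out
        (Hper.fn_of (hg.memH hL.out r)) (Hper.fn_of (hg.memH hL.out r)), Hper.norm_of, ← hm]
      have h4 : sobNorm L 0 g ^ 2 = innerPer L g g := by
        rw [sobNorm, Real.sq_sqrt, ← tsum_mul_left, innerPer_self,
          ← (hasSum_sq_coeff hL.out hg.memLp).tsum_eq]
        · simp
        · exact mul_nonneg hL.out.le (tsum_nonneg fun k => by positivity)
      rwa [h4] at h3
    have hseq : ∀ n : ℕ, ∃ g, ∃ hg : SmoothPer L g,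
        ‖v - Hper.of g (hg.memH hL.out r)‖ < 1 / (n + 1 : ℝ) :=
      fun n => v.exists_smooth_near (by positivity)
    choose g hg hgn using hseq
    have ht : Tendsto (fun n => Hper.of (g n) ((hg n).memH hL.out r)) atTop (𝓝 v) := by
      rw [tendsto_iff_norm_sub_tendsto_zero]
      refine squeeze_zero (fun n => norm_nonneg _) (fun n => ?_)
        (tendsto_one_div_add_atTop_nhds_zero_nat (𝕜 := ℝ))
      rw [norm_sub_rev]
      exact (hgn n).le
    refine le_of_tendsto_of_tendsto' (((ht.norm.pow 2).const_mul c₁).sub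
      ((tendsto_form (potForm_bounded hr.le _) ht ht).const_mul c₂))
      (tendsto_form (linForm_bounded hr.le hθ hq) ht ht) fun n => hsm _ (hg n)
  compact R u hu := by
    simp only [l2Form_apply, innerPer_self]
    exact Hper.rellich hr R u hu

/-! ### Eigenvectors -/

lemma coeff_linPot_mul {f φ v : ℝ → ℝ} (hf : ContDiff ℝ (⊤ : ℕ∞) f) (ω : ℝ) (hφ : SmoothPer L φ)
    (hv : MemLp v 2 (volume.restrict (Ioc 0 L))) (k : ℤ) :
    coeff L (fun x => linPot f ω φ x * v x) k
      = ω * coeff L v k - coeff L (fun x => deriv f (φ x) * v x) k := by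
  have h := coeff_sub hL.out (hv.const_mul ω)
    (memLp_mul_continuous (smoothPer_deriv_comp hf hφ).continuous hv) k
  rw [coeff_smul] at h
  rw [← h]
  congr 1
  ext x
  simp only [linPot]; ring

/-- By Parseval, the coefficientwise eigenvalue equation, paired with the coefficients of `w` and
summed, is the weak equation. -/
lemma EigenEq.weak {θ f φ v : ℝ → ℝ} {C m ω ν : ℝ} (hθ : SymbolBound θ r C)
    (hf : ContDiff ℝ (⊤ : ℕ∞) f) (hφ : SmoothPer L φ) (hq : Continuous (linPot f ω φ))
    (h : EigenEq L θ f m ω φ ν v) (hv : MemH L r v) (w : Hper L r) :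
    linForm θ hθ (linPot f ω φ) hq (Hper.of v hv) w = ν * l2Form (Hper.of v hv) w := by
  have h1 := (kinForm_hasSum hθ (Hper.of v hv) w).add
    (hasSum_coeff_mul hL.out (memLp_mul_continuous hq (Hper.of v hv).memLp) w.memLp)
  have h2 := (hasSum_coeff_mul hL.out (Hper.of v hv).memLp w.memLp).mul_left ν
  rw [linForm_apply, potForm_apply, l2Form_apply]
  refine h1.unique ((hasSum_congr fun k => ?_).2 h2)
  have e := h.2 k
  rw [coeff_linPot_mul hf ω hφ (Hper.of v hv).memLp,
    coeff_congr hL.out (u := fun x => deriv f (φ x) * (Hper.of v hv).fn x)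
      (v := fun x => deriv f (φ x) * v x)
      (by filter_upwards [Hper.fn_of hv] with x hx; rw [hx]), Hper.coeff_of]
  have e2 : ∀ z : ℂ, (ν * (coeff L v k * z)).re = ((ν * coeff L v k) * z).re := fun z => by
    rw [mul_assoc]
  rw [mul_left_comm ν L, ← Complex.re_ofReal_mul ν, e2, ← e, ← Complex.re_ofReal_mul, ← mul_add,
    ← Complex.add_re]
  congr 2
  ring

/-- The real trigonometric monomial with coefficients `z` at `k` and `z̄` at `-k`. -/
lemma exists_test (k : ℤ) (z : ℂ) : ∃ g, SmoothPer L g ∧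
    ∀ (θ : ℝ → ℝ) (x : ℤ → ℂ), (∀ κ, θ (-κ) = θ κ) → IsHerm x →
      HasSum (fun j : ℤ => L * (θ j * (x j * (starRingEnd ℂ) (coeff L g j)).re))
        (2 * L * (θ k * (x k * (starRingEnd ℂ) z).re)) := by
  -- Writing `c` as a sum of two terms makes `k = 0` no exception: there the two contributions
  -- simply add up.
  set c : ℤ → ℂ := fun j => (if j = k then z else 0) + if j = -k then (starRingEnd ℂ) z else 0 with hc
  have hh : IsHerm c := by
    intro j
    simp only [hc, map_add, neg_inj, apply_ite (starRingEnd ℂ), map_zero, Complex.conj_conj]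
    rw [add_comm]
    simp only [neg_eq_iff_eq_neg]
  have hrap : Rapid c := rapid_of_finite {k, -k} fun j hj => by
    simp only [Finset.mem_insert, Finset.mem_singleton, not_or] at hj
    simp [hc, hj.1, hj.2]
  refine ⟨synth L c, smoothPer_synth hL.out hrap, fun θ x he hx => ?_⟩
  simp only [coeff_synth hL.out hh hrap.summable_norm]
  have h1 : HasSum (fun j : ℤ => L * (θ j * (x j * (starRingEnd ℂ) (if j = k then z else 0)).re))
      (L * (θ k * (x k * (starRingEnd ℂ) z).re)) := by
    have := hasSum_single (f := fun j : ℤ => L * (θ j * (x j * (starRingEnd ℂ)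
      (if j = k then z else 0)).re)) k (fun j hj => by simp [hj])
    simpa using this
  have h2 : HasSum (fun j : ℤ => L * (θ j * (x j * (starRingEnd ℂ)
      (if j = -k then (starRingEnd ℂ) z else 0)).re)) (L * (θ k * (x k * (starRingEnd ℂ) z).re)) := by
    have := hasSum_single (f := fun j : ℤ => L * (θ j * (x j * (starRingEnd ℂ)
      (if j = -k then (starRingEnd ℂ) z else 0)).re)) (-k) (fun j hj => by simp [hj])
    have e : θ ((-k : ℤ) : ℝ) = θ k := by push_cast; rw [he]
    rw [if_pos rfl, hx k, ← map_mul, Complex.conj_re, e] at this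
    exact this
  have h3 := h1.add h2
  rw [← two_mul, ← mul_assoc] at h3
  refine (hasSum_congr fun j => ?_).2 h3
  simp only [hc, map_add, mul_add, Complex.add_re]

/-- The minimization works in the form domain, while the spectral hypothesis concerns eigenfunctions
in `H^m_per`. Testing against trigonometric monomials gives the equation coefficient by coefficient.
Then `θ(k) v̂(k)` is the coefficient of an `L²` function, and ellipticity gives `v ∈ H^m_per`. -/
lemma eigenEq_of_weak {θ f φ : ℝ → ℝ} {C m ω ν : ℝ} (hm : 0 < m) (hsym : IsSymbol θ m)
    (hθ : SymbolBound θ r C) (hf : ContDiff ℝ (⊤ : ℕ∞) f) (hφ : SmoothPer L φ)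
    (hq : Continuous (linPot f ω φ)) (v : Hper L r)
    (h : ∀ w, linForm θ hθ (linPot f ω φ) hq v w = ν * l2Form v w) :
    EigenEq L θ f m ω φ ν v.fn := by
  have he := hsym.1
  have hcoef : ∀ k : ℤ, (θ k : ℂ) * coeff L v.fn k + (ω : ℂ) * coeff L v.fn k
      - coeff L (fun x => deriv f (φ x) * v.fn x) k = (ν : ℂ) * coeff L v.fn k := by
    intro k
    -- The residual at frequency `k` is itself the amplitude of the test function, so the weak
    -- equation reads `|z|² = 0`.
    set z : ℂ := (θ k : ℂ) * coeff L v.fn k + coeff L (fun x => linPot f ω φ x * v.fn x) k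
      - ν * coeff L v.fn k with hz
    suffices hz0 : z = 0 by
      rw [hz, coeff_linPot_mul hf ω hφ v.memLp] at hz0
      rw [← sub_eq_zero, ← hz0]; ring
    obtain ⟨g, hg, htest⟩ := exists_test (L := L) k z
    have h1 := h (Hper.of g (hg.memH hL.out r))
    rw [linForm_apply, potForm_apply, l2Form_apply] at h1
    have e1 := (kinForm_hasSum hθ v (Hper.of g (hg.memH hL.out r)))
    have e2 := hasSum_coeff_mul hL.out (memLp_mul_continuous hq v.memLp)
      (Hper.of g (hg.memH hL.out r)).memLp
    have e3 := hasSum_coeff_mul hL.out v.memLp (Hper.of g (hg.memH hL.out r)).memLp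
    simp only [Hper.coeff_of] at e1 e2 e3
    have t1 := htest θ _ he (isHerm_coeff L v.fn)
    have t2 := htest (fun _ => 1) _ (fun _ => rfl) (isHerm_coeff L (fun x => linPot f ω φ x * v.fn x))
    have t3 := htest (fun _ => 1) _ (fun _ => rfl) (isHerm_coeff L v.fn)
    simp only [one_mul] at t2 t3
    rw [e1.unique t1, e2.unique t2, e3.unique t3] at h1
    have h2 : (z * (starRingEnd ℂ) z).re = 0 := by
      have e : (z * (starRingEnd ℂ) z).re = θ k * (coeff L v.fn k * (starRingEnd ℂ) z).re
          + (coeff L (fun x => linPot f ω φ x * v.fn x) k * (starRingEnd ℂ) z).re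
          - ν * (coeff L v.fn k * (starRingEnd ℂ) z).re := by
        conv_lhs => rw [hz]
        rw [sub_mul, add_mul, mul_assoc, mul_assoc, Complex.sub_re, Complex.add_re,
          Complex.re_ofReal_mul, Complex.re_ofReal_mul]
      have hL' := hL.out
      rw [e]
      have h3 : 2 * L * (θ k * (coeff L v.fn k * (starRingEnd ℂ) z).re
          + (coeff L (fun x => linPot f ω φ x * v.fn x) k * (starRingEnd ℂ) z).re
          - ν * (coeff L v.fn k * (starRingEnd ℂ) z).re) = 0 := by linarith
      exact (mul_eq_zero.1 h3).resolve_left (by positivity)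
    rw [Complex.mul_conj, Complex.ofReal_re] at h2
    exact Complex.normSq_eq_zero.1 h2
  refine ⟨⟨v.memLp, ?_⟩, hcoef⟩
  obtain ⟨D, hD, hw⟩ := hsym.weight_le hm
  have hsq : ∀ u : ℝ → ℝ, MemLp u 2 (volume.restrict (Ioc 0 L)) →
      Summable fun k => ‖coeff L u k‖ ^ 2 := fun u hu => by
    have := (hasSum_sq_coeff hL.out hu).summable.mul_left L⁻¹
    simpa [hL.out.ne'] using this
  have s1 := hsq _ v.memLp
  have s2 := hsq _ (memLp_mul_continuous (smoothPer_deriv_comp hf hφ).continuous v.memLp)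
  refine Summable.of_nonneg_of_le (fun k => by positivity) (fun k => ?_)
    ((s1.add s2).mul_left (2 * D ^ 2 * ((|ν - ω| + 1) ^ 2 + 1)))
  set a := ‖coeff L v.fn k‖
  set b := ‖coeff L (fun x => deriv f (φ x) * v.fn x) k‖
  have e1 : |θ k| * a ≤ |ν - ω| * a + b := by
    have : (θ k : ℂ) * coeff L v.fn k = ((ν - ω : ℝ) : ℂ) * coeff L v.fn k
        + coeff L (fun x => deriv f (φ x) * v.fn x) k := by
      push_cast
      linear_combination hcoef k
    have h2 := congrArg norm this
    rw [norm_mul, Complex.norm_real, Real.norm_eq_abs] at h2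
    rw [h2]
    refine (norm_add_le _ _).trans ?_
    rw [norm_mul, Complex.norm_real, Real.norm_eq_abs]
  have e2 : (1 + (k : ℝ) ^ 2) ^ (m / 2) * a ≤ D * ((|ν - ω| + 1) * a + b) := by
    calc (1 + (k : ℝ) ^ 2) ^ (m / 2) * a ≤ D * (|θ k| + 1) * a := by gcongr; exact hw k
      _ = D * (|θ k| * a + a) := by ring
      _ ≤ D * ((|ν - ω| * a + b) + a) := by gcongr
      _ = _ := by ring
  have e3 : (1 + (k : ℝ) ^ 2) ^ m * a ^ 2 = ((1 + (k : ℝ) ^ 2) ^ (m / 2) * a) ^ 2 := by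
    rw [mul_pow, ← Real.rpow_natCast ((1 + (k : ℝ) ^ 2) ^ (m / 2)), ← Real.rpow_mul (by positivity)]
    congr 2; push_cast; ring
  rw [e3]
  have ha : 0 ≤ a := norm_nonneg _
  have hb : 0 ≤ b := norm_nonneg _
  calc ((1 + (k : ℝ) ^ 2) ^ (m / 2) * a) ^ 2 ≤ (D * ((|ν - ω| + 1) * a + b)) ^ 2 := by gcongr
    _ = D ^ 2 * ((|ν - ω| + 1) * a + b) ^ 2 := by ring
    _ ≤ D ^ 2 * (2 * ((|ν - ω| + 1) * a) ^ 2 + 2 * b ^ 2) := by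
      gcongr
      nlinarith [sq_nonneg ((|ν - ω| + 1) * a - b)]
    _ = 2 * D ^ 2 * ((|ν - ω| + 1) ^ 2 * a ^ 2 + b ^ 2) := by ring
    _ ≤ 2 * D ^ 2 * (((|ν - ω| + 1) ^ 2 + 1) * (a ^ 2 + b ^ 2)) := by
      gcongr
      nlinarith [sq_nonneg a, sq_nonneg b, sq_nonneg (|ν - ω| + 1),
        mul_nonneg (sq_nonneg (|ν - ω| + 1)) (sq_nonneg b)]
    _ = _ := by ring

/-- Translates the spectral hypothesis from the operator to its form: strong eigenfunctions are weak
ones by `EigenEq.weak`, and simplicity among weak ones follows from `eigenEq_of_weak`. -/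
theorem SpectralCondition.oneNegative {θ f φ : ℝ → ℝ} {C m ω : ℝ} (hm : 0 < m) (hrm : r ≤ m)
    (hsym : IsSymbol θ m)
    (hθ : SymbolBound θ r C) (hf : ContDiff ℝ (⊤ : ℕ∞) f) (hφ : SmoothPer L φ)
    (hq : Continuous (linPot f ω φ)) (h : SpectralCondition L θ f m ω φ) :
    ∃ χ μ, OneNegative (linForm (L := L) θ hθ (linPot f ω φ) hq) l2Form χ
      (Hper.of (deriv φ) (hφ.deriv.memH hL.out r)) μ := by
  obtain ⟨⟨μ, hμ, χ, hχ, hχ0, huniq⟩, hψ, hψ0, hker⟩ := h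
  have hχr : MemH L r χ := hχ.1.mono hrm
  have hzero : AEEqPer L (0 : Hper L r).fn 0 := Lp.coeFn_zero ℝ 2 _
  refine ⟨Hper.of χ hχr, μ, hμ, fun h0 => hχ0 ?_, fun h0 => hψ0 ?_, fun w => ?_, fun w => ?_,
    fun ν hν v hv hw => ?_, fun v hw => ?_⟩
  · have := (Hper.fn_of hχr).symm
    rw [h0] at this
    exact this.trans hzero
  · have := (Hper.fn_of (hφ.deriv.memH hL.out r)).symm
    rw [h0] at this
    exact this.trans hzero
  · exact hχ.weak hθ hf hφ hq hχr w
  · rw [hψ.weak hθ hf hφ hq _ w, zero_mul]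
  · have h1 := eigenEq_of_weak hm hsym hθ hf hφ hq v hw
    obtain ⟨-, c, hc⟩ := huniq ν hν v.fn h1 fun h0 => hv (Hper.ext_fn (h0.trans hzero.symm))
    refine ⟨c, Hper.ext_fn (hc.trans ?_)⟩
    refine AEEqPer.symm ((Hper.fn_smul c _).trans ?_)
    filter_upwards [Hper.fn_of hχr] with x hx
    rw [hx]
  · have h1 := eigenEq_of_weak (ν := 0) hm hsym hθ hf hφ hq v fun w => by rw [hw w, zero_mul]
    obtain ⟨c, hc⟩ := hker v.fn h1
    refine ⟨c, Hper.ext_fn (hc.trans ?_)⟩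
    refine AEEqPer.symm ((Hper.fn_smul c _).trans ?_)
    filter_upwards [Hper.fn_of (hφ.deriv.memH hL.out r)] with x hx
    rw [hx]

end Form

/-! ## The potential energy -/

/-- The primitive `W(y) = ∫₀ʸ f`. -/
noncomputable def prim (f : ℝ → ℝ) (y : ℝ) : ℝ := ∫ z in (0 : ℝ)..y, f z

/-- The potential energy `∫₀ᴸ W(u)`. -/
noncomputable def potN (L : ℝ) (f u : ℝ → ℝ) : ℝ := ∫ x in (0 : ℝ)..L, prim f (u x)

lemma hasDerivAt_prim {f : ℝ → ℝ} (hf : Continuous f) (y : ℝ) : HasDerivAt (prim f) (f y) y :=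
  intervalIntegral.integral_hasDerivAt_right (hf.intervalIntegrable _ _)
    hf.aestronglyMeasurable.stronglyMeasurableAtFilter hf.continuousAt

lemma continuous_prim {f : ℝ → ℝ} (hf : Continuous f) : Continuous (prim f) :=
  continuous_iff_continuousAt.2 fun y => (hasDerivAt_prim hf y).continuousAt

lemma contDiff_prim {f : ℝ → ℝ} (hf : ContDiff ℝ (⊤ : ℕ∞) f) : ContDiff ℝ (⊤ : ℕ∞) (prim f) := by
  rw [show ((⊤ : ℕ∞) : WithTop ℕ∞) = (⊤ : ℕ∞) + 1 from rfl, contDiff_succ_iff_deriv]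
  refine ⟨fun y => (hasDerivAt_prim hf.continuous y).differentiableAt, by simp, ?_⟩
  rwa [show deriv (prim f) = f from funext fun y => (hasDerivAt_prim hf.continuous y).deriv]

lemma potN_congr {L : ℝ} (hL : 0 < L) (f : ℝ → ℝ) {u v : ℝ → ℝ} (h : AEEqPer L u v) :
    potN L f u = potN L f v := integral_congr_per hL h fun _ y => prim f y

/-- The mean value inequality from the base point `0`; iterating it produces the Taylor remainders
below. -/
lemma abs_le_of_hasDerivAt {g g' : ℝ → ℝ} {b K : ℝ} (hg : ∀ y, HasDerivAt g (g' y) y) (h0 : g 0 = 0)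
    (hK : ∀ y, |y| ≤ |b| → |g' y| ≤ K) : |g b| ≤ K * |b| := by
  have h := (convex_closedBall (0 : ℝ) |b|).norm_image_sub_le_of_norm_hasDerivWithin_le
    (f := g) (f' := g') (C := K) (x := 0) (y := b) (fun y _ => (hg y).hasDerivWithinAt)
    (fun y hy => by simpa using hK y (by simpa using hy)) (by simp) (by simp)
  simpa [h0] using h

/-- Second order Taylor expansion of the primitive, uniformly for bounded base points. -/
lemma prim_taylor {f : ℝ → ℝ} (hf : ContDiff ℝ (⊤ : ℕ∞) f) (R : ℝ) : ∃ C, 0 ≤ C ∧ ∀ a b : ℝ,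
    |a| ≤ R → |b| ≤ 1 →
      |prim f (a + b) - prim f a - f a * b - 1 / 2 * (deriv f a * b ^ 2)| ≤ C * |b| ^ 3 := by
  have hf1 : ContDiff ℝ (⊤ : ℕ∞) (deriv f) := by
    rw [show ((⊤ : ℕ∞) : WithTop ℕ∞) = (⊤ : ℕ∞) + 1 from rfl, contDiff_succ_iff_deriv] at hf
    exact hf.2.2
  have hd1 : ∀ y, HasDerivAt (deriv f) (deriv (deriv f) y) y := fun y =>
    (hf1.differentiable (by simp) y).hasDerivAt
  have hd : ∀ y, HasDerivAt f (deriv f y) y := fun y => (hf.differentiable (by simp) y).hasDerivAt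
  obtain ⟨C, hC⟩ := isCompact_Icc.exists_bound_of_continuousOn (s := Icc (-(R + 1)) (R + 1))
    (hf1.continuous_deriv (by simp)).continuousOn
  refine ⟨|C|, abs_nonneg _, fun a b ha hb => ?_⟩
  have hadd : ∀ y : ℝ, HasDerivAt (fun z => a + z) 1 y := fun y => (hasDerivAt_id y).const_add a
  -- `C` bounds `f''` on `[-(R+1), R+1]`. Three successive mean value estimates, for `f'`, then `f`,
  -- then its primitive, each gain one factor `|y|`.
  have e1 : ∀ y, |y| ≤ 1 → |deriv f (a + y) - deriv f a| ≤ |C| * |y| := by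
    intro y hy
    refine abs_le_of_hasDerivAt (g := fun y => deriv f (a + y) - deriv f a)
      (g' := fun y => deriv (deriv f) (a + y)) (fun z => ?_) (by simp) fun z hz => ?_
    · simpa using ((hd1 (a + z)).comp z (hadd z)).sub_const (deriv f a)
    · have : |a + z| ≤ R + 1 := (abs_add_le _ _).trans (by linarith)
      exact (hC _ (abs_le.1 this)).trans (le_abs_self C)
  have e2 : ∀ y, |y| ≤ 1 → |f (a + y) - f a - deriv f a * y| ≤ |C| * |y| * |y| := by
    intro y hy
    refine abs_le_of_hasDerivAt (g := fun y => f (a + y) - f a - deriv f a * y)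
      (g' := fun y => deriv f (a + y) - deriv f a) (fun z => ?_) (by simp) fun z hz => ?_
    · exact ((((hd (a + z)).comp z (hadd z)).sub_const (f a)).sub
        ((hasDerivAt_id z).const_mul (deriv f a))).congr_deriv (by ring)
    · refine (e1 z (hz.trans hy)).trans ?_
      gcongr
  have e3 : |prim f (a + b) - prim f a - f a * b - 1 / 2 * (deriv f a * b ^ 2)|
      ≤ |C| * |b| * |b| * |b| := by
    refine abs_le_of_hasDerivAt
      (g := fun y => prim f (a + y) - prim f a - f a * y - 1 / 2 * (deriv f a * y ^ 2))
      (g' := fun y => f (a + y) - f a - deriv f a * y) (fun z => ?_) (by simp) fun z hz => ?_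
    · have := ((((hasDerivAt_prim hf.continuous (a + z)).comp z (hadd z)).sub_const (prim f a)).sub
        ((hasDerivAt_id z).const_mul (f a))).sub
        (((hasDerivAt_pow 2 z).const_mul (deriv f a)).const_mul (1 / 2))
      refine this.congr_deriv ?_
      push_cast; ring
    · refine (e2 z (hz.trans hb)).trans ?_
      gcongr
  calc _ ≤ |C| * |b| * |b| * |b| := e3
    _ = _ := by ring

lemma intervalIntegrable_comp_of_bound {L : ℝ} (hL : 0 < L) {g u : ℝ → ℝ} (hg : Continuous g)
    (hu : MemLp u 2 (volume.restrict (Ioc 0 L))) {R : ℝ}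
    (hR : ∀ᵐ x ∂(volume.restrict (Ioc 0 L)), |u x| ≤ R) :
    IntervalIntegrable (fun x => g (u x)) volume 0 L := by
  rw [intervalIntegrable_iff_integrableOn_Ioc_of_le hL.le]
  obtain ⟨D, hD⟩ := isCompact_Icc.exists_bound_of_continuousOn (s := Icc (-R) R) hg.continuousOn
  refine Integrable.of_bound (hg.comp_aestronglyMeasurable hu.1) D ?_
  filter_upwards [hR] with x hx
  exact hD _ (abs_le.1 hx)

/-- Taylor expansion of the potential energy at `φ` in the direction of a bounded function. -/
lemma potN_taylor {L : ℝ} (hL : 0 < L) {f φ : ℝ → ℝ} (hf : ContDiff ℝ (⊤ : ℕ∞) f)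
    (hφ : Continuous φ) : ∃ C, 0 ≤ C ∧ ∀ (v : ℝ → ℝ) (δ : ℝ), δ ≤ 1 →
      MemLp v 2 (volume.restrict (Ioc 0 L)) → (∀ᵐ x ∂(volume.restrict (Ioc 0 L)), |v x| ≤ δ) →
      |potN L f (fun x => φ x + v x) - potN L f φ - innerPer L (fun x => f (φ x)) v
        - 1 / 2 * innerPer L (fun x => deriv f (φ x) * v x) v|
      ≤ C * δ * ∫ x in (0 : ℝ)..L, v x ^ 2 := by
  have hf1 : Continuous (deriv f) := hf.continuous_deriv (by simp)
  obtain ⟨R, hR⟩ := isCompact_Icc.exists_bound_of_continuousOn (s := Icc 0 L) hφ.continuousOn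
  obtain ⟨C, hC, hT⟩ := prim_taylor hf R
  refine ⟨C, hC, fun v δ hδ hv hvb => ?_⟩
  have hφL := memLp_of_continuous (L := L) hφ
  have hφb : ∀ᵐ x ∂(volume.restrict (Ioc 0 L)), |φ x| ≤ R := by
    filter_upwards [ae_restrict_mem measurableSet_Ioc] with x hx
    exact hR x ⟨hx.1.le, hx.2⟩
  have i1 : IntervalIntegrable (fun x => prim f (φ x + v x)) volume 0 L :=
    intervalIntegrable_comp_of_bound hL (continuous_prim hf.continuous) (hφL.add hv) (R := R + 1) (by
      filter_upwards [hφb, hvb] with x h1 h2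
      exact (abs_add_le _ _).trans (by linarith))
  have i2 : IntervalIntegrable (fun x => prim f (φ x)) volume 0 L :=
    ((continuous_prim hf.continuous).comp hφ).intervalIntegrable _ _
  have i3 : IntervalIntegrable (fun x => f (φ x) * v x) volume 0 L :=
    intervalIntegrable_mul_of_memLp hL (memLp_of_continuous (hf.continuous.comp hφ)) hv
  have i4 : IntervalIntegrable (fun x => deriv f (φ x) * v x * v x) volume 0 L :=
    intervalIntegrable_mul_of_memLp hL (memLp_mul_continuous (hf1.comp hφ) hv) hv
  have i5 := intervalIntegrable_mul_of_memLp hL hv hv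
  simp only [← sq] at i5
  have e : potN L f (fun x => φ x + v x) - potN L f φ - innerPer L (fun x => f (φ x)) v
        - 1 / 2 * innerPer L (fun x => deriv f (φ x) * v x) v
      = ∫ x in (0 : ℝ)..L, (prim f (φ x + v x) - prim f (φ x) - f (φ x) * v x
        - 1 / 2 * (deriv f (φ x) * v x * v x)) := by
    rw [intervalIntegral.integral_sub ((i1.sub i2).sub i3) (i4.const_mul _),
      intervalIntegral.integral_sub (i1.sub i2) i3, intervalIntegral.integral_sub i1 i2,
      intervalIntegral.integral_const_mul]
    rfl
  rw [e, ← intervalIntegral.integral_const_mul, ← Real.norm_eq_abs]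
  refine intervalIntegral.norm_integral_le_of_norm_le hL.le ?_ (i5.const_mul _)
  rw [← ae_restrict_iff' measurableSet_Ioc]
  filter_upwards [hφb, hvb] with x h1 h2
  rw [Real.norm_eq_abs, mul_assoc (deriv f (φ x)), ← sq]
  refine (hT _ _ h1 (h2.trans hδ)).trans ?_
  calc C * |v x| ^ 3 = C * |v x| * v x ^ 2 := by rw [← sq_abs (v x)]; ring
    _ ≤ C * δ * v x ^ 2 := by gcongr

section

variable {L : ℝ} [hL : Fact (0 < L)] {r : ℝ}

/-- Continuity of the potential energy on `H^r_per`, and its second order Taylor expansion at `φ`. -/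
structure PotentialRegular (f : ℝ → ℝ) {φ : ℝ → ℝ} (hφ : SmoothPer L φ) (r : ℝ)
    (hfφ : SmoothPer L fun x => f (φ x)) (hq : Continuous fun x => deriv f (φ x)) : Prop where
  continuous : Continuous fun u : Hper L r => potN L f u.fn
  taylor : ∀ η > 0, ∃ δ > 0, ∀ v : Hper L r, ‖v‖ < δ →
    |potN L f (Hper.of φ (hφ.memH hL.out r) + v).fn - potN L f φ
      - l2Form (Hper.of (fun x => f (φ x)) (hfφ.memH hL.out r)) v
      - 1 / 2 * potForm (fun x => deriv f (φ x)) hq v v| ≤ η * ‖v‖ ^ 2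

lemma Hper.fn_of_add {φ : ℝ → ℝ} (hφ : MemH L r φ) (v : Hper L r) :
    AEEqPer L (Hper.of φ hφ + v).fn fun x => φ x + v.fn x := by
  filter_upwards [Hper.fn_add (Hper.of φ hφ) v, Hper.fn_of hφ] with x h1 h2
  rw [h1, h2]

lemma l2Form_of_left {g : ℝ → ℝ} (hg : MemH L r g) (v : Hper L r) :
    l2Form (Hper.of g hg) v = innerPer L g v.fn := by
  rw [l2Form_apply]
  exact innerPer_congr hL.out (Hper.fn_of hg) (EventuallyEq.refl _ _)

/-! ### The embedding in `L^∞` and the potential energy for `r > 1/2`. -/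

lemma summable_weight_neg (hr : 1 / 2 < r) : Summable fun k : ℤ => ((1 + (k : ℝ) ^ 2) ^ r)⁻¹ := by
  have h : Summable fun k : ℤ => |(k : ℝ)| ^ (-(2 * r)) := Real.summable_abs_int_rpow (by linarith)
  have h0 : Summable fun k : ℤ => if k = 0 then (1 : ℝ) else 0 :=
    summable_of_ne_finset_zero (s := {0}) fun k hk => by simp at hk; simp [hk]
  refine Summable.of_nonneg_of_le (fun k => by positivity) (fun k => ?_) (h.add h0)
  by_cases hk : k = 0
  · subst hk
    have : (0 : ℝ) ≤ |((0 : ℤ) : ℝ)| ^ (-(2 * r)) := by positivity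
    simpa using this
  · have hk' : 0 < |(k : ℝ)| := abs_pos.2 (by exact_mod_cast hk)
    simp only [hk, if_false, add_zero]
    rw [Real.rpow_neg hk'.le]
    refine inv_anti₀ (by positivity) ?_
    have := abs_rpow_le_weight (m := 2 * r) (by linarith) (k : ℝ)
    rwa [mul_div_cancel_left₀ _ two_ne_zero] at this

/-- The embedding `H^r_per ⊂ L^∞`, `r > 1/2`. -/
theorem Hper.exists_sup_bound (hr : 1 / 2 < r) : ∃ S > 0, ∀ u : Hper L r,
    ∀ᵐ x ∂(volume.restrict (Ioc 0 L)), |u.fn x| ≤ S * ‖u‖ := by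
  have hL' := hL.out
  set Z := ∑' k : ℤ, ((1 + (k : ℝ) ^ 2) ^ r)⁻¹ with hZ
  have hZ0 : 0 ≤ Z := tsum_nonneg fun k => by positivity
  refine ⟨1 / 2 * (Z + L⁻¹), by positivity, fun u => ?_⟩
  have hcs : Summable (fun k => ‖coeff L u.fn k‖) ∧
      ∑' k, ‖coeff L u.fn k‖ ≤ 1 / 2 * (Z + L⁻¹) * ‖u‖ := by
    by_cases h0 : u = 0
    · subst h0
      simp [Hper.coeff_fn_zero]
    have hu := norm_pos_iff.2 h0
    have hs := (((summable_weight_neg hr).hasSum.mul_left ‖u‖).add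
      (u.hasSum_norm_sq.mul_left (L⁻¹ * ‖u‖⁻¹))).mul_left (1 / 2)
    -- The arithmetic–geometric inequality, with weights scaled by `‖u‖`, replaces Cauchy–Schwarz
    -- and proves summability at the same time.
    have hle : ∀ k : ℤ, ‖coeff L u.fn k‖ ≤ 1 / 2 * (‖u‖ * ((1 + (k : ℝ) ^ 2) ^ r)⁻¹
        + L⁻¹ * ‖u‖⁻¹ * (L * ((1 + (k : ℝ) ^ 2) ^ r * ‖coeff L u.fn k‖ ^ 2))) := by
      intro k
      set a := ‖coeff L u.fn k‖
      have hw : 0 < (1 + (k : ℝ) ^ 2) ^ r := by positivity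
      set w := (1 + (k : ℝ) ^ 2) ^ r
      have : 0 ≤ (‖u‖ - w * a) ^ 2 / (‖u‖ * w) := by positivity
      have e : (‖u‖ - w * a) ^ 2 / (‖u‖ * w)
          = ‖u‖ * w⁻¹ + L⁻¹ * ‖u‖⁻¹ * (L * (w * a ^ 2)) - 2 * a := by
        field_simp; ring
      rw [e] at this
      linarith
    have hsum := Summable.of_nonneg_of_le (fun k => norm_nonneg _) hle hs.summable
    refine ⟨hsum, (hasSum_le hle hsum.hasSum hs).trans (le_of_eq ?_)⟩
    rw [← hZ]
    field_simp
  have hcont := continuous_synth hcs.1 L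
  have hae : AEEqPer L (fun x => u.fn x - synth L (coeff L u.fn) x) 0 :=
    ae_zero_of_coeff hL' (u.memLp.sub (memLp_of_continuous hcont)) fun k => by
      have := coeff_sub hL' u.memLp (memLp_of_continuous hcont) k
      rw [coeff_synth hL' (isHerm_coeff L _) hcs.1, sub_self] at this
      exact this
  filter_upwards [hae] with x hx
  have : u.fn x = synth L (coeff L u.fn) x := sub_eq_zero.1 hx
  rw [this]
  exact (abs_synth_le hcs.1 L x).trans hcs.2

/-- Bounded sets of `H^r_per` are bounded in `L^∞`, so only the values of `f` on a compact interval
matter, whatever its growth. The pointwise Taylor expansion can then be integrated. -/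
theorem potentialRegular_of_half_lt {f φ : ℝ → ℝ} (hf : ContDiff ℝ (⊤ : ℕ∞) f) (hφ : SmoothPer L φ)
    (hr : 1 / 2 < r) (hfφ : SmoothPer L fun x => f (φ x)) (hq : Continuous fun x => deriv f (φ x)) :
    PotentialRegular f hφ r hfφ hq := by
  have hL' := hL.out
  obtain ⟨S, hS, hsup⟩ := Hper.exists_sup_bound (L := L) hr
  refine ⟨?_, fun η hη => ?_⟩
  · rw [continuous_iff_continuousAt]
    intro u
    set R := S * (‖u‖ + 1) with hR
    obtain ⟨D, hD⟩ := isCompact_Icc.exists_bound_of_continuousOn (s := Icc (-R) R)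
      hf.continuous.continuousOn
    have hlip : ∀ a b, |a| ≤ R → |b| ≤ R → |prim f a - prim f b| ≤ D * |a - b| := by
      intro a b ha hb
      have := (convex_Icc (-R) R).norm_image_sub_le_of_norm_hasDerivWithin_le
        (f := prim f) (f' := f) (C := D) (x := b) (y := a)
        (fun y _ => (hasDerivAt_prim hf.continuous y).hasDerivWithinAt) hD
        (abs_le.1 hb) (abs_le.1 ha)
      simpa using this
    have hD0 : 0 ≤ D := (norm_nonneg _).trans (hD 0 ⟨by rw [neg_nonpos]; positivity, by positivity⟩)
    rw [Metric.continuousAt_iff]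
    intro ε hε
    refine ⟨min 1 (ε / (D * S * L + 1)), by positivity, fun {v} hv => ?_⟩
    rw [dist_eq_norm] at hv ⊢
    have hv1 : ‖v‖ ≤ ‖u‖ + 1 := by
      have := norm_sub_norm_le v u
      linarith [hv.le.trans (min_le_left _ _)]
    have bu : ∀ᵐ x ∂(volume.restrict (Ioc 0 L)), |u.fn x| ≤ R := by
      filter_upwards [hsup u] with x hx
      exact hx.trans (by rw [hR]; gcongr; linarith)
    have bv : ∀ᵐ x ∂(volume.restrict (Ioc 0 L)), |v.fn x| ≤ R := by
      filter_upwards [hsup v] with x hx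
      exact hx.trans (by rw [hR]; gcongr)
    rw [potN, potN, ← intervalIntegral.integral_sub
      (intervalIntegrable_comp_of_bound hL' (continuous_prim hf.continuous) v.memLp bv)
      (intervalIntegrable_comp_of_bound hL' (continuous_prim hf.continuous) u.memLp bu)]
    have h1 : ‖∫ x in (0 : ℝ)..L, (prim f (v.fn x) - prim f (u.fn x))‖
        ≤ ∫ _x in (0 : ℝ)..L, D * (S * ‖v - u‖) := by
      refine intervalIntegral.norm_integral_le_of_norm_le hL'.le ?_ (by simp)
      rw [← ae_restrict_iff' measurableSet_Ioc]
      filter_upwards [bu, bv, hsup (v - u), Hper.fn_sub v u] with x h1 h2 h3 h4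
      rw [h4] at h3
      exact (hlip _ _ h2 h1).trans (by gcongr)
    rw [intervalIntegral.integral_const, sub_zero, smul_eq_mul] at h1
    refine lt_of_le_of_lt h1 ?_
    have h2 := hv.trans_le (min_le_right _ _)
    rw [lt_div_iff₀ (by positivity)] at h2
    have : 0 ≤ ‖v - u‖ := norm_nonneg _
    nlinarith
  · obtain ⟨C, hC, hT⟩ := potN_taylor hL' hf hφ.continuous
    refine ⟨min (1 / S) (η / (C * S + 1)), by positivity, fun v hv => ?_⟩
    have h1 : S * ‖v‖ ≤ 1 := by
      have := hv.le.trans (min_le_left _ _)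
      rw [le_div_iff₀ hS] at this
      linarith
    have h2 := hT v.fn (S * ‖v‖) h1 v.memLp (hsup v)
    rw [potN_congr hL' f (Hper.fn_of_add _ v), l2Form_of_left, potForm_apply]
    refine h2.trans ?_
    have h3 := v.integral_sq_le (by linarith : 0 ≤ r)
    have h4 := hv.le.trans (min_le_right _ _)
    rw [le_div_iff₀ (by positivity)] at h4
    have h5 : 0 ≤ ‖v‖ := norm_nonneg v
    have : C * (S * ‖v‖) ≤ η := by nlinarith
    exact mul_le_mul this h3 (intervalIntegral.integral_nonneg hL'.le fun x _ => sq_nonneg _)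
      hη.le

/-! ### The potential energy under the `C²` hypothesis. -/

lemma taylor_of_contDiff_two {E : Type*} [NormedAddCommGroup E] [NormedSpace ℝ E] {N : E → ℝ}
    (hN : ContDiff ℝ 2 N) (P : E) : ∀ η > 0, ∃ δ > 0, ∀ v, ‖v‖ < δ →
      |N (P + v) - N P - fderiv ℝ N P v - 1 / 2 * fderiv ℝ (fderiv ℝ N) P v v| ≤ η * ‖v‖ ^ 2 := by
  intro η hη
  have hd : ContDiff ℝ 1 (fderiv ℝ N) := hN.fderiv_right (by norm_num)
  have h2 := (hd.differentiable (by simp) P).hasFDerivAt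
  rw [hasFDerivAt_iff_isLittleO_nhds_zero] at h2
  have h3 := h2.def hη
  obtain ⟨δ, hδ, hb⟩ := Metric.eventually_nhds_iff.1 h3
  refine ⟨δ, hδ, fun v hv => ?_⟩
  set D1 := fderiv ℝ N P
  set D2 := fderiv ℝ (fderiv ℝ N) P
  have hg : ∀ t : ℝ, HasDerivAt (fun t : ℝ => N (P + t • v) - N P - t * D1 v
      - 1 / 2 * (t ^ 2 * D2 v v)) (fderiv ℝ N (P + t • v) v - D1 v - t * D2 v v) t := by
    intro t
    have hline : HasDerivAt (fun t : ℝ => P + t • v) v t := by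
      simpa using ((hasDerivAt_id t).smul_const v).const_add P
    have h5 := ((hN.differentiable (by simp) (P + t • v)).hasFDerivAt.comp_hasDerivAt t hline)
    have h6 := ((h5.sub_const (N P)).sub ((hasDerivAt_id t).mul_const (D1 v))).sub
      (((hasDerivAt_pow 2 t).mul_const (D2 v v)).const_mul (1 / 2))
    refine h6.congr_deriv ?_
    push_cast; ring
  have h7 := abs_le_of_hasDerivAt (b := 1) (K := η * ‖v‖ ^ 2) hg (by simp) fun t ht => by
    rw [abs_one] at ht
    have htv : ‖t • v‖ ≤ ‖v‖ := by
      rw [norm_smul, Real.norm_eq_abs]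
      exact mul_le_of_le_one_left (norm_nonneg v) ht
    have h8 := hb (y := t • v) (by rw [dist_zero_right]; exact htv.trans_lt hv)
    have e : fderiv ℝ N (P + t • v) v - D1 v - t * D2 v v
        = (fderiv ℝ N (P + t • v) - D1 - D2 (t • v)) v := by
      simp
    rw [e, ← Real.norm_eq_abs]
    calc _ ≤ ‖fderiv ℝ N (P + t • v) - D1 - D2 (t • v)‖ * ‖v‖ := ContinuousLinearMap.le_opNorm _ _
      _ ≤ (η * ‖t • v‖) * ‖v‖ := by gcongr
      _ ≤ (η * ‖v‖) * ‖v‖ := by gcongr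
      _ = _ := by ring
  simpa using h7

/-- Uniqueness of second order expansions in one variable. It identifies the abstract derivatives of
the potential energy with the explicit integrals. -/
lemma eq_zero_of_quadratic_small {a b : ℝ}
    (h : ∀ η > 0, ∃ δ > 0, ∀ t, 0 < t → t < δ → |t * a + t ^ 2 * b| ≤ η * t ^ 2) :
    a = 0 ∧ b = 0 := by
  have ha : a = 0 := by
    obtain ⟨δ, hδ, h1⟩ := h 1 one_pos
    by_contra hne
    have hpos := abs_pos.2 hne
    set t := min (δ / 2) (|a| / (2 * (|b| + 1))) with ht
    have ht0 : 0 < t := by positivity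
    have h2 := h1 t ht0 ((min_le_left _ _).trans_lt (half_lt_self hδ))
    have h3 : t ≤ |a| / (2 * (|b| + 1)) := min_le_right _ _
    rw [le_div_iff₀ (by positivity)] at h3
    have h4 : t * |a| ≤ t * (t * (|b| + 1)) := by
      calc t * |a| = |(t * a + t ^ 2 * b) - t ^ 2 * b| := by
            rw [add_sub_cancel_right, abs_mul, abs_of_pos ht0]
        _ ≤ |t * a + t ^ 2 * b| + |t ^ 2 * b| := abs_sub _ _
        _ ≤ 1 * t ^ 2 + t ^ 2 * |b| := by
          rw [abs_mul, abs_of_nonneg (sq_nonneg t)]; gcongr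
        _ = _ := by ring
    have h5 := le_of_mul_le_mul_left h4 ht0
    nlinarith
  refine ⟨ha, ?_⟩
  subst ha
  by_contra hne
  have hpos := abs_pos.2 hne
  obtain ⟨δ, hδ, h1⟩ := h (|b| / 2) (by positivity)
  have h2 := h1 (δ / 2) (by positivity) (half_lt_self hδ)
  rw [mul_zero, zero_add, abs_mul, abs_of_nonneg (sq_nonneg _), mul_comm] at h2
  have h3 := le_of_mul_le_mul_right h2 (by positivity)
  linarith

/-- Being `C²` gives an expansion with unknown derivatives at `φ`. Along a line in a smooth, hence
bounded, direction, the pointwise expansion also applies, and comparing the two identifies the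
derivatives. Density of smooth functions extends this to all directions. -/
theorem potentialRegular_of_c2 {f φ : ℝ → ℝ} (hf : ContDiff ℝ (⊤ : ℕ∞) f) (hφ : SmoothPer L φ)
    (hr : 0 ≤ r) (h : PotentialC2 L f r) (hfφ : SmoothPer L fun x => f (φ x))
    (hq : Continuous fun x => deriv f (φ x)) : PotentialRegular f hφ r hfφ hq := by
  have hL' := hL.out
  set N : Hper L r → ℝ := fun u => potN L f u.fn with hN
  have hC2 : ContDiff ℝ 2 N := h.2
  refine ⟨hC2.continuous, ?_⟩
  set P := Hper.of φ (hφ.memH hL' r) with hP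
  set D1 := fderiv ℝ N P
  set D2 := fderiv ℝ (fderiv ℝ N) P
  have hNP : N P = potN L f φ := potN_congr hL' f (Hper.fn_of _)
  have hTay := taylor_of_contDiff_two hC2 P
  obtain ⟨C, hC, hT⟩ := potN_taylor hL' hf hφ.continuous
  have hsm : ∀ g, ∀ hg : SmoothPer L g,
      D1 (Hper.of g (hg.memH hL' r))
        = l2Form (Hper.of (fun x => f (φ x)) (hfφ.memH hL' r)) (Hper.of g (hg.memH hL' r)) ∧
      D2 (Hper.of g (hg.memH hL' r)) (Hper.of g (hg.memH hL' r))
        = potForm (fun x => deriv f (φ x)) hq (Hper.of g (hg.memH hL' r))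
          (Hper.of g (hg.memH hL' r)) := by
    intro g hg
    set v := Hper.of g (hg.memH hL' r) with hv
    obtain ⟨R, hR⟩ := isCompact_Icc.exists_bound_of_continuousOn (s := Icc 0 L)
      hg.continuous.continuousOn
    have hvb : ∀ᵐ x ∂(volume.restrict (Ioc 0 L)), |v.fn x| ≤ |R| + 1 := by
      filter_upwards [ae_restrict_mem measurableSet_Ioc, Hper.fn_of (hg.memH hL' r)] with x hx h1
      rw [h1]
      exact (hR x ⟨hx.1.le, hx.2⟩).trans (by linarith [le_abs_self R])
    have key := eq_zero_of_quadratic_small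
      (a := D1 v - l2Form (Hper.of (fun x => f (φ x)) (hfφ.memH hL' r)) v)
      (b := 1 / 2 * (D2 v v - potForm (fun x => deriv f (φ x)) hq v v)) ?_
    · exact ⟨by linarith [key.1], by linarith [key.2]⟩
    intro η hη
    obtain ⟨δ₁, hδ₁, h1⟩ := hTay (η / (2 * (‖v‖ ^ 2 + 1))) (by positivity)
    set I := ∫ x in (0 : ℝ)..L, v.fn x ^ 2 with hI
    have hI0 : 0 ≤ I := intervalIntegral.integral_nonneg hL'.le fun x _ => sq_nonneg _
    -- The three bounds on `t` keep `t v` in the abstract Taylor ball, keep `|t v| ≤ 1` for the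
    -- pointwise expansion, and make its cubic error at most `η t² / 2`.
    refine ⟨min (δ₁ / (‖v‖ + 1)) (min (1 / (|R| + 1)) (η / (2 * (C * (|R| + 1) * I + 1)))),
      by positivity, fun t ht0 ht => ?_⟩
    have ht1 := ht.trans_le (min_le_left _ _)
    have ht2 := ht.trans_le ((min_le_right _ _).trans (min_le_left _ _))
    have ht3 := ht.trans_le ((min_le_right _ _).trans (min_le_right _ _))
    rw [lt_div_iff₀ (by positivity)] at ht1 ht2 ht3
    have a1 := h1 (t • v) (by
      rw [norm_smul, Real.norm_eq_abs, abs_of_pos ht0]; nlinarith [norm_nonneg v])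
    have a2 := hT (t • v).fn (t * (|R| + 1)) ht2.le (t • v).memLp (by
      filter_upwards [hvb, Hper.fn_smul t v] with x hx h2
      rw [h2, abs_mul, abs_of_pos ht0]; gcongr)
    rw [← potN_congr hL' f (Hper.fn_of_add (hφ.memH hL' r) (t • v)), ← l2Form_of_left
      (hfφ.memH hL' r), ← potForm_apply hq, ← innerPer_self, ← l2Form_apply] at a2
    simp only [map_smul, LinearMap.smul_apply, smul_eq_mul, smul_apply,
      norm_smul, Real.norm_eq_abs, abs_of_pos ht0] at a1 a2
    rw [l2Form_apply v v, innerPer_self, ← hI] at a2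
    rw [hNP] at a1
    have b1 : η / (2 * (‖v‖ ^ 2 + 1)) * (t * ‖v‖) ^ 2 ≤ η / 2 * t ^ 2 := by
      rw [div_mul_eq_mul_div, div_le_iff₀ (by positivity)]
      have : 0 ≤ η * t ^ 2 := by positivity
      nlinarith
    have b2 : C * (t * (|R| + 1)) * (t * (t * I)) ≤ η / 2 * t ^ 2 := by
      have : 0 ≤ t ^ 2 := by positivity
      nlinarith
    have e : t * (D1 v - l2Form (Hper.of (fun x => f (φ x)) (hfφ.memH hL' r)) v)
        + t ^ 2 * (1 / 2 * (D2 v v - potForm (fun x => deriv f (φ x)) hq v v))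
        = (N (P + t • v) - potN L f φ - t * l2Form (Hper.of (fun x => f (φ x)) (hfφ.memH hL' r)) v
          - 1 / 2 * (t * (t * potForm (fun x => deriv f (φ x)) hq v v)))
          - (N (P + t • v) - potN L f φ - t * D1 v - 1 / 2 * (t * (t * D2 v v))) := by ring
    rw [e]
    refine (abs_sub _ _).trans ?_
    have c1 := a1.trans b1
    have c2 := a2.trans b2
    linarith
  have hall : ∀ v : Hper L r,
      D1 v = l2Form (Hper.of (fun x => f (φ x)) (hfφ.memH hL' r)) v ∧
      D2 v v = potForm (fun x => deriv f (φ x)) hq v v := by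
    intro v
    have hseq : ∀ n : ℕ, ∃ g, ∃ hg : SmoothPer L g,
        ‖v - Hper.of g (hg.memH hL' r)‖ < 1 / (n + 1 : ℝ) :=
      fun n => v.exists_smooth_near (by positivity)
    choose g hg hgn using hseq
    have ht : Tendsto (fun n => Hper.of (g n) ((hg n).memH hL' r)) atTop (𝓝 v) := by
      rw [tendsto_iff_norm_sub_tendsto_zero]
      refine squeeze_zero (fun n => norm_nonneg _) (fun n => ?_)
        (tendsto_one_div_add_atTop_nhds_zero_nat (𝕜 := ℝ))
      rw [norm_sub_rev]
      exact (hgn n).le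
    constructor
    · refine tendsto_nhds_unique ((D1.continuous.tendsto v).comp ht) ?_
      refine (tendsto_form (potForm_bounded hr _) tendsto_const_nhds ht).congr fun n => ?_
      exact ((hsm _ (hg n)).1).symm
    · have hc : Continuous fun w => D2 w w := by fun_prop
      refine tendsto_nhds_unique ((hc.tendsto v).comp ht) ?_
      refine (tendsto_form (potForm_bounded hr _) ht ht).congr fun n => ?_
      exact ((hsm _ (hg n)).2).symm
  intro η hη
  obtain ⟨δ, hδ, h1⟩ := hTay η hη
  refine ⟨δ, hδ, fun v hv => ?_⟩
  have := h1 v hv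
  rwa [hNP, (hall v).1, (hall v).2] at this

end

/-! ## Translations -/

/-- The `L`-periodic function which agrees with `u` on `(0, L]`. -/
noncomputable def perExt {L : ℝ} (hL : 0 < L) (u : ℝ → ℝ) (x : ℝ) : ℝ := u (toIocMod hL 0 x)

lemma perExt_periodic {L : ℝ} (hL : 0 < L) (u : ℝ → ℝ) : Function.Periodic (perExt hL u) L :=
  fun x => by simp only [perExt, toIocMod_add_right]

lemma perExt_eq {L : ℝ} (hL : 0 < L) (u : ℝ → ℝ) {x : ℝ} (hx : x ∈ Ioc 0 L) :
    perExt hL u x = u x := by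
  rw [perExt, (toIocMod_eq_self hL).2 (by simpa using hx)]

lemma perExt_ae {L : ℝ} (hL : 0 < L) (u : ℝ → ℝ) : AEEqPer L (perExt hL u) u := by
  filter_upwards [ae_restrict_mem measurableSet_Ioc] with x hx
  exact perExt_eq hL u hx

lemma measurable_perExt {L : ℝ} (hL : 0 < L) {u : ℝ → ℝ} (hu : Measurable u) :
    Measurable (perExt hL u) := by
  have e : toIocMod hL (0 : ℝ) = fun x => 0 + L - Int.fract ((0 + L - x) / L) * L :=
    funext fun x => toIocMod_eq_sub_fract_mul hL 0 x
  refine hu.comp ?_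
  rw [e]
  exact measurable_const.sub
    ((measurable_fract.comp ((measurable_const.sub measurable_id).div_const L)).mul_const L)

section

variable {L : ℝ} [hL : Fact (0 < L)] {r : ℝ}

lemma norm_fchar_mul (L : ℝ) (k : ℤ) (y : ℝ) (z : ℂ) : ‖fchar L k y * z‖ = ‖z‖ := by
  rw [norm_mul, norm_fchar, one_mul]

/-- The translate of an element of `H^r_per`. -/
theorem Hper.exists_translate (f : ℝ → ℝ) (u : Hper L r) (y : ℝ) :
    ∃ w : Hper L r, (∀ k, coeff L w.fn k = fchar L k y * coeff L u.fn k) ∧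
      potN L f w.fn = potN L f u.fn := by
  have hL' := hL.out
  -- The representative is meaningful only on `(0, L]`, so the translation acts on its periodic
  -- extension, which is measurable because this representative is.
  have hmeas : Measurable u.fn := (Lp.stronglyMeasurable u.1).measurable
  set v := perExt hL' u.fn with hv
  have hvm : Measurable v := measurable_perExt hL' hmeas
  have hper : Function.Periodic v L := perExt_periodic hL' _
  have hae : AEEqPer L v u.fn := perExt_ae hL' _
  have hvL : MemLp v 2 (volume.restrict (Ioc 0 L)) := (memLp_congr_ae hae).2 u.memLp
  have hint : IntervalIntegrable (fun x => v x ^ 2) volume 0 L :=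
    (intervalIntegrable_iff_integrableOn_Ioc_of_le hL'.le).2 hvL.integrable_sq
  have hper2 : Function.Periodic (fun x => v x ^ 2) L := fun x => by simp only [hper x]
  have hint2 : IntervalIntegrable (fun x => v (x + y) ^ 2) volume 0 L := by
    have h1 : IntervalIntegrable (fun x => v x ^ 2) volume (0 + y) (L + y) :=
      hper2.intervalIntegrable₀ hL'.ne' hint _ _
    have := h1.comp_add_right y
    simpa using this
  have hwL : MemLp (fun x => v (x + y)) 2 (volume.restrict (Ioc 0 L)) := by
    refine (memLp_two_iff_integrable_sq
      (hvm.comp (measurable_add_const y)).aestronglyMeasurable).2 ?_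
    exact (intervalIntegrable_iff_integrableOn_Ioc_of_le hL'.le).1 hint2
  have hcoef : ∀ k, coeff L (fun x => v (x + y)) k = fchar L k y * coeff L u.fn k := fun k => by
    rw [coeff_translate hper y k hL', coeff_congr hL' hae]
  have hH : MemH L r (fun x => v (x + y)) :=
    ⟨hwL, u.memH.2.congr fun k => by rw [hcoef, norm_fchar_mul]⟩
  refine ⟨Hper.of _ hH, fun k => by rw [Hper.coeff_of, hcoef], ?_⟩
  rw [potN_congr hL' f (Hper.fn_of hH), ← potN_congr hL' f hae]
  have hp : Function.Periodic (fun x => prim f (v x)) L := fun x => by simp only [hper x]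
  unfold potN
  rw [intervalIntegral.integral_comp_add_right (fun x => prim f (v x)), zero_add, add_comm L y,
    hp.intervalIntegral_add_eq y 0, zero_add]

/-- The translate `φ(· + y)` in `H^r_per`. -/
noncomputable def trans {φ : ℝ → ℝ} (hφ : SmoothPer L φ) (r y : ℝ) : Hper L r :=
  Hper.of (fun x => φ (x + y)) ((hφ.translate y).memH hL.out r)

lemma coeff_trans {φ : ℝ → ℝ} (hφ : SmoothPer L φ) (y : ℝ) (k : ℤ) :
    coeff L (trans hφ r y).fn k = fchar L k y * coeff L φ k := by
  rw [trans, Hper.coeff_of, coeff_translate hφ.2 y k hL.out]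

/-! ### Regularity of the orbit map `y ↦ φ(· + y)`. -/

lemma fchar_arg_norm (L : ℝ) (k : ℤ) (y : ℝ) :
    ‖2 * Real.pi * Complex.I * k * y / L‖ = |2 * Real.pi * k * y / L| := by
  have : (2 * Real.pi * Complex.I * k * y / L : ℂ) = ((2 * Real.pi * k * y / L : ℝ) : ℂ) * Complex.I := by
    push_cast; ring
  rw [this, norm_mul, Complex.norm_I, mul_one, Complex.norm_real, Real.norm_eq_abs]

lemma norm_fchar_sub_one_le (L : ℝ) (k : ℤ) (y : ℝ) :
    ‖fchar L k y - 1‖ ≤ ‖2 * Real.pi * Complex.I * k * y / L‖ := by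
  rw [fchar_arg_norm, fchar_eq, mul_comm]
  exact Real.norm_exp_I_mul_ofReal_sub_one_le

/-- For arguments of modulus at most `1` this is the Taylor estimate of the exponential; for larger
ones the linear bound is already dominated by the square. No restriction on `k y` remains, so the
estimate can be summed over all frequencies. -/
lemma norm_fchar_sub_one_sub_le (L : ℝ) (k : ℤ) (y : ℝ) :
    ‖fchar L k y - 1 - 2 * Real.pi * Complex.I * k * y / L‖
      ≤ 2 * ‖2 * Real.pi * Complex.I * k * y / L‖ ^ 2 := by
  rcases le_or_gt ‖2 * Real.pi * Complex.I * k * y / L‖ 1 with h | h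
  · have := Complex.norm_exp_sub_one_sub_id_le h
    rw [fchar]
    nlinarith [sq_nonneg ‖2 * Real.pi * Complex.I * k * y / L‖]
  · have h1 := norm_fchar_sub_one_le L k y
    have h2 := norm_sub_le (fchar L k y - 1) (2 * Real.pi * Complex.I * k * y / L)
    nlinarith

lemma norm_trans_sub_le {φ : ℝ → ℝ} (hφ : SmoothPer L φ) (y z : ℝ) :
    ‖trans hφ r y - trans hφ r z‖ ≤ |y - z| * ‖Hper.of (deriv φ) (hφ.deriv.memH hL.out r)‖ := by
  rw [← Real.norm_eq_abs, ← norm_smul]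
  refine Hper.norm_le_of_coeff fun k => ?_
  rw [Hper.coeff_fn_sub, coeff_trans, coeff_trans, Hper.coeff_fn_smul, Hper.coeff_of,
    hφ.coeff_deriv hL.out]
  have e : fchar L k y * coeff L φ k - fchar L k z * coeff L φ k
      = fchar L k z * ((fchar L k (y - z) - 1) * coeff L φ k) := by
    have : fchar L k y = fchar L k z * fchar L k (y - z) := by rw [← fchar_add_right]; congr 1; ring
    rw [this]; ring
  rw [e, norm_fchar_mul, norm_mul, ← mul_assoc, norm_mul _ (coeff L φ k)]
  gcongr
  refine (norm_fchar_sub_one_le L k (y - z)).trans (le_of_eq ?_)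
  congr 1; ring

/-- The orbit has tangent `φ'` at `φ` with quadratic error; on coefficients the error is controlled
by those of `φ''`. -/
lemma norm_trans_sub_sub_le {φ : ℝ → ℝ} (hφ : SmoothPer L φ) (r : ℝ) : ∃ C, 0 ≤ C ∧ ∀ h : ℝ,
    ‖trans hφ r h - Hper.of φ (hφ.memH hL.out r)
      - h • Hper.of (deriv φ) (hφ.deriv.memH hL.out r)‖ ≤ C * h ^ 2 := by
  refine ⟨2 * ‖Hper.of (deriv (deriv φ)) (hφ.deriv.deriv.memH hL.out r)‖, by positivity, fun h => ?_⟩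
  have e0 : 2 * ‖Hper.of (deriv (deriv φ)) (hφ.deriv.deriv.memH hL.out r)‖ * h ^ 2
      = ‖(2 * h ^ 2) • Hper.of (deriv (deriv φ)) (hφ.deriv.deriv.memH hL.out r)‖ := by
    rw [norm_smul, Real.norm_eq_abs, abs_of_nonneg (by positivity)]; ring
  rw [e0]
  refine Hper.norm_le_of_coeff fun k => ?_
  rw [Hper.coeff_fn_sub, Hper.coeff_fn_sub, coeff_trans, Hper.coeff_fn_smul, Hper.coeff_fn_smul,
    Hper.coeff_of, Hper.coeff_of, Hper.coeff_of, hφ.deriv.coeff_deriv hL.out,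
    hφ.coeff_deriv hL.out]
  have e1 : fchar L k h * coeff L φ k - coeff L φ k
      - h * (2 * Real.pi * Complex.I * k / L * coeff L φ k)
      = (fchar L k h - 1 - 2 * Real.pi * Complex.I * k * h / L) * coeff L φ k := by ring
  have e2 : ((2 * h ^ 2 : ℝ) : ℂ) * (2 * Real.pi * Complex.I * k / L
      * (2 * Real.pi * Complex.I * k / L * coeff L φ k))
      = 2 * (2 * Real.pi * Complex.I * k * h / L) ^ 2 * coeff L φ k := by push_cast; ring
  rw [e1, e2, norm_mul, norm_mul _ (coeff L φ k), norm_mul 2, norm_pow]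
  gcongr
  simpa using norm_fchar_sub_one_sub_le L k h

lemma continuous_trans {φ : ℝ → ℝ} (hφ : SmoothPer L φ) (r : ℝ) : Continuous (trans hφ r) := by
  refine LipschitzWith.continuous
    (K := ‖Hper.of (deriv φ) (hφ.deriv.memH hL.out r)‖₊) (LipschitzWith.of_dist_le_mul fun y z => ?_)
  rw [dist_eq_norm, Real.dist_eq, coe_nnnorm, mul_comm]
  exact norm_trans_sub_le hφ y z

lemma trans_periodic {φ : ℝ → ℝ} (hφ : SmoothPer L φ) (r : ℝ) : Function.Periodic (trans hφ r) L :=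
  fun y => Hper.ext_coeff fun k => by
    rw [coeff_trans, coeff_trans, fchar_periodic hL.out k y]

/-! ### The distance to the orbit and the closest translate. -/

lemma orbitDist_eq {φ u : ℝ → ℝ} (hφ : SmoothPer L φ) (hu : MemH L r u) :
    orbitDist L r u φ = ⨅ y, ‖Hper.of u hu - trans hφ r y‖ := by
  unfold orbitDist
  congr 1
  ext y
  rw [trans, Hper.of_sub, Hper.norm_of]

lemma orbitDist_le {φ u : ℝ → ℝ} (hφ : SmoothPer L φ) (hu : MemH L r u) (y : ℝ) :
    orbitDist L r u φ ≤ ‖Hper.of u hu - trans hφ r y‖ := by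
  rw [orbitDist_eq hφ hu]
  exact ciInf_le ⟨0, by rintro _ ⟨y, rfl⟩; exact norm_nonneg _⟩ y

/-- The infimum is attained because the orbit is the continuous image of a period. -/
lemma exists_orbitDist_eq {φ u : ℝ → ℝ} (hφ : SmoothPer L φ) (hu : MemH L r u) :
    ∃ y, orbitDist L r u φ = ‖Hper.of u hu - trans hφ r y‖ := by
  have hc : Continuous fun y => ‖Hper.of u hu - trans hφ r y‖ :=
    (continuous_const.sub (continuous_trans hφ r)).norm
  obtain ⟨y, -, hy⟩ := isCompact_Icc.exists_isMinOn (s := Icc (0 : ℝ) L)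
    ⟨0, le_rfl, hL.out.le⟩ hc.continuousOn
  refine ⟨y, le_antisymm (orbitDist_le hφ hu y) ?_⟩
  rw [orbitDist_eq hφ hu]
  refine le_ciInf fun z => ?_
  have hp : Function.Periodic (fun y => ‖Hper.of u hu - trans hφ r y‖) L := fun y => by
    simp only [trans_periodic hφ r y]
  obtain ⟨z', hz', e⟩ := hp.exists_mem_Ico₀ hL.out z
  rw [e]
  exact hy ⟨hz'.1, hz'.2.le⟩

lemma orbitDist_lipschitz {φ u v : ℝ → ℝ} (hφ : SmoothPer L φ) (hu : MemH L r u) (hv : MemH L r v) :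
    |orbitDist L r u φ - orbitDist L r v φ| ≤ sobNorm L r fun x => u x - v x := by
  have h1 : ∀ u v (hu : MemH L r u) (hv : MemH L r v),
      orbitDist L r u φ ≤ orbitDist L r v φ + ‖Hper.of u hu - Hper.of v hv‖ := by
    intro u v hu hv
    obtain ⟨y, hy⟩ := exists_orbitDist_eq hφ hv
    rw [hy]
    refine (orbitDist_le hφ hu y).trans ?_
    have := norm_add_le (Hper.of v hv - trans hφ r y) (Hper.of u hu - Hper.of v hv)
    rwa [sub_add_sub_comm, add_comm (Hper.of v hv), add_sub_add_right_eq_sub] at this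
  rw [← Hper.norm_of (hu.sub hL.out hv), ← Hper.of_sub hu hv, abs_le]
  have a1 := h1 u v hu hv
  have a2 := h1 v u hv hu
  rw [norm_sub_rev] at a2
  constructor <;> linarith

/-- A translate of `u` whose distance to `φ` is the distance of `u` to the orbit of `φ`; its
difference with `φ` cannot be shortened in the direction `φ'`. -/
theorem exists_modulation (f : ℝ → ℝ) {φ u : ℝ → ℝ} (hφ : SmoothPer L φ) (hu : MemH L r u) :
    ∃ v : Hper L r, ‖v‖ = orbitDist L r u φ ∧
      (∃ y, ∀ k, coeff L (Hper.of φ (hφ.memH hL.out r) + v).fn k = fchar L k y * coeff L u k) ∧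
      potN L f (Hper.of φ (hφ.memH hL.out r) + v).fn = potN L f u ∧
      ∀ t : ℝ, ‖v‖ ≤ ‖v - t • Hper.of (deriv φ) (hφ.deriv.memH hL.out r)‖ := by
  obtain ⟨y, hy⟩ := exists_orbitDist_eq hφ hu
  obtain ⟨w, hw, hpot⟩ := (Hper.of u hu).exists_translate f (-y)
  set P := Hper.of φ (hφ.memH hL.out r) with hP
  set ψ := Hper.of (deriv φ) (hφ.deriv.memH hL.out r) with hψ
  have hshift : ∀ h, ‖w - trans hφ r h‖ = ‖Hper.of u hu - trans hφ r (y + h)‖ := fun h => by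
    refine Hper.norm_congr_coeff fun k => ?_
    rw [Hper.coeff_fn_sub, Hper.coeff_fn_sub, hw, coeff_trans, coeff_trans]
    have e : fchar L k h = fchar L k (-y) * fchar L k (y + h) := by
      rw [← fchar_add_right]; congr 1; ring
    rw [e, mul_assoc, ← mul_sub, norm_fchar_mul]
  have hP0 : trans hφ r 0 = P := Hper.ext_coeff fun k => by
    rw [coeff_trans, hP, Hper.coeff_of]; simp [fchar]
  have hvn : ‖w - P‖ = orbitDist L r u φ := by rw [← hP0, hshift, add_zero, hy]
  refine ⟨w - P, hvn, ⟨-y, fun k => ?_⟩, ?_, fun t => ?_⟩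
  · rw [add_sub_cancel, hw, Hper.coeff_of]
  · rw [add_sub_cancel, hpot, potN_congr hL.out f (Hper.fn_of hu)]
  set v := w - P with hv
  obtain ⟨C, hC, hdiff⟩ := norm_trans_sub_sub_le hφ r
  have hmin : ∀ h : ℝ, ‖v‖ ≤ ‖v - h • ψ‖ + C * h ^ 2 := by
    intro h
    have h1 : ‖v‖ ≤ ‖w - trans hφ r h‖ := by
      rw [hvn, hshift]; exact orbitDist_le hφ hu _
    have e : w - trans hφ r h = (v - h • ψ) - (trans hφ r h - P - h • ψ) := by rw [hv]; abel
    rw [e] at h1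
    exact h1.trans ((norm_sub_le _ _).trans (by gcongr; exact hdiff h))
  -- First-order optimality by convexity: `v - s t ψ` lies on the segment from `v` to `v - t ψ`,
  -- while minimality along the orbit loses only `C (s t)²`. Dividing by `s` and letting `s → 0`
  -- removes the error.
  have hconv : ∀ s : ℝ, 0 < s → s ≤ 1 → ‖v‖ ≤ ‖v - t • ψ‖ + s * (C * t ^ 2) := by
    intro s hs hs1
    have h1 := hmin (s * t)
    have e : v - (s * t) • ψ = (1 - s) • v + s • (v - t • ψ) := by
      module
    have h2 : ‖v - (s * t) • ψ‖ ≤ (1 - s) * ‖v‖ + s * ‖v - t • ψ‖ := by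
      rw [e]
      refine (norm_add_le _ _).trans ?_
      rw [norm_smul, norm_smul, Real.norm_eq_abs, Real.norm_eq_abs, abs_of_pos hs,
        abs_of_nonneg (by linarith)]
    have h3 : s * ‖v‖ ≤ s * (‖v - t • ψ‖ + s * (C * t ^ 2)) := by nlinarith
    exact le_of_mul_le_mul_left h3 hs
  refine le_of_forall_pos_le_add fun ε hε => ?_
  have h4 := hconv (min 1 (ε / (C * t ^ 2 + 1))) (by positivity) (min_le_left _ _)
  refine h4.trans ?_
  gcongr
  have h5 : min 1 (ε / (C * t ^ 2 + 1)) ≤ ε / (C * t ^ 2 + 1) := min_le_right _ _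
  rw [le_div_iff₀ (by positivity)] at h5
  have h6 : 0 ≤ min 1 (ε / (C * t ^ 2 + 1)) := by positivity
  linarith

end

/-! ## Smooth families of periodic functions -/

/-- A jointly smooth family `G t`, `t ∈ S`, of `L`-periodic functions. -/
structure SmoothFam (L : ℝ) (S : Set ℝ) (G : ℝ → ℝ → ℝ) : Prop where
  isOpen : IsOpen S
  contDiffOn : ContDiffOn ℝ (⊤ : ℕ∞) (fun p : ℝ × ℝ => G p.1 p.2) (S ×ˢ univ)
  periodic : ∀ t ∈ S, Function.Periodic (G t) L

/-- The derivative of a family with respect to the parameter. -/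
noncomputable def dpar (G : ℝ → ℝ → ℝ) (t x : ℝ) : ℝ := deriv (fun τ => G τ x) t

variable {L : ℝ} {S : Set ℝ} {G : ℝ → ℝ → ℝ}

lemma SmoothFam.isOpen_prod (h : SmoothFam L S G) : IsOpen (S ×ˢ (univ : Set ℝ)) :=
  h.isOpen.prod isOpen_univ

lemma SmoothFam.hasFDerivAt (h : SmoothFam L S G) {t : ℝ} (ht : t ∈ S) (x : ℝ) :
    HasFDerivAt (fun p : ℝ × ℝ => G p.1 p.2) (fderiv ℝ (fun p : ℝ × ℝ => G p.1 p.2) (t, x)) (t, x) :=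
  ((h.contDiffOn.contDiffAt (h.isOpen_prod.mem_nhds ⟨ht, mem_univ x⟩)).differentiableAt
    (by simp)).hasFDerivAt

lemma SmoothFam.smoothPer (h : SmoothFam L S G) {t : ℝ} (ht : t ∈ S) : SmoothPer L (G t) := by
  refine ⟨?_, h.periodic t ht⟩
  exact h.contDiffOn.comp_contDiff (g := fun p : ℝ × ℝ => G p.1 p.2) (f := fun x => (t, x))
    (contDiff_const.prodMk contDiff_id) fun x => ⟨ht, mem_univ x⟩

lemma SmoothFam.hasDerivAt_fst (h : SmoothFam L S G) {t : ℝ} (ht : t ∈ S) (x : ℝ) :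
    HasDerivAt (fun τ => G τ x) (fderiv ℝ (fun p : ℝ × ℝ => G p.1 p.2) (t, x) (1, 0)) t :=
  (h.hasFDerivAt ht x).comp_hasDerivAt (f := fun τ : ℝ => (τ, x)) t
    ((hasDerivAt_id t).prodMk (hasDerivAt_const t x))

lemma SmoothFam.hasDerivAt_snd (h : SmoothFam L S G) {t : ℝ} (ht : t ∈ S) (x : ℝ) :
    HasDerivAt (G t) (fderiv ℝ (fun p : ℝ × ℝ => G p.1 p.2) (t, x) (0, 1)) x :=
  (h.hasFDerivAt ht x).comp_hasDerivAt x ((hasDerivAt_const x t).prodMk (hasDerivAt_id x))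

lemma SmoothFam.hasDerivAt (h : SmoothFam L S G) {t : ℝ} (ht : t ∈ S) (x : ℝ) :
    HasDerivAt (fun τ => G τ x) (dpar G t x) t := (h.hasDerivAt_fst ht x).differentiableAt.hasDerivAt

lemma SmoothFam.fderiv_apply (h : SmoothFam L S G) (e : ℝ × ℝ) :
    ContDiffOn ℝ (⊤ : ℕ∞) (fun p : ℝ × ℝ => fderiv ℝ (fun p : ℝ × ℝ => G p.1 p.2) p e)
      (S ×ˢ univ) :=
  (h.contDiffOn.fderiv_of_isOpen h.isOpen_prod (by simp)).clm_apply contDiffOn_const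

lemma SmoothFam.dpar (h : SmoothFam L S G) : SmoothFam L S (dpar G) where
  isOpen := h.isOpen
  contDiffOn := (h.fderiv_apply (1, 0)).congr fun p hp => (h.hasDerivAt_fst hp.1 p.2).deriv
  periodic t ht x := by
    refine Filter.EventuallyEq.deriv_eq ?_
    filter_upwards [h.isOpen.mem_nhds ht] with τ hτ
    exact h.periodic τ hτ x

lemma SmoothFam.deriv (h : SmoothFam L S G) : SmoothFam L S (fun t => deriv (G t)) where
  isOpen := h.isOpen
  contDiffOn := (h.fderiv_apply (0, 1)).congr fun p hp => (h.hasDerivAt_snd hp.1 p.2).deriv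
  periodic _ ht := (h.smoothPer ht).deriv.2

lemma SmoothFam.iteratedDeriv (h : SmoothFam L S G) (p : ℕ) :
    SmoothFam L S (fun t => iteratedDeriv p (G t)) := by
  induction p with
  | zero => simpa using h
  | succ p ih => simpa only [iteratedDeriv_succ] using ih.deriv

lemma SmoothFam.comp {F : ℝ → ℝ} (hF : ContDiff ℝ (⊤ : ℕ∞) F) (h : SmoothFam L S G) :
    SmoothFam L S fun t x => F (G t x) where
  isOpen := h.isOpen
  contDiffOn := hF.comp_contDiffOn h.contDiffOn
  periodic t ht x := by simp only [h.periodic t ht x]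

lemma SmoothFam.continuousOn (h : SmoothFam L S G) :
    ContinuousOn (fun p : ℝ × ℝ => G p.1 p.2) (S ×ˢ univ) := h.contDiffOn.continuousOn

lemma SmoothFam.exists_bound (h : SmoothFam L S G) {t₀ : ℝ} (ht₀ : t₀ ∈ S) :
    ∃ ε > 0, Metric.ball t₀ ε ⊆ S ∧ ∃ D, ∀ t ∈ Metric.ball t₀ ε, ∀ x ∈ Icc 0 L, |G t x| ≤ D := by
  obtain ⟨ε, hε, hsub⟩ := Metric.isOpen_iff.1 h.isOpen t₀ ht₀
  have hc : Metric.closedBall t₀ (ε / 2) ⊆ S :=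
    (Metric.closedBall_subset_ball (half_lt_self hε)).trans hsub
  obtain ⟨D, hD⟩ := ((isCompact_closedBall t₀ (ε / 2)).prod isCompact_Icc).exists_bound_of_continuousOn
    (h.continuousOn.mono (prod_mono hc (subset_univ (Icc 0 L))))
  exact ⟨ε / 2, by positivity, Metric.ball_subset_closedBall.trans hc, D, fun t ht x hx =>
    hD (t, x) ⟨Metric.ball_subset_closedBall ht, hx⟩⟩

/-- Differentiation under the integral sign, with a complex continuous weight. -/
lemma SmoothFam.hasDerivAt_integral_smul {E : Type*} [NormedAddCommGroup E] [NormedSpace ℝ E]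
    (h : SmoothFam L S G) (hL : 0 < L) {t : ℝ} (ht : t ∈ S) {w : ℝ → E} (hw : Continuous w) :
    HasDerivAt (fun τ => ∫ x in (0 : ℝ)..L, G τ x • w x)
      (∫ x in (0 : ℝ)..L, PerWave.dpar G t x • w x) t := by
  obtain ⟨ε, hε, hsub, D, hD⟩ := h.dpar.exists_bound ht
  have hD0 : 0 ≤ D := (abs_nonneg _).trans
    (hD t (Metric.mem_ball_self hε) 0 ⟨le_rfl, hL.le⟩)
  refine (intervalIntegral.hasDerivAt_integral_of_dominated_loc_of_deriv_le
    (F := fun τ x => G τ x • w x) (F' := fun τ x => PerWave.dpar G τ x • w x)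
    (bound := fun x => D * ‖w x‖) (Metric.ball_mem_nhds t hε) ?_ ?_ ?_ ?_ ?_ ?_).2
  · filter_upwards [h.isOpen.mem_nhds ht] with τ hτ
    exact ((h.smoothPer hτ).continuous.smul hw).aestronglyMeasurable
  · exact ((h.smoothPer ht).continuous.smul hw).intervalIntegrable _ _
  · exact ((h.dpar.smoothPer ht).continuous.smul hw).aestronglyMeasurable
  · refine ae_of_all _ fun x hx τ hτ => ?_
    rw [uIoc_of_le hL.le] at hx
    rw [norm_smul]
    gcongr
    exact hD τ hτ x ⟨hx.1.le, hx.2⟩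
  · exact (continuous_const.mul hw.norm).intervalIntegrable _ _
  · exact ae_of_all _ fun x _ τ hτ => (h.hasDerivAt (hsub hτ) x).smul_const (w x)

lemma SmoothFam.hasDerivAt_integral (h : SmoothFam L S G) (hL : 0 < L) {t : ℝ} (ht : t ∈ S) :
    HasDerivAt (fun τ => ∫ x in (0 : ℝ)..L, G τ x) (∫ x in (0 : ℝ)..L, PerWave.dpar G t x) t := by
  simpa using h.hasDerivAt_integral_smul hL ht (w := fun _ => (1 : ℝ)) continuous_const

lemma SmoothFam.hasDerivAt_coeff (h : SmoothFam L S G) (hL : 0 < L) {t : ℝ} (ht : t ∈ S) (k : ℤ) :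
    HasDerivAt (fun τ => coeff L (G τ) k) (coeff L (PerWave.dpar G t) k) t := by
  have := (h.hasDerivAt_integral_smul hL ht (continuous_fchar L (-k))).const_mul (1 / (L : ℂ))
  simpa only [coeff_eq_integral, Complex.real_smul, mul_comm (fchar L (-k) _)] using this

lemma SmoothFam.dpar_comp {F : ℝ → ℝ} (hF : ContDiff ℝ (⊤ : ℕ∞) F) (h : SmoothFam L S G) {t : ℝ}
    (ht : t ∈ S) (x : ℝ) :
    PerWave.dpar (fun t x => F (G t x)) t x = _root_.deriv F (G t x) * PerWave.dpar G t x :=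
  (((hF.differentiable (by simp) (G t x)).hasDerivAt).comp t (h.hasDerivAt ht x)).deriv

lemma SmoothFam.hasDerivAt_massM (h : SmoothFam L S G) (hL : 0 < L) {t : ℝ} (ht : t ∈ S) :
    HasDerivAt (fun τ => massM L (G τ)) (massM L (PerWave.dpar G t)) t := h.hasDerivAt_integral hL ht

lemma SmoothFam.hasDerivAt_integral_sq (h : SmoothFam L S G) (hL : 0 < L) {t : ℝ} (ht : t ∈ S) :
    HasDerivAt (fun τ => ∫ x in (0 : ℝ)..L, G τ x ^ 2) (2 * innerPer L (G t) (PerWave.dpar G t)) t := by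
  have h2 : ContDiff ℝ (⊤ : ℕ∞) fun y : ℝ => y ^ 2 := contDiff_id.pow 2
  refine ((h.comp h2).hasDerivAt_integral hL ht).congr_deriv ?_
  rw [innerPer, ← intervalIntegral.integral_const_mul]
  refine intervalIntegral.integral_congr fun x _ => ?_
  simp only [h.dpar_comp h2 ht]
  simp
  ring

lemma SmoothFam.hasDerivAt_massF (h : SmoothFam L S G) (hL : 0 < L) {t : ℝ} (ht : t ∈ S) :
    HasDerivAt (fun τ => massF L (G τ)) (innerPer L (G t) (PerWave.dpar G t)) t :=
  ((h.hasDerivAt_integral_sq hL ht).const_mul (1 / 2)).congr_deriv (by ring)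

lemma SmoothFam.hasDerivAt_potN {f : ℝ → ℝ} (hf : ContDiff ℝ (⊤ : ℕ∞) f) (h : SmoothFam L S G)
    (hL : 0 < L) {t : ℝ} (ht : t ∈ S) :
    HasDerivAt (fun τ => potN L f (G τ)) (innerPer L (fun x => f (G t x)) (PerWave.dpar G t)) t := by
  refine ((h.comp (contDiff_prim hf)).hasDerivAt_integral hL ht).congr_deriv ?_
  refine intervalIntegral.integral_congr fun x _ => ?_
  simp only [h.dpar_comp (contDiff_prim hf) ht, (hasDerivAt_prim hf.continuous _).deriv]

/-- The kinetic energy `(𝓜u, u)`. -/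
noncomputable def kinE (L : ℝ) (θ u : ℝ → ℝ) : ℝ := ∑' k : ℤ, L * (θ k * ‖coeff L u k‖ ^ 2)

lemma hasDerivAt_norm_sq {c : ℝ → ℂ} {c' : ℂ} {t : ℝ} (h : HasDerivAt c c' t) :
    HasDerivAt (fun τ => ‖c τ‖ ^ 2) (2 * (c t * (starRingEnd ℂ) c').re) t := by
  have h1 := h.norm_sq
  refine h1.congr_deriv ?_
  rw [Complex.inner, mul_comm (c t), ← Complex.conj_re, map_mul, Complex.conj_conj]

lemma SmoothFam.exists_coeff_bound (h : SmoothFam L S G) (hL : 0 < L) {t₀ : ℝ} (ht₀ : t₀ ∈ S)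
    (p : ℕ) : ∃ ε > 0, ∃ D, 0 ≤ D ∧ ∀ δ ≤ ε, ∀ t ∈ Metric.ball t₀ δ, ∀ k : ℤ,
      |(k : ℝ)| ^ p * ‖coeff L (G t) k‖ ≤ D := by
  obtain ⟨ε, hε, hsub, D, hD⟩ := (h.iteratedDeriv p).exists_bound ht₀
  have key : ∀ δ ≤ ε, ∀ t ∈ Metric.ball t₀ δ, ∀ k : ℤ,
      |(k : ℝ)| ^ p * ‖coeff L (G t) k‖ ≤ (L / (2 * Real.pi)) ^ p * D := fun δ hδ t ht k =>
    (h.smoothPer (hsub (Metric.ball_subset_ball hδ ht))).pow_mul_norm_coeff_le hL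
      (hD t (Metric.ball_subset_ball hδ ht)) k
  refine ⟨ε, hε, _, ?_, key⟩
  exact le_trans (by positivity) (key ε le_rfl t₀ (Metric.mem_ball_self hε) 0)

/-- The Fourier series of `(𝓜u, u)` is differentiated term by term. Smoothness of the family gives
coefficient decay uniform in the parameter, hence a summable majorant for the derivatives. -/
lemma SmoothFam.hasDerivAt_kinE [hLf : Fact (0 < L)] {θ : ℝ → ℝ} (he : ∀ κ, θ (-κ) = θ κ) {r C : ℝ}
    (hθ : SymbolBound θ r C) (h : SmoothFam L S G) {t₀ : ℝ} (ht₀ : t₀ ∈ S) :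
    HasDerivAt (fun τ => kinE L θ (G τ))
      (2 * innerPer L (multiplier L θ (G t₀)) (PerWave.dpar G t₀)) t₀ := by
  have hL := hLf.out
  have hC := hθ.1
  obtain ⟨C', N, hC', hw⟩ := weight_le r
  obtain ⟨ε₀, hε₀, hsub, D, hD⟩ := h.dpar.exists_bound ht₀
  -- The orders `0`, `2`, `N`, `N + 2` are the monomials of `(1 + |k|^N)(1 + |k|²)`: growth of the
  -- symbol times the decay required for summability.
  obtain ⟨ε₁, hε₁, D₁, hD₁, h1⟩ := h.exists_coeff_bound hL ht₀ 0
  obtain ⟨ε₂, hε₂, D₂, hD₂, h2⟩ := h.exists_coeff_bound hL ht₀ 2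
  obtain ⟨ε₃, hε₃, D₃, hD₃, h3⟩ := h.exists_coeff_bound hL ht₀ N
  obtain ⟨ε₄, hε₄, D₄, hD₄, h4⟩ := h.exists_coeff_bound hL ht₀ (N + 2)
  set ε := min ε₀ (min (min ε₁ ε₂) (min ε₃ ε₄)) with hε
  have hεpos : 0 < ε := by positivity
  have l0 : ε ≤ ε₀ := min_le_left _ _
  have l1 : ε ≤ ε₁ := (min_le_right _ _).trans ((min_le_left _ _).trans (min_le_left _ _))
  have l2 : ε ≤ ε₂ := (min_le_right _ _).trans ((min_le_left _ _).trans (min_le_right _ _))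
  have l3 : ε ≤ ε₃ := (min_le_right _ _).trans ((min_le_right _ _).trans (min_le_left _ _))
  have l4 : ε ≤ ε₄ := (min_le_right _ _).trans ((min_le_right _ _).trans (min_le_right _ _))
  have hin : ∀ t ∈ Metric.ball t₀ ε, t ∈ S := fun t ht => hsub (Metric.ball_subset_ball l0 ht)
  have hD0 : 0 ≤ D := (abs_nonneg _).trans (hD t₀ (Metric.mem_ball_self hε₀) 0 ⟨le_rfl, hL.le⟩)
  have hderiv := hasDerivAt_tsum_of_isPreconnected (𝕜 := ℝ) (α := ℤ) (t := Metric.ball t₀ ε)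
    (y₀ := t₀) (y := t₀)
    (g := fun k τ => L * (θ k * ‖coeff L (G τ) k‖ ^ 2))
    (g' := fun k τ => L * (θ k * (2 * (coeff L (G τ) k
      * (starRingEnd ℂ) (coeff L (PerWave.dpar G τ) k)).re)))
    (u := fun k => L * (C * C') * (D₁ + D₂ + D₃ + D₄) * (2 * D) * (1 / (1 + |(k : ℝ)| ^ 2)))
    (summable_inv_one_add_sq.mul_left _) Metric.isOpen_ball
    (convex_ball t₀ ε).isPreconnected
    (fun k τ hτ => ((hasDerivAt_norm_sq (h.hasDerivAt_coeff hL (hin τ hτ) k)).const_mul _).const_mul _)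
    (fun k τ hτ => by
      have e1 : |θ k| ≤ C * C' * (1 + |(k : ℝ)| ^ N) := by
        rw [mul_assoc]
        exact (hθ.2 k).trans (by gcongr; exact hw k)
      have e2 := norm_coeff_le hL (hD τ (Metric.ball_subset_ball l0 hτ)) k
      have e3 := abs_re_mul_conj_le (coeff L (G τ) k) (coeff L (PerWave.dpar G τ) k)
      have f1 := h1 ε l1 τ hτ k
      have f2 := h2 ε l2 τ hτ k
      have f3 := h3 ε l3 τ hτ k
      have f4 := h4 ε l4 τ hτ k
      set a := ‖coeff L (G τ) k‖
      have ha : 0 ≤ a := norm_nonneg _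
      have e4 : (1 + |(k : ℝ)| ^ N) * a ≤ (D₁ + D₂ + D₃ + D₄) * (1 / (1 + |(k : ℝ)| ^ 2)) := by
        rw [mul_one_div, le_div_iff₀ (by positivity)]
        rw [pow_zero, one_mul] at f1
        rw [pow_add, mul_assoc] at f4
        have : (1 + |(k : ℝ)| ^ N) * a * (1 + |(k : ℝ)| ^ 2) = a + |(k : ℝ)| ^ 2 * a
          + |(k : ℝ)| ^ N * a + |(k : ℝ)| ^ N * (|(k : ℝ)| ^ 2 * a) := by ring
        rw [this]; linarith
      rw [Real.norm_eq_abs, abs_mul, abs_mul, abs_mul, abs_of_pos hL, abs_two]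
      calc L * (|θ k| * (2 * |(coeff L (G τ) k * (starRingEnd ℂ) (coeff L (PerWave.dpar G τ) k)).re|))
          ≤ L * ((C * C' * (1 + |(k : ℝ)| ^ N)) * (2 * (a * D))) := by
            gcongr
            exact e3.trans (by gcongr)
        _ = L * (C * C') * ((1 + |(k : ℝ)| ^ N) * a) * (2 * D) := by ring
        _ ≤ L * (C * C') * ((D₁ + D₂ + D₃ + D₄) * (1 / (1 + |(k : ℝ)| ^ 2))) * (2 * D) := by gcongr
        _ = _ := by ring)
    (Metric.mem_ball_self hεpos)
    (by
      have hs := ((h.smoothPer ht₀).rapid hL).summable_weight r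
      refine Summable.of_norm_bounded (hs.mul_left (L * C)) fun k => ?_
      rw [Real.norm_eq_abs, abs_mul, abs_mul, abs_of_pos hL, abs_of_nonneg (sq_nonneg ‖_‖),
        mul_assoc L C, ← mul_assoc C]
      gcongr
      exact hθ.2 k)
    (Metric.mem_ball_self hεpos)
  refine hderiv.congr_deriv ?_
  have hp := (hasSum_coeff_mul hL (smoothPer_multiplier hθ (h.smoothPer ht₀)).memLp
    (h.dpar.smoothPer ht₀).memLp).mul_left 2
  rw [← hp.tsum_eq]
  refine tsum_congr fun k => ?_
  rw [coeff_multiplier he hθ (h.smoothPer ht₀), mul_assoc, Complex.re_ofReal_mul]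
  ring

/-! ## Conservation laws -/

lemma SmoothPer.integral_deriv {g : ℝ → ℝ} (hg : SmoothPer L g) :
    ∫ x in (0 : ℝ)..L, _root_.deriv g x = 0 := by
  rw [intervalIntegral.integral_deriv_eq_sub' g rfl
    (fun x _ => (hg.hasDerivAt x).differentiableAt) hg.deriv.continuous.continuousOn]
  have : g L = g 0 := by simpa using hg.2 0
  rw [this, sub_self]

lemma SmoothPer.innerPer_deriv {g h : ℝ → ℝ} (hg : SmoothPer L g) (hh : SmoothPer L h) :
    innerPer L g (_root_.deriv h) = -innerPer L (_root_.deriv g) h := by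
  have h1 := (hg.mul hh).integral_deriv
  have e : _root_.deriv (fun x => g x * h x) = fun x => _root_.deriv g x * h x + g x * _root_.deriv h x :=
    funext fun x => ((hg.hasDerivAt x).mul (hh.hasDerivAt x)).deriv
  simp only [e] at h1
  rw [intervalIntegral.integral_add (f := fun x => _root_.deriv g x * h x)
    (g := fun x => g x * _root_.deriv h x) ((hg.deriv.continuous.mul hh.continuous).intervalIntegrable _ _)
    ((hg.continuous.mul hh.deriv.continuous).intervalIntegrable _ _)] at h1
  unfold innerPer
  linarith

lemma SmoothPer.innerPer_deriv_self {g : ℝ → ℝ} (hg : SmoothPer L g) :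
    innerPer L g (_root_.deriv g) = 0 := by
  have h1 := hg.innerPer_deriv hg
  rw [innerPer_comm L (_root_.deriv g)] at h1
  linarith

/-- The symbol of `𝓜` is real and that of the derivative imaginary, so every term of the Parseval
sum has zero real part. -/
lemma innerPer_multiplier_deriv [hLf : Fact (0 < L)] {θ : ℝ → ℝ} (he : ∀ κ, θ (-κ) = θ κ) {r C : ℝ}
    (hθ : SymbolBound θ r C) {g : ℝ → ℝ} (hg : SmoothPer L g) :
    innerPer L (multiplier L θ g) (deriv g) = 0 := by
  have hL := hLf.out
  refine (hasSum_coeff_mul hL (smoothPer_multiplier hθ hg).memLp hg.deriv.memLp).unique ?_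
  refine (hasSum_congr fun k => ?_).2 hasSum_zero
  rw [coeff_multiplier he hθ hg, hg.coeff_deriv hL]
  have e : (θ k : ℂ) * coeff L g k * (starRingEnd ℂ) (2 * Real.pi * Complex.I * k / L * coeff L g k)
      = ((θ k * (-(2 * Real.pi * k / L)) * Complex.normSq (coeff L g k) : ℝ) : ℂ) * Complex.I := by
    have e1 : (starRingEnd ℂ) (2 * Real.pi * Complex.I * k / L)
        = ((-(2 * Real.pi * k / L) : ℝ) : ℂ) * Complex.I := by
      simp only [map_mul, map_div₀, Complex.conj_I, Complex.conj_ofReal, map_intCast,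
        Complex.conj_ofNat]
      push_cast; ring
    rw [map_mul, e1]
    push_cast
    rw [← Complex.mul_conj]
    ring
  rw [e, Complex.re_ofReal_mul, Complex.I_re, mul_zero, mul_zero]

variable {θ f : ℝ → ℝ} {U : ℝ → ℝ → ℝ}

/-- Restricting to `t > 0` gives an open time set, where two-sided derivatives exist. The initial
time is recovered later, by continuity, in `IsSolution.conserved`. -/
lemma IsClassicalSolution.smoothFam (h : IsClassicalSolution L θ f U) : SmoothFam L (Ioi 0) U where
  isOpen := isOpen_Ioi
  contDiffOn := h.1.mono (prod_mono Ioi_subset_Ici_self subset_rfl)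
  periodic t ht := h.2.1 t (le_of_lt ht)

lemma IsClassicalSolution.smoothPer (h : IsClassicalSolution L θ f U) {t : ℝ} (ht : 0 ≤ t) :
    SmoothPer L (U t) :=
  ⟨h.1.comp_contDiff (g := fun p : ℝ × ℝ => U p.1 p.2) (f := fun x => (t, x))
    (contDiff_const.prodMk contDiff_id) fun x => ⟨ht, mem_univ x⟩, h.2.1 t ht⟩

/-- The flux `𝓜u - f(u)`. -/
noncomputable def flux (L : ℝ) (θ f u : ℝ → ℝ) (x : ℝ) : ℝ := multiplier L θ u x - f (u x)

lemma smoothPer_flux [hLf : Fact (0 < L)] {r C : ℝ} (hθ : SymbolBound θ r C)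
    (hf : ContDiff ℝ (⊤ : ℕ∞) f) {u : ℝ → ℝ} (hu : SmoothPer L u) : SmoothPer L (flux L θ f u) :=
  (smoothPer_multiplier hθ hu).sub (hu.comp hf)

/-- The equation in Hamiltonian form `U_t = ∂ₓ(𝓜U - f(U))`, where the flux is the `L²` gradient of
`E`. All three conservation laws follow by integration by parts. -/
lemma IsClassicalSolution.dpar_eq [hLf : Fact (0 < L)] {r C : ℝ} (hθ : SymbolBound θ r C)
    (hf : ContDiff ℝ (⊤ : ℕ∞) f) (h : IsClassicalSolution L θ f U) {t : ℝ} (ht : 0 < t) :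
    dpar U t = deriv (flux L θ f (U t)) := by
  ext x
  have h1 := (h.2.2 t ht.le x).hasDerivAt (Ici_mem_nhds ht)
  have hu := h.smoothPer ht.le
  rw [dpar, h1.deriv]
  have e := ((smoothPer_multiplier hθ hu).hasDerivAt x).sub ((hu.comp hf).hasDerivAt x)
  rw [show flux L θ f (U t) = fun x => multiplier L θ (U t) x - f (U t x) from rfl]
  have e' : deriv (fun x => multiplier L θ (U t) x - f (U t x)) x
      = deriv (multiplier L θ (U t)) x - deriv (fun x => f (U t x)) x := e.deriv
  rw [e']
  ring

lemma eq_of_hasDerivAt_zero {Γ : ℝ → ℝ} (h : ∀ t, 0 < t → HasDerivAt Γ 0 t) {t τ : ℝ} (ht : 0 < t)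
    (hτ : 0 < τ) : Γ t = Γ τ :=
  isOpen_Ioi.is_const_of_deriv_eq_zero (convex_Ioi (0 : ℝ)).isPreconnected
    (fun x hx => (h x hx).differentiableAt.differentiableWithinAt) (fun x hx => (h x hx).deriv) ht hτ

theorem IsClassicalSolution.massM_eq [hLf : Fact (0 < L)] {r C : ℝ} (hθ : SymbolBound θ r C)
    (hf : ContDiff ℝ (⊤ : ℕ∞) f) (h : IsClassicalSolution L θ f U) {t τ : ℝ} (ht : 0 < t)
    (hτ : 0 < τ) : massM L (U t) = massM L (U τ) := by
  refine eq_of_hasDerivAt_zero (Γ := fun t => massM L (U t)) (fun t ht => ?_) ht hτ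
  refine (h.smoothFam.hasDerivAt_massM hLf.out ht).congr_deriv ?_
  rw [h.dpar_eq hθ hf ht]
  exact (smoothPer_flux hθ hf (h.smoothPer ht.le)).integral_deriv

theorem IsClassicalSolution.massF_eq [hLf : Fact (0 < L)] (he : ∀ κ, θ (-κ) = θ κ) {r C : ℝ}
    (hθ : SymbolBound θ r C)
    (hf : ContDiff ℝ (⊤ : ℕ∞) f) (h : IsClassicalSolution L θ f U) {t τ : ℝ} (ht : 0 < t)
    (hτ : 0 < τ) : massF L (U t) = massF L (U τ) := by
  refine eq_of_hasDerivAt_zero (Γ := fun t => massF L (U t)) (fun t ht => ?_) ht hτ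
  refine (h.smoothFam.hasDerivAt_massF hLf.out ht).congr_deriv ?_
  have hu := h.smoothPer ht.le
  rw [h.dpar_eq hθ hf ht, hu.innerPer_deriv (smoothPer_flux hθ hf hu), neg_eq_zero, innerPer_comm]
  have e1 : innerPer L (flux L θ f (U t)) (deriv (U t))
      = innerPer L (multiplier L θ (U t)) (deriv (U t)) - ∫ x in (0 : ℝ)..L,
        deriv (fun x => prim f (U t x)) x := by
    rw [innerPer, innerPer, ← intervalIntegral.integral_sub]
    · refine intervalIntegral.integral_congr fun x _ => ?_
      have : HasDerivAt (fun x => prim f (U t x)) (f (U t x) * deriv (U t) x) x :=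
        (hasDerivAt_prim hf.continuous (U t x)).comp x (hu.hasDerivAt x)
      simp only [flux, this.deriv]
      ring
    · exact ((smoothPer_multiplier hθ hu).continuous.mul hu.deriv.continuous).intervalIntegrable _ _
    · exact (hu.comp (contDiff_prim hf)).deriv.continuous.intervalIntegrable _ _
  rw [e1, innerPer_multiplier_deriv he hθ hu, (hu.comp (contDiff_prim hf)).integral_deriv, sub_zero]

/-- The energy `E(u) = (𝓜u, u)/2 - ∫ W(u)`. -/
noncomputable def energyE (L : ℝ) (θ f u : ℝ → ℝ) : ℝ := 1 / 2 * kinE L θ u - potN L f u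

/-- The time derivative of the energy is the flux paired with its own `x`-derivative, which
integrates to zero over a period. -/
theorem IsClassicalSolution.energyE_eq [hLf : Fact (0 < L)] (he : ∀ κ, θ (-κ) = θ κ) {r C : ℝ}
    (hθ : SymbolBound θ r C)
    (hf : ContDiff ℝ (⊤ : ℕ∞) f) (h : IsClassicalSolution L θ f U) {t τ : ℝ} (ht : 0 < t)
    (hτ : 0 < τ) : energyE L θ f (U t) = energyE L θ f (U τ) := by
  refine eq_of_hasDerivAt_zero (Γ := fun t => energyE L θ f (U t)) (fun t ht => ?_) ht hτ
  refine (((h.smoothFam.hasDerivAt_kinE he hθ ht).const_mul (1 / 2)).sub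
    (h.smoothFam.hasDerivAt_potN hf hLf.out ht)).congr_deriv ?_
  have hu := h.smoothPer ht.le
  have hd := h.smoothFam.dpar.smoothPer (show t ∈ Ioi 0 from ht)
  have e1 : innerPer L (flux L θ f (U t)) (dpar U t)
      = innerPer L (multiplier L θ (U t)) (dpar U t) - innerPer L (fun x => f (U t x)) (dpar U t) := by
    rw [innerPer, innerPer, innerPer, ← intervalIntegral.integral_sub]
    · simp only [flux, sub_mul]
    · exact ((smoothPer_multiplier hθ hu).continuous.mul hd.continuous).intervalIntegrable _ _
    · exact ((hu.comp hf).continuous.mul hd.continuous).intervalIntegrable _ _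
  have e2 : innerPer L (flux L θ f (U t)) (dpar U t) = 0 := by
    rw [h.dpar_eq hθ hf ht]
    exact (smoothPer_flux hθ hf hu).innerPer_deriv_self
  linarith

/-- A continuous functional on `H^r_per`, `r ≤ s`, which is conserved by classical solutions is
conserved by `H^s`-solutions. -/
theorem IsSolution.conserved [hLf : Fact (0 < L)] {r s : ℝ} (hrs : r ≤ s) {u : ℝ → ℝ → ℝ}
    (hu : IsSolution L θ f s u) {Γ : Hper L r → ℝ} (hΓ : Continuous Γ)
    (hcl : ∀ U, ∀ hU : IsClassicalSolution L θ f U, ∀ t τ : ℝ, ∀ ht : 0 < t, ∀ hτ : 0 < τ,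
      Γ (Hper.of (U t) ((hU.smoothPer ht.le).memH hLf.out r))
        = Γ (Hper.of (U τ) ((hU.smoothPer hτ.le).memH hLf.out r)))
    {t : ℝ} (ht : 0 ≤ t) :
    Γ (Hper.of (u t) ((hu.1 t ht).mono hrs)) = Γ (Hper.of (u 0) ((hu.1 0 le_rfl).mono hrs)) := by
  have hL := hLf.out
  obtain ⟨hmem, hcont, V, hV, hconv⟩ := hu
  have hlim : ∀ t (ht : 0 < t), Tendsto
      (fun n => Γ (Hper.of (V n t) (((hV n).smoothPer ht.le).memH hL r))) atTop
      (𝓝 (Γ (Hper.of (u t) ((hmem t ht.le).mono hrs)))) := by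
    intro t ht
    refine (hΓ.tendsto _).comp ?_
    rw [tendsto_iff_norm_sub_tendsto_zero, Metric.tendsto_atTop]
    intro ε hε
    obtain ⟨N, hN⟩ := hconv t ε hε
    refine ⟨N, fun n hn => ?_⟩
    rw [dist_zero_right, norm_norm, Hper.of_sub, Hper.norm_of]
    exact (sobNorm_mono hL hrs ((((hV n).smoothPer ht.le).memH hL s).sub hL (hmem t ht.le))).trans_lt
      (hN n hn t ⟨ht.le, le_rfl⟩)
  have hpos : ∀ t τ (ht : 0 < t) (hτ : 0 < τ), Γ (Hper.of (u t) ((hmem t ht.le).mono hrs))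
      = Γ (Hper.of (u τ) ((hmem τ hτ.le).mono hrs)) := fun t τ ht hτ =>
    tendsto_nhds_unique (hlim t ht)
      ((hlim τ hτ).congr fun n => (hcl (V n) (hV n) t τ ht hτ).symm)
  rcases ht.eq_or_lt with rfl | ht'
  · rfl
  have h0 := hcont 0 le_rfl
  -- Constancy is known at positive times only; time continuity of `u` along `1/(n+1)` brings in `t
  -- = 0`.
  have htend : Tendsto (fun n : ℕ => 1 / ((n : ℝ) + 1)) atTop (𝓝[Ici 0] 0) :=
    tendsto_nhdsWithin_iff.2 ⟨tendsto_one_div_add_atTop_nhds_zero_nat,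
      Eventually.of_forall fun n => by simp only [mem_Ici]; positivity⟩
  have h1 := h0.comp htend
  have hn : ∀ n : ℕ, 0 < 1 / ((n : ℝ) + 1) := fun n => by positivity
  have h2 : Tendsto (fun n : ℕ => Γ (Hper.of (u (1 / ((n : ℝ) + 1))) ((hmem _ (hn n).le).mono hrs)))
      atTop (𝓝 (Γ (Hper.of (u 0) ((hmem 0 le_rfl).mono hrs)))) := by
    refine (hΓ.tendsto _).comp ?_
    rw [tendsto_iff_norm_sub_tendsto_zero]
    refine squeeze_zero (fun n => norm_nonneg _) (fun n => ?_) h1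
    rw [Hper.of_sub, Hper.norm_of]
    exact sobNorm_mono hL hrs ((hmem _ (hn n).le).sub hL (hmem 0 le_rfl))
  refine tendsto_nhds_unique (tendsto_const_nhds.congr fun n => ?_) h2
  exact hpos t _ ht' (hn n)

/-! ## The curve of travelling waves -/

lemma SmoothWaveCurve.smoothFam {L m : ℝ} {θ f ω A : ℝ → ℝ} {φ : ℝ → ℝ → ℝ} {I : Set ℝ}
    (h : SmoothWaveCurve L θ f m I ω A φ) (hI : IsOpen I) :
    SmoothFam L I φ := ⟨hI, h.smooth_φ, h.periodic⟩

section

variable {L : ℝ} [hL : Fact (0 < L)] {r m : ℝ} {θ f ω A : ℝ → ℝ} {φ : ℝ → ℝ → ℝ} {I : Set ℝ}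

/-- In Fourier coefficients the equation can be differentiated in the parameter without
interchanging a derivative with the series defining `𝓜`. -/
lemma WaveEq.coeff_eq {a b : ℝ} {g : ℝ → ℝ} (he : ∀ κ, θ (-κ) = θ κ) {C : ℝ}
    (hθ : SymbolBound θ r C) (hf : ContDiff ℝ (⊤ : ℕ∞) f) (hg : SmoothPer L g)
    (h : WaveEq L θ f a b g) (k : ℤ) :
    (θ k : ℂ) * coeff L g k + a * coeff L g k - coeff L (fun x => f (g x)) k
      + b * coeff L (fun _ => 1) k = 0 := by
  have hL' := hL.out
  have h1 : coeff L (fun x => (multiplier L θ g x + a * g x - f (g x)) + b * 1) k = 0 := by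
    have : (fun x => (multiplier L θ g x + a * g x - f (g x)) + b * 1) = fun _ => (0 : ℝ) := by
      ext x; rw [mul_one]; exact h x
    rw [this]
    simp [coeff]
  have hM := (smoothPer_multiplier hθ hg).memLp
  have hA : MemLp (fun x => multiplier L θ g x + a * g x) 2 (volume.restrict (Ioc 0 L)) :=
    hM.add (hg.memLp.const_mul a)
  have hB : MemLp (fun x => multiplier L θ g x + a * g x - f (g x)) 2
      (volume.restrict (Ioc 0 L)) := hA.sub (hg.comp hf).memLp
  rw [coeff_const_mul_add hL' hB (SmoothPer.const L 1).memLp] at h1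
  have h2 := coeff_sub hL' hA (hg.comp hf).memLp k
  have h3 := coeff_const_mul_add hL' hM hg.memLp a k
  rw [h2, h3, coeff_multiplier he hθ hg] at h1
  exact h1

/-- Differentiating the wave equation along the curve: `𝓛Φ = -ω'φ - A'`. -/
theorem SmoothWaveCurve.linOp_dpar (h : SmoothWaveCurve L θ f m I ω A φ) (hI : IsOpen I)
    (he : ∀ κ, θ (-κ) = θ κ) {C : ℝ} (hθ : SymbolBound θ r C) (hf : ContDiff ℝ (⊤ : ℕ∞) f)
    {ξ : ℝ} (hξ : ξ ∈ I) : AEEqPer L (linOp L θ f (ω ξ) (φ ξ) (dpar φ ξ))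
      (fun x => -(deriv ω ξ * φ ξ x + deriv A ξ * 1)) := by
  have hL' := hL.out
  have hF := h.smoothFam hI
  have hφ := hF.smoothPer hξ
  have hΦ := hF.dpar.smoothPer hξ
  have hω : HasDerivAt ω (deriv ω ξ) ξ :=
    ((h.smooth_ω.contDiffAt (hI.mem_nhds hξ)).differentiableAt (by simp)).hasDerivAt
  have hA : HasDerivAt A (deriv A ξ) ξ :=
    ((h.smooth_A.contDiffAt (hI.mem_nhds hξ)).differentiableAt (by simp)).hasDerivAt
  have hcoef : ∀ k : ℤ, (θ k : ℂ) * coeff L (dpar φ ξ) k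
      + (deriv ω ξ * coeff L (φ ξ) k + ω ξ * coeff L (dpar φ ξ) k)
      - coeff L (fun x => deriv f (φ ξ x) * dpar φ ξ x) k
      + deriv A ξ * coeff L (fun _ => 1) k = 0 := by
    intro k
    have d1 := hF.hasDerivAt_coeff hL' hξ k
    have d2 := (hF.comp hf).hasDerivAt_coeff hL' hξ k
    have e2 : dpar (fun t x => f (φ t x)) ξ = fun x => deriv f (φ ξ x) * dpar φ ξ x :=
      funext fun x => hF.dpar_comp hf hξ x
    rw [e2] at d2
    have d3 := (((d1.const_mul (θ k : ℂ)).add (hω.ofReal_comp.mul d1)).sub d2).add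
      (hA.ofReal_comp.mul_const (coeff L (fun _ => 1) k))
    refine d3.unique ((hasDerivAt_const ξ (0 : ℂ)).congr_of_eventuallyEq ?_)
    filter_upwards [hI.mem_nhds hξ] with ζ hζ
    exact (h.wave ζ hζ).coeff_eq he hθ hf (hF.smoothPer hζ) k
  have hM := (smoothPer_multiplier hθ hΦ).memLp
  have hq := smoothPer_deriv_comp hf hφ
  have hlin : SmoothPer L (linOp L θ f (ω ξ) (φ ξ) (dpar φ ξ)) := by
    rw [linOp_eq]
    exact (smoothPer_multiplier hθ hΦ).add ((smoothPer_linPot hf (ω ξ) hφ).mul hΦ)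
  have hrhs : MemLp (fun x => deriv ω ξ * φ ξ x + deriv A ξ * 1) 2 (volume.restrict (Ioc 0 L)) :=
    (hφ.memLp.const_mul _).add ((SmoothPer.const L 1).memLp.const_mul _)
  have h0 : AEEqPer L (fun x => linOp L θ f (ω ξ) (φ ξ) (dpar φ ξ) x
      + (deriv ω ξ * φ ξ x + deriv A ξ * 1)) 0 := by
    refine ae_zero_of_coeff hL' (hlin.memLp.add hrhs) fun k => ?_
    rw [coeff_add hL' hlin.memLp hrhs, coeff_const_mul_add hL' (hφ.memLp.const_mul _)
      (SmoothPer.const L 1).memLp, coeff_smul, linOp_eq,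
      coeff_add hL' hM (memLp_mul_continuous (smoothPer_linPot hf (ω ξ) hφ).continuous hΦ.memLp),
      coeff_multiplier he hθ hΦ, coeff_linPot_mul hf (ω ξ) hφ hΦ.memLp, ← hcoef k]
    ring
  filter_upwards [h0] with x hx
  exact eq_neg_of_add_eq_zero_left hx

/-- The right-hand side is minus the differential at `φ` of `ω'F + A'M`, in the direction `v`. With
`v = Φ` it is the asserted formula; with general `v` it links the form to the conserved quantities.
-/
lemma SmoothWaveCurve.innerPer_linOp (h : SmoothWaveCurve L θ f m I ω A φ) (hI : IsOpen I)
    (he : ∀ κ, θ (-κ) = θ κ) {C : ℝ} (hθ : SymbolBound θ r C) (hf : ContDiff ℝ (⊤ : ℕ∞) f)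
    {ξ : ℝ} (hξ : ξ ∈ I) {v : ℝ → ℝ} (hv : MemLp v 2 (volume.restrict (Ioc 0 L))) :
    innerPer L (linOp L θ f (ω ξ) (φ ξ) (dpar φ ξ)) v
      = -(deriv ω ξ * innerPer L (φ ξ) v + deriv A ξ * innerPer L (fun _ => 1) v) := by
  have hφ := (h.smoothFam hI).smoothPer hξ
  rw [innerPer_congr hL.out (h.linOp_dpar hI he hθ hf hξ) (EventuallyEq.refl _ _)]
  have h1 := innerPer_smul_left L (-1) (fun x => deriv ω ξ * φ ξ x + deriv A ξ * 1) v
  simp only [neg_one_mul] at h1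
  rw [h1, innerPer_add_left hL.out (hφ.memLp.const_mul _) ((SmoothPer.const L 1).memLp.const_mul _) hv,
    innerPer_smul_left, innerPer_smul_left]

/-! ## The Lyapunov functional -/

lemma innerPer_one (L : ℝ) (v : ℝ → ℝ) : innerPer L (fun _ => 1) v = massM L v := by
  simp only [innerPer, one_mul, massM]

lemma massF_eq (L : ℝ) (v : ℝ → ℝ) : massF L v = 1 / 2 * innerPer L v v := by
  rw [innerPer_self, massF]

/-- The functional `E + aF + bM + K (b'M + a'F - c)²`. -/
noncomputable def lyap (L : ℝ) (θ f : ℝ → ℝ) (a b a' b' K c : ℝ) (u : ℝ → ℝ) : ℝ :=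
  energyE L θ f u + a * massF L u + b * massM L u + K * (b' * massM L u + a' * massF L u - c) ^ 2

lemma lyap_congr (θ f : ℝ → ℝ) (a b a' b' K c : ℝ) {u v : ℝ → ℝ} (h : AEEqPer L u v) :
    lyap L θ f a b a' b' K c u = lyap L θ f a b a' b' K c v := by
  have h1 : massM L u = massM L v := integral_congr_per hL.out h fun _ y => y
  have h2 : massF L u = massF L v := by rw [massF_eq, massF_eq, innerPer_congr hL.out h h]
  have h3 : energyE L θ f u = energyE L θ f v := by
    simp only [energyE, kinE, coeff_congr hL.out h, potN_congr hL.out f h]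
  rw [lyap, lyap, h1, h2, h3]

lemma kinE_eq_kinForm {C : ℝ} (hθ : SymbolBound θ r C) (u : Hper L r) :
    kinE L θ u.fn = kinForm θ hθ u u := by
  rw [kinE, ← (kinForm_hasSum hθ u u).tsum_eq]
  refine tsum_congr fun k => ?_
  rw [Complex.mul_conj, Complex.ofReal_re, Complex.sq_norm]

/-- The constant function `1` in `H^r_per`. -/
noncomputable def oneH (L : ℝ) [hL : Fact (0 < L)] (r : ℝ) : Hper L r :=
  Hper.of (fun _ => 1) ((SmoothPer.const L 1).memH hL.out r)

lemma massM_eq_l2Form (u : Hper L r) : massM L u.fn = l2Form (oneH L r) u := by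
  rw [oneH, l2Form_of_left, innerPer_one]

lemma massF_eq_l2Form (u : Hper L r) : massF L u.fn = 1 / 2 * l2Form u u := by
  rw [massF_eq, l2Form_apply]

lemma continuous_form {E : Type*} [NormedAddCommGroup E] [NormedSpace ℝ E]
    {B : E →ₗ[ℝ] E →ₗ[ℝ] ℝ} (hB : ∃ C, ∀ u v, |B u v| ≤ C * ‖u‖ * ‖v‖) :
    Continuous fun p : E × E => B p.1 p.2 := by
  obtain ⟨C, hC⟩ := hB
  let B' : E →L[ℝ] E →L[ℝ] ℝ := LinearMap.mkContinuous₂ B C hC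
  have h : Continuous fun p : E × E => B' p.1 p.2 := by fun_prop
  exact h

lemma continuous_lyap (hr : 0 ≤ r) {C : ℝ} (hθ : SymbolBound θ r C)
    (hN : Continuous fun u : Hper L r => potN L f u.fn) (a b a' b' K c : ℝ) :
    Continuous fun u : Hper L r => lyap L θ f a b a' b' K c u.fn := by
  have hl2 : ∃ D, ∀ u v : Hper L r, |l2Form u v| ≤ D * ‖u‖ * ‖v‖ := potForm_bounded hr _
  have h1 : Continuous fun u : Hper L r => massM L u.fn := by
    simp only [massM_eq_l2Form]
    exact (continuous_form hl2).comp (continuous_const.prodMk continuous_id)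
  have h2 : Continuous fun u : Hper L r => massF L u.fn := by
    simp only [massF_eq_l2Form]
    exact continuous_const.mul ((continuous_form hl2).comp (continuous_id.prodMk continuous_id))
  have h3 : Continuous fun u : Hper L r => energyE L θ f u.fn := by
    simp only [energyE, kinE_eq_kinForm hθ]
    exact (continuous_const.mul ((continuous_form (kinForm_bounded hθ)).comp
      (continuous_id.prodMk continuous_id))).sub hN
  unfold lyap
  fun_prop

/-- Apart from the potential energy, every term depends only on the moduli of the coefficients and
on the mean, which a translation leaves unchanged. -/
lemma lyap_translate {u w : ℝ → ℝ} (hu : MemLp u 2 (volume.restrict (Ioc 0 L)))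
    (hw : MemLp w 2 (volume.restrict (Ioc 0 L))) (a b a' b' K c : ℝ) {y : ℝ}
    (h : ∀ k, coeff L w k = fchar L k y * coeff L u k) (hpot : potN L f w = potN L f u) :
    lyap L θ f a b a' b' K c w = lyap L θ f a b a' b' K c u := by
  have hn : ∀ k, ‖coeff L w k‖ = ‖coeff L u k‖ := fun k => by rw [h, norm_fchar_mul]
  have h1 : massM L w = massM L u := by
    have := h 0
    rw [fchar_zero, one_mul, coeff_zero_index, coeff_zero_index, Complex.ofReal_inj] at this
    exact mul_left_cancel₀ (one_div_ne_zero hL.out.ne') this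
  have h2 : massF L w = massF L u := by
    rw [massF, massF, ← (hasSum_sq_coeff hL.out hw).tsum_eq, ← (hasSum_sq_coeff hL.out hu).tsum_eq]
    simp only [hn]
  have h3 : energyE L θ f w = energyE L θ f u := by simp only [energyE, kinE, hn, hpot]
  rw [lyap, lyap, h1, h2, h3]

theorem IsClassicalSolution.lyap_eq (he : ∀ κ, θ (-κ) = θ κ) {C : ℝ} (hθ : SymbolBound θ r C)
    (hf : ContDiff ℝ (⊤ : ℕ∞) f) {U : ℝ → ℝ → ℝ} (h : IsClassicalSolution L θ f U) {t τ : ℝ}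
    (ht : 0 < t) (hτ : 0 < τ) (a b a' b' K c : ℝ) :
    lyap L θ f a b a' b' K c (U t) = lyap L θ f a b a' b' K c (U τ) := by
  rw [lyap, lyap, h.massM_eq hθ hf ht hτ, h.massF_eq he hθ hf ht hτ, h.energyE_eq he hθ hf ht hτ]

/-- The Lyapunov functional controls the distance to the orbit. -/
theorem exists_lyap_lower (hr : 0 < r) (hrm : m / 2 = r) {C : ℝ} (hsym : IsSymbol θ m)
    (hθ : SymbolBound θ r C) (hf : ContDiff ℝ (⊤ : ℕ∞) f) (hI : IsOpen I)
    (h : SmoothWaveCurve L θ f m I ω A φ) {ξ : ℝ} (hξ : ξ ∈ I) (hφ : SmoothPer L (φ ξ))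
    (hG : Garding L θ f m (ω ξ) (φ ξ)) (hfφ : SmoothPer L fun x => f (φ ξ x))
    (hq' : Continuous fun x => deriv f (φ ξ x)) (hP : PotentialRegular f hφ r hfφ hq')
    (hneg : innerPer L (linOp L θ f (ω ξ) (φ ξ) (dpar φ ξ)) (dpar φ ξ) < 0) :
    ∃ K c₀ : ℝ, ∃ ρ > 0, ∃ c > 0, ∀ u, MemH L r u → orbitDist L r u (φ ξ) < ρ →
      c * orbitDist L r u (φ ξ) ^ 2
        ≤ lyap L θ f (ω ξ) (A ξ) (deriv ω ξ) (deriv A ξ) K c₀ u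
          - lyap L θ f (ω ξ) (A ξ) (deriv ω ξ) (deriv A ξ) K c₀ (φ ξ) := by
  have hL' := hL.out
  have he := hsym.1
  have hm : 0 < m := by linarith
  have hΦ := ((h.smoothFam hI).dpar).smoothPer hξ
  have hq : Continuous (linPot f (ω ξ) (φ ξ)) := (smoothPer_linPot hf (ω ξ) hφ).continuous
  have hpair := gardingPair_linForm hr he hθ hrm hq hG
  obtain ⟨χ, μ, hone⟩ := (h.spectral ξ hξ).oneNegative hm (by linarith) hsym hθ hf hφ hq
  have := Hper.completeSpace (L := L) hr.le
  set B := linForm (L := L) θ hθ (linPot f (ω ξ) (φ ξ)) hq with hB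
  set Φ : Hper L r := Hper.of (dpar φ ξ) (hΦ.memH hL' r) with hΦdef
  set P : Hper L r := Hper.of (φ ξ) (hφ.memH hL' r) with hPdef
  have hBΦ : ∀ v, B Φ v = -(deriv ω ξ * l2Form P v + deriv A ξ * l2Form (oneH L r) v) := fun v => by
    rw [hB, hΦdef, linForm_of_smooth he hθ hq hΦ, ← linOp_eq,
      h.innerPer_linOp hI he hθ hf hξ v.memLp, hPdef, oneH, l2Form_of_left, l2Form_of_left]
  have hneg' : B Φ Φ < 0 := by
    have : B Φ Φ = innerPer L (linOp L θ f (ω ξ) (φ ξ) (dpar φ ξ)) (dpar φ ξ) := by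
      rw [hB, hΦdef, linForm_of_smooth he hθ hq hΦ, ← linOp_eq]
      exact innerPer_congr hL' (EventuallyEq.refl _ _) (Hper.fn_of _)
    rw [this]; exact hneg
  obtain ⟨K, hK, c, hc, hcoer⟩ := hpair.coercive_add_sq hone hneg'
  obtain ⟨δ, hδ, hT⟩ := hP.taylor (c / 8) (by positivity)
  set a' := deriv ω ξ
  set b' := deriv A ξ
  -- The constant `c₀` makes the penalty vanish at `φ`. The radius keeps `v` within the Taylor ball
  -- and makes the quadratic part of the penalized quantity negligible.
  refine ⟨K, b' * massM L (φ ξ) + a' * massF L (φ ξ),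
    min δ (min 1 (c / (2 * K * (a' ^ 2 + 1)))), by positivity, c / 4, by positivity,
    fun u hu hd => ?_⟩
  obtain ⟨v, hv, ⟨y, hy⟩, hpot, hmin⟩ := exists_modulation f hφ hu
  rw [← hv] at hd ⊢
  rw [← lyap_translate hu.1 (Hper.memLp _) _ _ _ _ _ _ hy hpot,
    ← lyap_congr θ f _ _ _ _ _ _ (Hper.fn_of (hφ.memH hL' r))]
  rw [← hPdef]
  have hd1 : ‖v‖ < δ := hd.trans_le (min_le_left _ _)
  have hd2 : ‖v‖ < 1 := hd.trans_le ((min_le_right _ _).trans (min_le_left _ _))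
  have hd3 : ‖v‖ < c / (2 * K * (a' ^ 2 + 1)) :=
    hd.trans_le ((min_le_right _ _).trans (min_le_right _ _))
  rw [lt_div_iff₀ (by positivity)] at hd3
  have hT' := (abs_le.1 (hT v hd1)).2
  rw [← hPdef] at hT'
  -- The weak wave equation: the linear term of the expansion at `φ` vanishes.
  have hwave : kinForm θ hθ P v + ω ξ * l2Form P v + A ξ * l2Form (oneH L r) v
      - l2Form (Hper.of (fun x => f (φ ξ x)) (hfφ.memH hL' r)) v = 0 := by
    have hM := smoothPer_multiplier hθ hφ
    have hMA : MemLp (fun x => multiplier L θ (φ ξ) x + ω ξ * φ ξ x) 2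
        (volume.restrict (Ioc 0 L)) := hM.memLp.add (hφ.memLp.const_mul _)
    have hA1 : MemLp (fun _ : ℝ => A ξ * 1) 2 (volume.restrict (Ioc 0 L)) :=
      (SmoothPer.const L 1).memLp.const_mul _
    rw [hPdef, kinForm_of_smooth he hθ hφ, oneH, l2Form_of_left, l2Form_of_left, l2Form_of_left,
      ← innerPer_smul_left, ← innerPer_smul_left,
      ← innerPer_add_left hL' hM.memLp (hφ.memLp.const_mul _) v.memLp,
      ← innerPer_add_left hL' hMA hA1 v.memLp, sub_eq_zero]
    refine innerPer_congr hL' (ae_of_all _ fun x => ?_) (EventuallyEq.refl _ _)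
    have := h.wave ξ hξ x
    simp only [mul_one]
    linarith
  have hBv : B v v = kinForm θ hθ v v + ω ξ * l2Form v v
      - potForm (fun x => deriv f (φ ξ x)) hq' v v := by
    rw [hB, linForm_apply, add_sub_assoc]
    congr 1
    rw [potForm_apply, potForm_apply, l2Form_apply, ← innerPer_smul_left, eq_sub_iff_add_eq,
      ← innerPer_add_left hL' (memLp_mul_continuous hq v.memLp) (memLp_mul_continuous hq' v.memLp)
        v.memLp]
    congr 1
    ext x
    simp only [linPot]; ring
  have hPN : potN L f P.fn = potN L f (φ ξ) := potN_congr hL' f (Hper.fn_of _)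
  have hPM : massM L (φ ξ) = l2Form (oneH L r) P := by
    rw [← massM_eq_l2Form]
    exact (integral_congr_per hL' (Hper.fn_of (hφ.memH hL' r)) fun _ y => y).symm
  have hPF : massF L (φ ξ) = 1 / 2 * l2Form P P := by
    rw [← massF_eq_l2Form, massF_eq, massF_eq]
    congr 1
    exact innerPer_congr hL' (Hper.fn_of (hφ.memH hL' r)).symm (Hper.fn_of (hφ.memH hL' r)).symm
  have hkin : kinForm θ hθ v P = kinForm θ hθ P v := kinForm_symm hθ v P
  have hl2 : l2Form v P = l2Form P v := potForm_symm _ v P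
  obtain ⟨t, ht⟩ := hcoer v
  -- Coercivity holds only for `v - t ψ` with some uncontrolled `t`; modulation gives `‖v‖ ≤ ‖v - t
  -- ψ‖` for every `t`.
  have hcv : c * ‖v‖ ^ 2 ≤ B v v + K * B Φ v ^ 2 := by
    refine le_trans ?_ ht
    gcongr
    exact hmin t
  have hJ0 : 0 ≤ l2Form v v := by
    rw [l2Form_apply]
    exact intervalIntegral.integral_nonneg hL'.le fun x _ => mul_self_nonneg _
  have hJ : l2Form v v ≤ ‖v‖ ^ 2 := by
    rw [l2Form_apply, innerPer_self]; exact v.integral_sq_le hr.le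
  obtain ⟨X, hX⟩ : ∃ X, X = l2Form v v := ⟨_, rfl⟩
  -- Exact expansion: half the second variation, the Taylor remainder of the potential, and the
  -- penalty, whose linear part is `-B Φ v` and whose quadratic part comes from `F`.
  have hdiff : lyap L θ f (ω ξ) (A ξ) a' b' K (b' * massM L (φ ξ) + a' * massF L (φ ξ)) (P + v).fn
      - lyap L θ f (ω ξ) (A ξ) a' b' K (b' * massM L (φ ξ) + a' * massF L (φ ξ)) P.fn
      = 1 / 2 * B v v - (potN L f (P + v).fn - potN L f (φ ξ)
        - l2Form (Hper.of (fun x => f (φ ξ x)) (hfφ.memH hL' r)) v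
        - 1 / 2 * potForm (fun x => deriv f (φ ξ x)) hq' v v)
        + K * (-B Φ v + 1 / 2 * a' * l2Form v v) ^ 2 := by
    simp only [lyap, energyE, kinE_eq_kinForm hθ, massM_eq_l2Form, massF_eq_l2Form, hPN, hPM, hPF,
      hBΦ, hBv, map_add, LinearMap.add_apply, hkin, hl2]
    linear_combination hwave
  rw [hdiff]
  rw [← hX] at hJ hJ0 ⊢
  set S := B Φ v
  -- The factor `1/2` kept here matches that of `1/2 * B v v`, so `hcv` yields `c/2`. The Taylor
  -- remainder and the correction in `X` cost `c/8` each, leaving `c/4`.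
  have e1 : 1 / 2 * S ^ 2 - (1 / 2 * a' * X) ^ 2 ≤ (-S + 1 / 2 * a' * X) ^ 2 := by
    nlinarith [sq_nonneg (S - 2 * (1 / 2 * a' * X))]
  have e2 := mul_le_mul_of_nonneg_left e1 hK.le
  have e3 : K * (1 / 2 * a' * X) ^ 2 ≤ c / 8 * ‖v‖ ^ 2 := by
    have n0 := norm_nonneg v
    have i1 : X ^ 2 ≤ ‖v‖ * ‖v‖ ^ 2 := by
      calc X ^ 2 ≤ (‖v‖ ^ 2) ^ 2 := by gcongr
        _ = (‖v‖ * ‖v‖ ^ 2) * ‖v‖ := by ring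
        _ ≤ (‖v‖ * ‖v‖ ^ 2) * 1 := by gcongr
        _ = _ := mul_one _
    calc K * (1 / 2 * a' * X) ^ 2 = 1 / 4 * (K * a' ^ 2) * X ^ 2 := by ring
      _ ≤ 1 / 4 * (K * (a' ^ 2 + 1)) * (‖v‖ * ‖v‖ ^ 2) := by gcongr; linarith
      _ = 1 / 8 * (‖v‖ * (2 * K * (a' ^ 2 + 1))) * ‖v‖ ^ 2 := by ring
      _ ≤ 1 / 8 * c * ‖v‖ ^ 2 := by gcongr
      _ = _ := by ring
  linarith

/-- Continuity of the Lyapunov functional makes its initial excess small, conservation keeps it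
small, and the lower bound turns this into a barrier around the orbit. Well-posedness supplies the
existence of the solution. -/
theorem orbitallyStable_of_neg {s : ℝ} (hm : 0 < m) (hs : m / 2 ≤ s) (hsym : IsSymbol θ m)
    (hf : ContDiff ℝ (⊤ : ℕ∞) f) (hpot : m ≤ 1 → PotentialC2 L f (m / 2))
    (hwp : GloballyWellPosed L θ f s) (hI : IsOpen I)
    (h : SmoothWaveCurve L θ f m I ω A φ) {ξ : ℝ} (hξ : ξ ∈ I)
    (hG : Garding L θ f m (ω ξ) (φ ξ))
    (hneg : innerPer L (linOp L θ f (ω ξ) (φ ξ) (dpar φ ξ)) (dpar φ ξ) < 0) :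
    OrbitallyStable L θ f m s (φ ξ) := by
  have hL' := hL.out
  have he := hsym.1
  have hr : 0 < m / 2 := by linarith
  obtain ⟨C, hθ⟩ := hsym.bound hm
  have hφ := (h.smoothFam hI).smoothPer hξ
  have hfφ : SmoothPer L fun x => f (φ ξ x) := hφ.comp hf
  have hq' : Continuous fun x => deriv f (φ ξ x) := (smoothPer_deriv_comp hf hφ).continuous
  have hP : PotentialRegular f hφ (m / 2) hfφ hq' := by
    rcases le_or_gt m 1 with h1 | h1
    · exact potentialRegular_of_c2 hf hφ hr.le (hpot h1) hfφ hq'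
    · exact potentialRegular_of_half_lt hf hφ (by linarith) hfφ hq'
  obtain ⟨K, c₀, ρ, hρ, c, hc, hlow⟩ :=
    exists_lyap_lower hr rfl hsym hθ hf hI h hξ hφ hG hfφ hq' hP hneg
  set Γ := lyap L θ f (ω ξ) (A ξ) (deriv ω ξ) (deriv A ξ) K c₀ with hΓ
  have hΓc : Continuous fun u : Hper L (m / 2) => Γ u.fn :=
    continuous_lyap hr.le hθ hP.continuous _ _ _ _ _ _
  have hΓof : ∀ {g : ℝ → ℝ} (hg : MemH L (m / 2) g), Γ (Hper.of g hg).fn = Γ g := fun hg =>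
    lyap_congr θ f _ _ _ _ _ _ (Hper.fn_of hg)
  intro ε hε
  -- The barrier radius lies strictly below `ρ`, so that the lower bound applies on the sphere
  -- itself.
  set ε₀ := min ε (ρ / 2) with hε₀
  have hε₀pos : 0 < ε₀ := by positivity
  set P : Hper L (m / 2) := Hper.of (φ ξ) (hφ.memH hL' _) with hPdef
  obtain ⟨δ, hδ, hcont⟩ := Metric.continuousAt_iff.1 (hΓc.continuousAt (x := P)) (c * ε₀ ^ 2)
    (by positivity)
  refine ⟨min δ ε₀, by positivity, fun u₀ hu₀ hnear => ⟨hwp.1 u₀ hu₀, fun u hu hu0 t ht => ?_⟩⟩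
  have hmem : ∀ t, 0 ≤ t → MemH L (m / 2) (u t) := fun t ht => (hu.1 t ht).mono hs
  have hnear0 : ‖Hper.of (u 0) (hmem 0 le_rfl) - P‖ < min δ ε₀ := by
    rw [hPdef, Hper.of_sub, Hper.norm_of]
    refine lt_of_eq_of_lt (sobNorm_congr hL' _ ?_) hnear
    filter_upwards [hu0] with x hx
    rw [hx]
  have hP0 : trans hφ (m / 2) 0 = P := Hper.ext_coeff fun k => by
    rw [coeff_trans, hPdef, Hper.coeff_of]; simp [fchar]
  have hd0 : orbitDist L (m / 2) (u 0) (φ ξ) < ε₀ := by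
    have := orbitDist_le hφ (hmem 0 le_rfl) 0
    rw [hP0] at this
    exact this.trans_lt (hnear0.trans_le (min_le_right _ _))
  have hΓ0 : Γ (u 0) - Γ (φ ξ) < c * ε₀ ^ 2 := by
    have := hcont (x := Hper.of (u 0) (hmem 0 le_rfl)) (by
      rw [dist_eq_norm]; exact hnear0.trans_le (min_le_left _ _))
    rw [Real.dist_eq, hΓof, hPdef, hΓof] at this
    exact (le_abs_self _).trans_lt this
  have hcons : ∀ t, 0 ≤ t → Γ (u t) = Γ (u 0) := fun t ht => by
    have := hu.conserved hs hΓc (fun U hU t τ ht hτ => by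
      rw [hΓof, hΓof]; exact hU.lyap_eq he hθ hf ht hτ _ _ _ _ _ _) ht
    rwa [hΓof, hΓof] at this
  have hdc : ContinuousOn (fun t => orbitDist L (m / 2) (u t) (φ ξ)) (Ici 0) := by
    intro t ht
    rw [ContinuousWithinAt, tendsto_iff_norm_sub_tendsto_zero]
    refine squeeze_zero' (Eventually.of_forall fun _ => norm_nonneg _) ?_ (hu.2.1 t ht)
    filter_upwards [self_mem_nhdsWithin] with τ hτ
    exact (orbitDist_lipschitz hφ (hmem τ hτ) (hmem t ht)).trans
      (sobNorm_mono hL' hs ((hu.1 τ hτ).sub hL' (hu.1 t ht)))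
  by_contra hcon
  have hge : ε₀ ≤ orbitDist L (m / 2) (u t) (φ ξ) := (min_le_left _ _).trans (not_lt.1 hcon)
  -- An escaping solution would be at distance exactly `ε₀` at some time. There the excess is at
  -- least `c ε₀²`, while conservation bounds it by its initial value, which is smaller.
  obtain ⟨τ, hτ, hτd⟩ := intermediate_value_Icc ht (hdc.mono Icc_subset_Ici_self) ⟨hd0.le, hge⟩
  simp only at hτd
  have hfin := hlow (u τ) (hmem τ hτ.1) (by
    rw [hτd]; exact (min_le_right _ _).trans_lt (half_lt_self hρ))
  rw [hτd, hcons τ hτ.1] at hfin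
  linarith

end

end PerWave

/-! ### The derivative formula, the stability criterion and the solitary-wave case. -/

theorem corollary4p2
    (L : ℝ) [Fact (0 < L)]
    (θ f : ℝ → ℝ) (m s : ℝ) (hm : 0 < m) (hs : m / 2 ≤ s)
    (hθ : PerWave.IsSymbol θ m) (hf : ContDiff ℝ (⊤ : ℕ∞) f)
    (hpot : m ≤ 1 → PerWave.PotentialC2 L f (m / 2))
    (hwp : PerWave.GloballyWellPosed L θ f s)
    (I : Set ℝ) (hIo : IsOpen I) (hIc : I.OrdConnected)
    (ω A : ℝ → ℝ) (φ : ℝ → ℝ → ℝ)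
    (hcurve : PerWave.SmoothWaveCurve L θ f m I ω A φ)
    (ξ : ℝ) (hξ : ξ ∈ I)
    (hgard : PerWave.Garding L θ f m (ω ξ) (φ ξ))
    (Φ : ℝ → ℝ) (hΦ : Φ = fun x => deriv (fun ζ => φ ζ x) ξ) :
    DifferentiableAt ℝ (fun ζ => PerWave.massM L (φ ζ)) ξ ∧
    DifferentiableAt ℝ (fun ζ => PerWave.massF L (φ ζ)) ξ ∧
    PerWave.innerPer L (PerWave.linOp L θ f (ω ξ) (φ ξ) Φ) Φ =
      -(deriv A ξ * deriv (fun ζ => PerWave.massM L (φ ζ)) ξ)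
        - deriv ω ξ * deriv (fun ζ => PerWave.massF L (φ ζ)) ξ ∧
    (PerWave.innerPer L (PerWave.linOp L θ f (ω ξ) (φ ξ) Φ) Φ < 0 →
      PerWave.OrbitallyStable L θ f m s (φ ξ)) ∧
    ((∀ ζ ∈ I, A ζ = 0 ∧ ω ζ = ζ) →
      (PerWave.innerPer L (PerWave.linOp L θ f (ω ξ) (φ ξ) Φ) Φ < 0 ↔
        0 < deriv (fun ζ => ∫ x in (0 : ℝ)..L, φ ζ x ^ 2) ξ)) := by
  have hL : 0 < L := Fact.out
  obtain rfl : Φ = PerWave.dpar φ ξ := hΦ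
  obtain ⟨C, hb⟩ := hθ.bound hm
  have hF := hcurve.smoothFam hIo
  have hM := hF.hasDerivAt_massM hL hξ
  have hMF := hF.hasDerivAt_massF hL hξ
  have hSq := hF.hasDerivAt_integral_sq hL hξ
  have hid : PerWave.innerPer L (PerWave.linOp L θ f (ω ξ) (φ ξ) (PerWave.dpar φ ξ))
      (PerWave.dpar φ ξ) =
      -(deriv A ξ * deriv (fun ζ => PerWave.massM L (φ ζ)) ξ)
        - deriv ω ξ * deriv (fun ζ => PerWave.massF L (φ ζ)) ξ := by
    rw [hcurve.innerPer_linOp hIo hθ.1 hb hf hξ (hF.dpar.smoothPer hξ).memLp, hM.deriv, hMF.deriv,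
      PerWave.innerPer_one]
    ring
  refine ⟨hM.differentiableAt, hMF.differentiableAt, hid,
    PerWave.orbitallyStable_of_neg hm hs hθ hf hpot hwp hIo hcurve hξ hgard, fun hsol => ?_⟩
  have hA : deriv A ξ = 0 := by
    have : A =ᶠ[𝓝 ξ] fun _ => 0 := by
      filter_upwards [hIo.mem_nhds hξ] with ζ hζ
      exact (hsol ζ hζ).1
    rw [this.deriv_eq, deriv_const]
  have hω : deriv ω ξ = 1 := by
    have : ω =ᶠ[𝓝 ξ] fun ζ => ζ := by
      filter_upwards [hIo.mem_nhds hξ] with ζ hζ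
      exact (hsol ζ hζ).2
    rw [this.deriv_eq, deriv_id'']
  rw [hid, hA, hω, hMF.deriv, hSq.deriv]
  constructor <;> intro hlt <;> linarith
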